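/- Let $g:[0,1]\to\mathbb R$ be strictly increasing, strictly convex and of class $C^3$ on $[0,1]$, with $g(0)=0$, and let $\gamma$ be its graph. Assume that the curvature of $\gamma$ is bounded from below: there is $K_0>0$ with $g''(u)/(1+g'(u)^2)^{3/2}\ge K_0$ for all $u\in[0,1]$. Put $c_\gamma:=g(1)$, $t_0:=\inf_{[0,1]}g'$, $t_1:=\sup_{[0,1]}g'$ and, for $t\in[0,\infty]$, $$u_\gamma(t):=\sup\{u\in[0,1]:g'(u)\le t\}\quad(\sup\emptyset:=0),\qquad \ell_\gamma(t):=\int_0^{u_\gamma(t)}\sqrt{1+g'(u)^2}\,du .$$ Let $\mathcal X$ be the set of pairs $x=(x_1,x_2)$ of coprime nonnegative integers, with slopes $\tau(x):=x_2/x_1\in[0,\infty]$. A convex lattice polygonal line $\varGamma$ starting at the origin, with finitely many edges, of slopes in $[0,\infty]$, is identified with a finitely supported function $\nu:\mathcal X\to\{0,1,2,\dots\}$: its edges are the vectors $\nu(x)x$ with $\nu(x)>0$, in the order of increasing slope. Let $\mathcal L$ be the set of all such lines, $\xi_\varGamma:=\sum_{x}\nu(x)x$ the right endpoint of $\varGamma$,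 and $\mathcal L_n:=\{\varGamma\in\mathcal L:\xi_\varGamma=n\}$ for $n=(n_1,n_2)$. For $s>0$ let $\ell_{s\varGamma}(t):=\sum_{x:\,\tau(x)\le t}|s\,\nu(x)\,x|$ be the length of the part of $s\varGamma$ where the slope of the edges is at most $t$, and $$d_{\mathcal L}(s\varGamma,\gamma):=\sup_{0\le t\le\infty}|\ell_{s\varGamma}(t)-\ell_\gamma(t)| .$$ Let $\kappa:=(2\zeta(3)/\zeta(2))^{1/3}$, where $\zeta$ is the Riemann zeta function, and $$\delta_1(t):=\kappa\left(\frac{g''(u_\gamma(t))}{(1+t^2)^{3/2}}\right)^{1/3}\frac{c_\gamma\sqrt{1+t^2}}{c_\gamma+t},\qquad \delta_2(t):=\frac{\delta_1(t)}{c_\gamma}\qquad(t_0\le t\le t_1),$$ $\delta_1(t)=\delta_2(t):=+\infty$ for all other $t\in[0,\infty]$. For $n=(n_1,n_2)$ with $n_1,n_2\ge1$ put $c_n:=n_2/n_1$, $\rho_n:=c_\gamma/c_n$, $\alpha_n:=(\rho_nn_1)^{-1/3}$ and, with $e^{-\infty}:=0$, $$z_j(x):=\exp\{-\alpha_n\,\delta_j(\rho_nx_2/x_1)\}\qquad(j=1,2,\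 x\in\mathcal X).$$ With $z^x:=z_1(x)^{x_1}z_2(x)^{x_2}$, let $Q_z^\gamma$ be the measure on $\mathcal L$ given by $Q_z^\gamma(\varGamma):=\prod_{x\in\mathcal X}z^{x\nu(x)}(1-z^x)$, where $z^{x\nu(x)}:=(z^x)^{\nu(x)}$, and let $P_n^\gamma:=Q_z^\gamma(\,\cdot\mid\xi_\varGamma=n)$ be the conditional measure on $\mathcal L_n$. Then, for every $\varepsilon>0$, as $n_1\to\infty$ and $n_2/n_1\to c_\gamma$, $$P_n^\gamma\{\varGamma\in\mathcal L_n: d_{\mathcal L}(n_1^{-1}\varGamma,\gamma)\le\varepsilon\}\longrightarrow 1 .$$ The same holds if $z_2(x)$ is replaced by $\exp\{-\alpha_n\rho_n\,\delta_2(\rho_nx_2/x_1)\}$, that is, if $z^x=\exp\{-\alpha_n(x_1\delta_1(\tau)+\rho_nx_2\delta_2(\tau))\}$ with $\tau=\rho_nx_2/x_1$. -/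

import Mathlib

open Set Filter Topology MeasureTheory
open scoped ENNReal

namespace LatticePaths

noncomputable section

/-! ### The curve `γ`: the graph over `[0,1]` of a convex function `g` -/

/-- First derivative of `g` on the closed interval `[0,1]` (one-sided at the end points). -/
def slopeFn (g : ℝ → ℝ) (u : ℝ) : ℝ := derivWithin g (Icc 0 1) u

/-- Second derivative of `g` on `[0,1]`. -/
def slopeFn' (g : ℝ → ℝ) (u : ℝ) : ℝ := derivWithin (slopeFn g) (Icc 0 1) u

/-- Curvature of the graph of `g` at the point with abscissa `u`. -/
def curvature (g : ℝ → ℝ) (u : ℝ) : ℝ :=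
  slopeFn' g u / (1 + slopeFn g u ^ 2) ^ (3 / 2 : ℝ)

/-- The smallest tangent slope `t₀`. -/
def minSlope (g : ℝ → ℝ) : ℝ := sInf (slopeFn g '' Icc 0 1)

/-- The largest tangent slope `t₁`. -/
def maxSlope (g : ℝ → ℝ) : ℝ := sSup (slopeFn g '' Icc 0 1)

/-- `u_γ(t) = sup {u ∈ [0,1] : g'(u) ≤ t}` for `t ∈ [0,∞]`, with `sup ∅ = 0`. -/
def uParam (g : ℝ → ℝ) (t : ℝ≥0∞) : ℝ :=
  sSup {u : ℝ | u ∈ Icc (0 : ℝ) 1 ∧ ENNReal.ofReal (slopeFn g u) ≤ t}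

/-- `ℓ_γ(t)`: the length of the part of the curve where the tangent slope is at most `t`. -/
def curveLength (g : ℝ → ℝ) (t : ℝ≥0∞) : ℝ :=
  ∫ u in (0 : ℝ)..uParam g t, Real.sqrt (1 + slopeFn g u ^ 2)

/-! ### Convex lattice polygonal lines -/

/-- Pairs of coprime nonnegative integers (`(0,1)` and `(1,0)` belong, `(0,0)` does not). -/
abbrev Direction : Type := {x : ℕ × ℕ // Nat.Coprime x.1 x.2}

/-- The slope `x₂/x₁ ∈ [0,∞]` (division in `[0,∞]`, so that `(0,1)` has slope `∞`). -/
def edgeSlope (x : Direction) : ℝ≥0∞ := (x.1.2 : ℝ≥0∞) / (x.1.1 : ℝ≥0∞)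

/-- The convex lattice polygonal lines with finitely many edges that start at the origin and whose
edges have slopes in `[0,∞]`.  Such a line is the same as a finitely supported function `ν` on the
set of directions: its edges are the vectors `ν(x) x` with `ν(x) > 0`, arranged in the order of
increasing slope. -/
abbrev PolyLine : Type := Direction →₀ ℕ

/-- Every set of polygonal lines is an event. -/
instance : MeasurableSpace PolyLine := ⊤

/-- The right end point `ξ = ∑ ν(x) x`. -/
def endpoint (Γ : PolyLine) : ℕ × ℕ := Γ.sum fun x k => k • x.1

/-- The lines whose right end point is `n`. -/
def linesTo (n : ℕ × ℕ) : Set PolyLine := {Γ | endpoint Γ = n}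

open Classical in
/-- The length of the part of the scaled line `s Γ` (with edges `s ν(x) x`) where the slope of the
edges is at most `t`. -/
def polyLength (s : ℝ) (Γ : PolyLine) (t : ℝ≥0∞) : ℝ :=
  Γ.sum fun x k =>
    if edgeSlope x ≤ t then Real.sqrt ((s * k * x.1.1) ^ 2 + (s * k * x.1.2) ^ 2) else 0

/-- The distance `d_L(s Γ, γ) = sup_{0 ≤ t ≤ ∞} |ℓ_{sΓ}(t) - ℓ_γ(t)|`, a number in `[0,∞]`. -/
def distL (s : ℝ) (Γ : PolyLine) (g : ℝ → ℝ) : ℝ≥0∞ :=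
  ⨆ t : ℝ≥0∞, ENNReal.ofReal |polyLength s Γ t - curveLength g t|

/-! ### The measures -/

/-- `z^x = z₁(x)^{x₁} z₂(x)^{x₂}` for a parameter function `z`. -/
def zPow (z : Direction → ℝ × ℝ) (x : Direction) : ℝ :=
  (z x).1 ^ x.1.1 * (z x).2 ^ x.1.2

/-- The weight `∏ₓ z^{x ν(x)} (1 - z^x)` of a single line. -/
def weight (z : Direction → ℝ × ℝ) (Γ : PolyLine) : ℝ :=
  ∏' x : Direction, zPow z x ^ Γ x * (1 - zPow z x)

/-- The measure `Q_z` on polygonal lines that gives each line its weight. -/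
def Q (z : Direction → ℝ × ℝ) : Measure PolyLine :=
  Measure.sum fun Γ : PolyLine => ENNReal.ofReal (weight z Γ) • Measure.dirac Γ

/-- The conditional measure `P_n = Q_z( · | ξ = n)`.  (By the conventions of `cond`, it is the zero
measure if `Q_z{ξ = n} = 0`.) -/
def P (z : Direction → ℝ × ℝ) (n : ℕ × ℕ) : Measure PolyLine :=
  ProbabilityTheory.cond (Q z) (linesTo n)

/-! ### The choice of the parameters -/

/-- `κ = (2 ζ(3) / ζ(2))^{1/3}`. -/
def kappa : ℝ := (2 * (riemannZeta 3).re / (riemannZeta 2).re) ^ (1 / 3 : ℝ)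

/-- The curvature as a function of the tangent slope: `g''(u_γ(t)) / (1 + t²)^{3/2}`. -/
def curvatureAtSlope (g : ℝ → ℝ) (t : ℝ≥0∞) : ℝ :=
  slopeFn' g (uParam g t) / (1 + t.toReal ^ 2) ^ (3 / 2 : ℝ)

open Classical in
/-- `δ₁(t) = κ ϰ_γ(t)^{1/3} c_γ √(1+t²) / (c_γ + t)` for `t₀ ≤ t ≤ t₁`, where `c_γ = g(1)`, and
`δ₁(t) = ∞` for all other `t`. -/
def delta₁ (g : ℝ → ℝ) (t : ℝ≥0∞) : ℝ≥0∞ :=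
  if ENNReal.ofReal (minSlope g) ≤ t ∧ t ≤ ENNReal.ofReal (maxSlope g) then
    ENNReal.ofReal (kappa * curvatureAtSlope g t ^ (1 / 3 : ℝ) *
      (g 1 * Real.sqrt (1 + t.toReal ^ 2) / (g 1 + t.toReal)))
  else ⊤

/-- `δ₂ = δ₁ / c_γ`. -/
def delta₂ (g : ℝ → ℝ) (t : ℝ≥0∞) : ℝ≥0∞ := delta₁ g t / ENNReal.ofReal (g 1)

/-- `exp(-a)` for `a ∈ [0,∞]`, with `exp(-∞) = 0`. -/
def expNeg (a : ℝ≥0∞) : ℝ := if a = ⊤ then 0 else Real.exp (-a.toReal)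

/-- `ρ_n = c_γ / c_n`, where `c_n = n₂ / n₁`. -/
def rho (g : ℝ → ℝ) (n : ℕ × ℕ) : ℝ := g 1 / ((n.2 : ℝ) / (n.1 : ℝ))

/-- `α_n = (ρ_n n₁)^{-1/3}`. -/
def alpha (g : ℝ → ℝ) (n : ℕ × ℕ) : ℝ := (rho g n * n.1) ^ (-(1 / 3) : ℝ)

/-- The slope `ρ_n x₂ / x₁ ∈ [0,∞]` of the vector `(x₁, ρ_n x₂)`. -/
def tiltedSlope (g : ℝ → ℝ) (n : ℕ × ℕ) (x : Direction) : ℝ≥0∞ :=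
  ENNReal.ofReal (rho g n * x.1.2) / (x.1.1 : ℝ≥0∞)

/-- The parameters `z_j(x) = exp(-α_n δ_j(ρ_n x₂ / x₁))`. -/
def zParam (g : ℝ → ℝ) (n : ℕ × ℕ) (x : Direction) : ℝ × ℝ :=
  (expNeg (ENNReal.ofReal (alpha g n) * delta₁ g (tiltedSlope g n x)),
   expNeg (ENNReal.ofReal (alpha g n) * delta₂ g (tiltedSlope g n x)))

/-- The variant of the parameters with an additional factor `ρ_n` in the second exponent.  For it,
`z^x = exp(-α_n ⟨(x₁, ρ_n x₂), δ(ρ_n x₂ / x₁)⟩)`. -/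
def zParam' (g : ℝ → ℝ) (n : ℕ × ℕ) (x : Direction) : ℝ × ℝ :=
  (expNeg (ENNReal.ofReal (alpha g n) * delta₁ g (tiltedSlope g n x)),
   expNeg (ENNReal.ofReal (alpha g n * rho g n) * delta₂ g (tiltedSlope g n x)))

end

end LatticePaths

/-! Under `geomMeasure q` the multiplicities of the directions are independent and geometric, and
the quantities of interest (end point, length up to a given slope) are additive functionals `linSum
W`. Their exponential moments are explicit: the partition function is `exp (logPart q)`, and tilting
by `exp (linSum W Γ)` replaces `q x` by `q x * exp (W x)`.

Limits of means. The prescribed parameter of `x` is `exp (-height)` at `α x`, where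
`SlopeModel.height` is homogeneous of degree one. Powers of the parameter are therefore values at
multiples of `x`. Expanding logarithms and means into power series gives sums over coprime vectors
and their multiples `k`, with weights `1/k`. Möbius inversion and Riemann sums
(`tendsto_coprime_sum`) turn these into integrals over the quadrant with the factor `ζ(3)/ζ(2)`, and
in the coordinates `(r, r t)` the radial integral is a Gamma integral. For a functional `x₁
ψ(x₂/x₁)` the mean times `α³` tends to `2ζ(3)/ζ(2) ∫ ψ(t)/E(t)³ dt`. The choice of `δ` amounts to
`E(g'(u)) = κ g''(u)^{1/3}`, so the substitution `t = g'(u)` turns this limit into `∫₀¹ ψ(g'(u)) du`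
(`Admissible.limitMean_eq`). In particular the scaled mean end point tends to `(1, g(1))` and the
scaled mean length up to slope `t` tends to `ℓ_γ(t)`.

Concentration. A Chernoff bound (`geomMeasure_deviation`) shows that a deviation of order `α⁻³`, the
order of the means themselves, has probability at most `exp (-d/α²)` up to a factor `2`, for some `d
> 0`.

Conditioning. Since deviations are exponentially small in `α⁻²`, no local limit theorem is needed:
it is enough that the probability of the end point exceeds `exp (-ε/α²)` for every `ε > 0`
(`SlopeModel.Regime.eventually_le_linesTo`). To see this, take a lattice basis `e`, `f` with nearly
equal slopes and forbid all directions in the narrow closed sector between them. The end point then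
typically misses `n` by about the mean displacement of the forbidden directions, which lies strictly
inside the cone of `e` and `f`. As the determinant is `1`, the gap is exactly a nonnegative integer
combination of `e` and `f`. Emptying the sector and refilling it both cost `exp (-O(width)/α²)`, and
the width is arbitrary.

Conclusion. Length functions are monotone in the slope and `ℓ_γ` is controlled by finitely many
slopes (`Admissible.exists_slope_grid`), so a union bound over a finite grid gives the supremum
distance. The two choices of `z₂` are the cases `σ = 1` and `σ = ρ_n` of one family, and only `σ →
1` matters. -/

namespace LatticePaths

noncomputable section

/-! ### The generating function of multisets and geometric measures -/

section GeneratingFunction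

variable {ι : Type*}

/-- The negative logarithm of the Euler product `∏ (1 - q x)`. -/
def logPart (q : ι → ℝ) : ℝ := ∑' x, -Real.log (1 - q x)

lemma summable_neg_log_one_sub {q : ι → ℝ} (hs : Summable q) :
    Summable fun x => -Real.log (1 - q x) := by
  have h : Summable fun x => Real.log (1 + -q x) :=
    Real.summable_log_one_add_of_summable hs.neg
  simpa [sub_eq_add_neg] using h.neg

lemma neg_log_one_sub_nonneg {q : ℝ} (h0 : 0 ≤ q) (h1 : q < 1) : 0 ≤ -Real.log (1 - q) := by
  have := Real.log_nonpos (x := 1 - q) (by linarith) (by linarith)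
  linarith

/-- Induction on `s`: a function supported on `insert x s` is a function supported on `s` together
with its value at `x`, and the sum over that value is a geometric series. In `ℝ≥0∞` no summability
has to be tracked. -/
lemma tsum_finsupp_prod_pow_of_support_subset (a : ι → ℝ≥0∞) (s : Finset ι) :
    ∑' Γ : {Γ : ι →₀ ℕ // Γ.support ⊆ s}, Γ.1.prod (fun x k => a x ^ k)
      = ∏ x ∈ s, (1 - a x)⁻¹ := by
  classical
  induction s using Finset.induction_on with
  | empty =>
    have h0 : ∀ Γ : {Γ : ι →₀ ℕ // Γ.support ⊆ ∅}, Γ = ⟨0, by simp⟩ := by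
      rintro ⟨Γ, h⟩
      have : Γ = 0 := by simpa using h
      subst this; rfl
    rw [tsum_eq_single ⟨0, by simp⟩ (fun b hb => absurd (h0 b) hb)]
    simp
  | insert x s hx ih =>
    let i : ℕ × {Γ : ι →₀ ℕ // Γ.support ⊆ s} → {Γ : ι →₀ ℕ // Γ.support ⊆ insert x s} :=
      fun p => ⟨p.2.1 + Finsupp.single x p.1, by
        refine (Finsupp.support_add).trans (Finset.union_subset ?_ ?_)
        · exact p.2.2.trans (Finset.subset_insert _ _)
        · exact Finsupp.support_single_subset.trans (by simp)⟩
    have hzero : ∀ Γ : {Γ : ι →₀ ℕ // Γ.support ⊆ s}, Γ.1 x = 0 := fun Γ => by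
      by_contra h
      exact hx (Γ.2 (Finsupp.mem_support_iff.2 h))
    have hbij : Function.Bijective i := by
      constructor
      · rintro ⟨k, Γ⟩ ⟨k', Γ'⟩ h
        have h1 : Γ.1 + Finsupp.single x k = Γ'.1 + Finsupp.single x k' := congrArg Subtype.val h
        have hk : k = k' := by
          have := DFunLike.congr_fun h1 x
          simpa [hzero] using this
        subst hk
        have := add_right_cancel h1
        exact Prod.ext rfl (Subtype.ext this)
      · rintro ⟨Γ, h⟩
        refine ⟨⟨Γ x, ⟨Γ.erase x, ?_⟩⟩, Subtype.ext ?_⟩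
        · rw [Finsupp.support_erase]
          intro y hy
          rw [Finset.mem_erase] at hy
          exact (Finset.mem_insert.1 (h hy.2)).resolve_left hy.1
        · exact Finsupp.erase_add_single x Γ
    rw [← (Equiv.ofBijective i hbij).tsum_eq, ENNReal.tsum_prod', Finset.prod_insert hx]
    have hval : ∀ (k : ℕ) (Γ : {Γ : ι →₀ ℕ // Γ.support ⊆ s}),
        ((Equiv.ofBijective i hbij) (k, Γ)).1.prod (fun x k => a x ^ k)
          = a x ^ k * Γ.1.prod (fun x k => a x ^ k) := by
      intro k Γ
      change (Γ.1 + Finsupp.single x k).prod _ = _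
      rw [Finsupp.prod_add_index' (by simp) (by intros; rw [pow_add]),
        Finsupp.prod_single_index (by simp), mul_comm]
    simp_rw [hval, ENNReal.tsum_mul_left, ih, ENNReal.tsum_mul_right, ENNReal.tsum_geometric]

/-- The Euler product for infinitely many factors. Any finite family of functions has a common
finite support, which gives `≤`; every finite partial product is a subsum of the left side, which
gives `≥`. -/
lemma tsum_finsupp_prod_pow {q : ι → ℝ} (h0 : ∀ x, 0 ≤ q x) (h1 : ∀ x, q x < 1)
    (hs : Summable q) :
    ∑' Γ : ι →₀ ℕ, ENNReal.ofReal (Γ.prod fun x k => q x ^ k)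
      = ENNReal.ofReal (Real.exp (logPart q)) := by
  classical
  have hconv : ∀ Γ : ι →₀ ℕ, ENNReal.ofReal (Γ.prod fun x k => q x ^ k)
      = Γ.prod (fun x k => ENNReal.ofReal (q x) ^ k) := by
    intro Γ
    rw [Finsupp.prod, ENNReal.ofReal_prod_of_nonneg (fun x _ => pow_nonneg (h0 x) _)]
    exact Finset.prod_congr rfl fun x _ => ENNReal.ofReal_pow (h0 x) _
  have hfin : ∀ s : Finset ι, ∏ x ∈ s, (1 - ENNReal.ofReal (q x))⁻¹
      = ENNReal.ofReal (Real.exp (∑ x ∈ s, -Real.log (1 - q x))) := by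
    intro s
    rw [Real.exp_sum, ENNReal.ofReal_prod_of_nonneg (fun x _ => (Real.exp_pos _).le)]
    refine Finset.prod_congr rfl fun x _ => ?_
    have hp : 0 < 1 - q x := by linarith [h1 x]
    rw [Real.exp_neg, Real.exp_log hp, ENNReal.ofReal_inv_of_pos hp, ENNReal.ofReal_sub _ (h0 x),
      ENNReal.ofReal_one]
  have hsum := summable_neg_log_one_sub hs
  have hnn : ∀ x, 0 ≤ -Real.log (1 - q x) := fun x => neg_log_one_sub_nonneg (h0 x) (h1 x)
  simp_rw [hconv]
  apply le_antisymm
  · rw [ENNReal.tsum_eq_iSup_sum]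
    refine iSup_le fun T => ?_
    let s : Finset ι := T.biUnion Finsupp.support
    calc ∑ Γ ∈ T, Γ.prod (fun x k => ENNReal.ofReal (q x) ^ k)
        ≤ ∑' Γ : {Γ : ι →₀ ℕ // Γ.support ⊆ s}, Γ.1.prod (fun x k => ENNReal.ofReal (q x) ^ k) := by
          have hT : ∀ Γ ∈ T, Γ.support ⊆ s := fun Γ hΓ => Finset.subset_biUnion_of_mem _ hΓ
          rw [← Finset.sum_subtype_of_mem (p := fun Γ : ι →₀ ℕ => Γ.support ⊆ s)
            (fun Γ : ι →₀ ℕ => Γ.prod (fun x k => ENNReal.ofReal (q x) ^ k)) hT]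
          exact ENNReal.sum_le_tsum _
      _ = ENNReal.ofReal (Real.exp (∑ x ∈ s, -Real.log (1 - q x))) := by
          rw [tsum_finsupp_prod_pow_of_support_subset, hfin]
      _ ≤ _ := by
          refine ENNReal.ofReal_le_ofReal (Real.exp_le_exp.2 ?_)
          exact hsum.sum_le_tsum _ (fun x _ => hnn x)
  · have hlim : Tendsto (fun s : Finset ι =>
        ENNReal.ofReal (Real.exp (∑ x ∈ s, -Real.log (1 - q x)))) atTop
        (𝓝 (ENNReal.ofReal (Real.exp (logPart q)))) :=
      (ENNReal.continuous_ofReal.tendsto _).comp ((Real.continuous_exp.tendsto _).comp hsum.hasSum)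
    refine le_of_tendsto' hlim fun s => ?_
    rw [← hfin, ← tsum_finsupp_prod_pow_of_support_subset]
    exact ENNReal.tsum_comp_le_tsum_of_injective Subtype.val_injective
      (fun Γ : ι →₀ ℕ => Γ.prod (fun x k => ENNReal.ofReal (q x) ^ k))

end GeneratingFunction

/-- The weight of a polygonal line under independent geometric multiplicities. -/
def geomWeight (q : Direction → ℝ) (Γ : PolyLine) : ℝ :=
  Real.exp (-logPart q) * Γ.prod fun x k => q x ^ k

/-- The law of a polygonal line with independent geometric multiplicities. -/
def geomMeasure (q : Direction → ℝ) : Measure PolyLine :=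
  Measure.sum fun Γ : PolyLine => ENNReal.ofReal (geomWeight q Γ) • Measure.dirac Γ

/-- The product splits into the powers, of which only finitely many differ from `1`, and the
normalising product, which converges because the logarithms are summable. -/
lemma weight_eq_geomWeight {z : Direction → ℝ × ℝ} {q : Direction → ℝ} (hz : ∀ x, zPow z x = q x)
    (h1 : ∀ x, q x < 1) (hs : Summable q) (Γ : PolyLine) :
    weight z Γ = geomWeight q Γ := by
  have hpos : ∀ x, 0 < 1 - q x := fun x => by linarith [h1 x]
  have hlog : Summable fun x => Real.log (1 - q x) := by
    simpa using (summable_neg_log_one_sub hs).neg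
  have hfin : (Function.mulSupport fun x => q x ^ Γ x).Finite := by
    refine Γ.support.finite_toSet.subset fun x hx => ?_
    simp only [Finset.mem_coe, Finsupp.mem_support_iff]
    rintro h
    simp [h] at hx
  unfold weight geomWeight
  simp_rw [hz]
  rw [Multipliable.tprod_mul (multipliable_of_hasFiniteMulSupport hfin)
    (Real.multipliable_of_summable_log hpos hlog), ← Real.rexp_tsum_eq_tprod hpos hlog, mul_comm]
  congr 1
  · rw [logPart, tsum_neg, neg_neg]
  · rw [tprod_eq_prod (s := Γ.support)]
    · rfl
    · intro x hx
      simp [Finsupp.notMem_support_iff.1 hx]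

lemma Q_eq_geomMeasure {z : Direction → ℝ × ℝ} {q : Direction → ℝ} (hz : ∀ x, zPow z x = q x)
    (h1 : ∀ x, q x < 1) (hs : Summable q) : Q z = geomMeasure q := by
  unfold Q geomMeasure
  simp_rw [weight_eq_geomWeight hz h1 hs]

lemma geomMeasure_apply (q : Direction → ℝ) (A : Set PolyLine) :
    geomMeasure q A = ∑' Γ : PolyLine, A.indicator (fun Γ => ENNReal.ofReal (geomWeight q Γ)) Γ := by
  rw [geomMeasure, Measure.sum_apply _ (MeasurableSpace.measurableSet_top)]
  refine tsum_congr fun Γ => ?_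
  rw [Measure.smul_apply, Measure.dirac_apply' _ (MeasurableSpace.measurableSet_top)]
  by_cases h : Γ ∈ A <;> simp [h]

lemma isProbabilityMeasure_geomMeasure {q : Direction → ℝ} (h0 : ∀ x, 0 ≤ q x)
    (h1 : ∀ x, q x < 1) (hs : Summable q) : IsProbabilityMeasure (geomMeasure q) := by
  constructor
  rw [geomMeasure_apply]
  simp only [indicator_univ, geomWeight]
  simp_rw [ENNReal.ofReal_mul (Real.exp_pos _).le]
  rw [ENNReal.tsum_mul_left, tsum_finsupp_prod_pow h0 h1 hs,
    ← ENNReal.ofReal_mul (Real.exp_pos _).le, ← Real.exp_add]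
  simp

/-- The additive functional `∑ ν(x) W(x)` of a polygonal line. -/
def linSum (W : Direction → ℝ) (Γ : PolyLine) : ℝ := Γ.sum fun x k => k * W x

/-- The exponential Markov inequality for additive functionals. -/
lemma geomMeasure_le_exp {q W : Direction → ℝ} (h0 : ∀ x, 0 ≤ q x)
    (h1 : ∀ x, q x * Real.exp (W x) < 1) (hs : Summable fun x => q x * Real.exp (W x)) (A : ℝ) :
    geomMeasure q {Γ | A ≤ linSum W Γ} ≤
      ENNReal.ofReal (Real.exp (-A + logPart (fun x => q x * Real.exp (W x)) - logPart q)) := by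
  -- Tilting preserves the product form, so the exponential moment is again an Euler product.
  have hprod : ∀ Γ : PolyLine, Γ.prod (fun x k => (q x * Real.exp (W x)) ^ k)
      = (Γ.prod fun x k => q x ^ k) * Real.exp (linSum W Γ) := by
    intro Γ
    rw [linSum, Finsupp.sum, Real.exp_sum, Finsupp.prod, Finsupp.prod, ← Finset.prod_mul_distrib]
    refine Finset.prod_congr rfl fun x _ => ?_
    rw [mul_pow, ← Real.exp_nat_mul]
  have hpt : ∀ Γ : PolyLine,
      ({Γ | A ≤ linSum W Γ} : Set PolyLine).indicator (fun Γ => ENNReal.ofReal (geomWeight q Γ)) Γ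
        ≤ ENNReal.ofReal (Real.exp (-A - logPart q)) *
          ENNReal.ofReal (Γ.prod fun x k => (q x * Real.exp (W x)) ^ k) := by
    intro Γ
    by_cases h : A ≤ linSum W Γ
    · rw [indicator_of_mem (by exact h), ← ENNReal.ofReal_mul (Real.exp_pos _).le]
      refine ENNReal.ofReal_le_ofReal ?_
      rw [hprod, geomWeight]
      have hP : 0 ≤ Γ.prod fun x k => q x ^ k := Finset.prod_nonneg fun x _ => pow_nonneg (h0 x) _
      have hE : Real.exp (-logPart q) ≤
          Real.exp (-A - logPart q) * Real.exp (linSum W Γ) := by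
        rw [← Real.exp_add]
        exact Real.exp_le_exp.2 (by linarith)
      nlinarith [mul_le_mul_of_nonneg_right hE hP]
    · rw [indicator_of_notMem (by exact h)]
      exact zero_le
  rw [geomMeasure_apply]
  refine (ENNReal.tsum_le_tsum hpt).trans ?_
  rw [ENNReal.tsum_mul_left, tsum_finsupp_prod_pow
    (fun x => mul_nonneg (h0 x) (Real.exp_pos _).le) h1 hs,
    ← ENNReal.ofReal_mul (Real.exp_pos _).le, ← Real.exp_add]
  refine ENNReal.ofReal_le_ofReal (Real.exp_le_exp.2 ?_)
  linarith

/-- A one-term bound for the cumulant generating function of a geometric variable. -/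
lemma neg_log_tilt_le {q v r : ℝ} (h0 : 0 ≤ q) (hr : q * Real.exp |v| ≤ r) (hr1 : r < 1) :
    -Real.log (1 - q * Real.exp v) ≤
      -Real.log (1 - q) + v * (q / (1 - q)) + v ^ 2 * (r / (1 - r) ^ 2) := by
  have hev : Real.exp v ≤ Real.exp |v| := Real.exp_le_exp.2 (le_abs_self v)
  have h1e : 1 ≤ Real.exp |v| := Real.one_le_exp (abs_nonneg v)
  have hqr : q ≤ r := le_trans (by nlinarith) hr
  have hqv : q * Real.exp v ≤ r := le_trans (mul_le_mul_of_nonneg_left hev h0) hr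
  have hp : 0 < 1 - q := by linarith
  have hpv : 0 < 1 - q * Real.exp v := by linarith
  have hpr : 0 < 1 - r := by linarith
  -- The bound `log y ≤ y - 1` at the ratio of the two arguments is sharp to first order in `v`;
  -- `e3` below separates the mean `v q/(1-q)` from a remainder quadratic in `v`.
  have hlog := Real.log_le_sub_one_of_pos (div_pos hp hpv)
  rw [Real.log_div hp.ne' hpv.ne'] at hlog
  have e1 : (1 - q) / (1 - q * Real.exp v) - 1
      = q * (Real.exp v - 1) / (1 - q * Real.exp v) := by field_simp; ring
  have hexp1 : Real.exp v - 1 ≤ v * Real.exp v := by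
    have := Real.add_one_le_exp (-v)
    rw [Real.exp_neg] at this
    have he := Real.exp_pos v
    have h2 : (-v + 1) * Real.exp v ≤ 1 := by
      calc (-v + 1) * Real.exp v ≤ (Real.exp v)⁻¹ * Real.exp v := by gcongr
        _ = 1 := inv_mul_cancel₀ he.ne'
    linarith
  have e2 : q * (Real.exp v - 1) / (1 - q * Real.exp v) ≤
      q * (v * Real.exp v) / (1 - q * Real.exp v) := by gcongr
  have e3 : q * (v * Real.exp v) / (1 - q * Real.exp v) = v * (q / (1 - q)) +
      q * (v * (Real.exp v - 1)) / ((1 - q * Real.exp v) * (1 - q)) := by field_simp; ring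
  have hquad : v * (Real.exp v - 1) ≤ v ^ 2 * Real.exp |v| := by
    rcases le_total 0 v with h | h
    · rw [abs_of_nonneg h]
      nlinarith
    · have := Real.add_one_le_exp v
      nlinarith [mul_nonneg (neg_nonneg.2 h) (by linarith : 0 ≤ Real.exp v - 1 - v),
        sq_nonneg v]
  have e4 : q * (v * (Real.exp v - 1)) / ((1 - q * Real.exp v) * (1 - q)) ≤
      v ^ 2 * r / ((1 - r) * (1 - r)) := by
    have hn : q * (v * (Real.exp v - 1)) ≤ v ^ 2 * r := by
      nlinarith [mul_le_mul_of_nonneg_left hquad h0, mul_le_mul_of_nonneg_left hr (sq_nonneg v)]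
    have hn0 : 0 ≤ v ^ 2 * r := mul_nonneg (sq_nonneg v) (h0.trans hqr)
    exact div_le_div₀ hn0 hn (mul_pos hpr hpr)
      (mul_le_mul (by linarith) (by linarith) hpr.le hpv.le)
  have e5 : v ^ 2 * (r / (1 - r) ^ 2) = v ^ 2 * r / ((1 - r) * (1 - r)) := by
    rw [sq (1 - r), mul_div_assoc]
  rw [e5]
  linarith

/-! ### Exponential sums over the lattice -/

/-- The fraction is `1 / (2 sinh (b/2))²`, and `b/2 ≤ sinh (b/2)`. -/
lemma sq_mul_exp_div_le {b : ℝ} (hb : 0 < b) :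
    b ^ 2 * (Real.exp (-b) / (1 - Real.exp (-b)) ^ 2) ≤ 1 := by
  have h1 : Real.exp (-b) < 1 := Real.exp_lt_one_iff.2 (by linarith)
  have hs := Real.self_le_sinh_iff.2 (by positivity : 0 ≤ b / 2)
  rw [Real.sinh_eq] at hs
  have hle : b ≤ Real.exp (b / 2) - Real.exp (-(b / 2)) := by linarith
  have e1 : Real.exp (-b) = Real.exp (-(b / 2)) ^ 2 := by rw [← Real.exp_nat_mul]; congr 1; ring
  have e2 : Real.exp (b / 2) * Real.exp (-(b / 2)) = 1 := by rw [← Real.exp_add]; simp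
  have hp : 0 < (1 - Real.exp (-b)) ^ 2 := by have : 0 < 1 - Real.exp (-b) := by linarith
                                              positivity
  rw [← mul_div_assoc, div_le_one hp]
  have e3 : 1 - Real.exp (-b) =
      Real.exp (-(b / 2)) * (Real.exp (b / 2) - Real.exp (-(b / 2))) := by
    rw [e1]; linear_combination -e2
  rw [e3, mul_pow, ← e1, mul_comm]
  exact mul_le_mul_of_nonneg_left (pow_le_pow_left₀ hb.le hle 2) (Real.exp_pos _).le

/-- Applying the preceding bound at `b/2` leaves a factor `exp (-b/2)` unused; this decay makes
second-order terms summable over the lattice. -/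
lemma sq_mul_exp_div_le_exp {b : ℝ} (hb : 0 < b) :
    b ^ 2 * (Real.exp (-b) / (1 - Real.exp (-b)) ^ 2) ≤ 4 * Real.exp (-(b / 2)) := by
  have h := sq_mul_exp_div_le (half_pos hb)
  set u := Real.exp (-(b / 2)) with hu
  have hu0 : 0 < u := Real.exp_pos _
  have hu1 : u < 1 := Real.exp_lt_one_iff.2 (by linarith)
  have e1 : Real.exp (-b) = u ^ 2 := by rw [hu, ← Real.exp_nat_mul]; congr 1; ring
  rw [e1]
  have hp : 0 < (1 - u) ^ 2 := by have : 0 < 1 - u := by linarith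
                                  positivity
  have h2 : u ^ 2 / (1 - u ^ 2) ^ 2 ≤ u * (u / (1 - u) ^ 2) := by
    rw [← mul_div_assoc, ← sq]
    refine div_le_div_of_nonneg_left (sq_nonneg u) hp ?_
    exact pow_le_pow_left₀ (by linarith) (by nlinarith) 2
  calc b ^ 2 * (u ^ 2 / (1 - u ^ 2) ^ 2) ≤ b ^ 2 * (u * (u / (1 - u) ^ 2)) := by gcongr
    _ = 4 * u * ((b / 2) ^ 2 * (u / (1 - u) ^ 2)) := by ring
    _ ≤ 4 * u * 1 := by gcongr
    _ = 4 * u := by ring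

lemma hasSum_exp_lattice {b : ℝ} (hb : 0 < b) :
    HasSum (fun p : ℕ × ℕ => Real.exp (-(b * (p.1 + p.2))))
      ((1 - Real.exp (-b))⁻¹ * (1 - Real.exp (-b))⁻¹) := by
  have h := hasSum_geometric_of_lt_one (Real.exp_pos (-b)).le (Real.exp_lt_one_iff.2 (by linarith))
  have h2 := h.mul h (h.summable.mul_of_nonneg h.summable
    (fun n => pow_nonneg (Real.exp_pos _).le n) (fun n => pow_nonneg (Real.exp_pos _).le n))
  refine h2.congr_fun fun p => ?_
  rw [← Real.exp_nat_mul, ← Real.exp_nat_mul, ← Real.exp_add]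
  congr 1; ring

lemma summable_exp_lattice {b : ℝ} (hb : 0 < b) :
    Summable fun p : ℕ × ℕ => Real.exp (-(b * (p.1 + p.2))) := (hasSum_exp_lattice hb).summable

/-- Without the origin the bound is of order `b⁻²` for all `b > 0`, large ones included. With the
origin the sum would stay above `1`, and the later sums over all scales `b = c α k m` would have no
summable majorant. -/
lemma tsum_exp_lattice_ne_zero_le {b : ℝ} (hb : 0 < b) :
    ∑' p : ℕ × ℕ, (if p = 0 then 0 else Real.exp (-(b * (p.1 + p.2)))) ≤ 2 / b ^ 2 := by
  have h := (hasSum_exp_lattice hb)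
  have hite := h.summable.tsum_eq_add_tsum_ite (0 : ℕ × ℕ)
  have hval := h.tsum_eq
  have h0 : (fun p : ℕ × ℕ => if p = 0 then 0 else Real.exp (-(b * (p.1 + p.2)))) =
    fun p : ℕ × ℕ => ite (p = 0) 0 (Real.exp (-(b * (p.1 + p.2)))) := rfl
  rw [hval] at hite
  have hone : Real.exp (-(b * ((((0 : ℕ × ℕ).1 : ℕ) : ℝ) + (((0 : ℕ × ℕ).2 : ℕ) : ℝ)))) = 1 := by
    simp
  rw [hone] at hite
  have hT : ∑' p : ℕ × ℕ, (if p = 0 then 0 else Real.exp (-(b * (p.1 + p.2)))) =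
      (1 - Real.exp (-b))⁻¹ * (1 - Real.exp (-b))⁻¹ - 1 := by linarith
  rw [hT]
  have hk := sq_mul_exp_div_le hb
  set u := Real.exp (-b)
  have hu1 : u < 1 := Real.exp_lt_one_iff.2 (by linarith)
  have hp : 0 < 1 - u := by linarith
  have e : (1 - u)⁻¹ * (1 - u)⁻¹ - 1 ≤ 2 * (u / (1 - u) ^ 2) := by
    have : (1 - u)⁻¹ * (1 - u)⁻¹ - 1 = (2 * u - u ^ 2) / (1 - u) ^ 2 := by field_simp; ring
    rw [this, ← mul_div_assoc]
    gcongr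
    nlinarith [sq_nonneg u]
  rw [le_div_iff₀ (by positivity)]
  nlinarith [mul_le_mul_of_nonneg_right e (sq_nonneg b)]

/-- The quadrant of vectors with nonnegative coordinates. -/
def quadrant : Set (ℝ × ℝ) := Ici 0 ×ˢ Ici 0

lemma measurableSet_quadrant : MeasurableSet quadrant := measurableSet_Ici.prod measurableSet_Ici

/-- The fibres of the floor map are squares of side `h`. A Riemann sum thus becomes the integral of
a step function, to which dominated convergence applies. -/
lemma map_floor_quadrant {h : ℝ} (hh : 0 < h) :
    (volume.restrict quadrant).map (fun x : ℝ × ℝ => (⌊x.1 / h⌋₊, ⌊x.2 / h⌋₊)) =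
      ENNReal.ofReal (h ^ 2) • (Measure.count : Measure (ℕ × ℕ)) := by
  have hm : Measurable (fun x : ℝ × ℝ => (⌊x.1 / h⌋₊, ⌊x.2 / h⌋₊)) := by fun_prop
  refine Measure.ext_of_singleton fun p => ?_
  rw [Measure.map_apply hm (measurableSet_singleton p),
    Measure.restrict_apply (hm (measurableSet_singleton p))]
  have hset : (fun x : ℝ × ℝ => (⌊x.1 / h⌋₊, ⌊x.2 / h⌋₊)) ⁻¹' {p} ∩ quadrant =
      Ico (p.1 * h) ((p.1 + 1) * h) ×ˢ Ico (p.2 * h) ((p.2 + 1) * h) := by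
    have key : ∀ (y : ℝ) (k : ℕ), (⌊y / h⌋₊ = k ∧ 0 ≤ y) ↔ (k * h ≤ y ∧ y < (k + 1) * h) := by
      intro y k
      constructor
      · rintro ⟨h1, h2⟩
        rw [Nat.floor_eq_iff (div_nonneg h2 hh.le), le_div_iff₀ hh, div_lt_iff₀ hh] at h1
        exact h1
      · rintro ⟨h1, h2⟩
        have h3 : 0 ≤ y := le_trans (by positivity) h1
        refine ⟨?_, h3⟩
        rw [Nat.floor_eq_iff (div_nonneg h3 hh.le), le_div_iff₀ hh, div_lt_iff₀ hh]
        exact ⟨h1, h2⟩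
    ext x
    simp only [quadrant, mem_inter_iff, mem_preimage, mem_singleton_iff, mem_prod, mem_Ici, mem_Ico,
      Prod.ext_iff, ← key]
    tauto
  rw [hset, Measure.volume_eq_prod, Measure.prod_prod, Real.volume_Ico, Real.volume_Ico,
    Measure.smul_apply, Measure.count_singleton, ← ENNReal.ofReal_mul (by linarith)]
  simp only [smul_eq_mul, mul_one]
  congr 1; ring

lemma integral_floor_quadrant {h : ℝ} (hh : 0 < h) {f : ℕ × ℕ → ℝ} (hf : Summable f) :
    ∫ x in quadrant, f (⌊x.1 / h⌋₊, ⌊x.2 / h⌋₊) = h ^ 2 * ∑' p, f p := by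
  have hm : Measurable (fun x : ℝ × ℝ => (⌊x.1 / h⌋₊, ⌊x.2 / h⌋₊)) := by fun_prop
  have hi : Integrable f (Measure.count : Measure (ℕ × ℕ)) :=
    integrable_count_iff.2 hf.norm
  rw [← integral_map (φ := fun x : ℝ × ℝ => (⌊x.1 / h⌋₊, ⌊x.2 / h⌋₊)) hm.aemeasurable
    (Measurable.of_discrete.aestronglyMeasurable), map_floor_quadrant hh, integral_smul_measure,
    integral_countable hi, ENNReal.toReal_ofReal (by positivity), smul_eq_mul]
  simp [Measure.real]

lemma abs_tsum_lattice_le {f : ℕ × ℕ → ℝ} {C b : ℝ} (hb : 0 < b) (h0 : f 0 = 0)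
    (hf : ∀ p, |f p| ≤ C * Real.exp (-(b * (p.1 + p.2)))) :
    Summable f ∧ |∑' p, f p| ≤ 2 * C / b ^ 2 := by
  have hC : 0 ≤ C := by
    have := (abs_nonneg _).trans (hf 0)
    simpa using this
  have hs : Summable fun p : ℕ × ℕ => C * Real.exp (-(b * (p.1 + p.2))) :=
    (summable_exp_lattice hb).mul_left C
  have hsf : Summable f := Summable.of_norm_bounded hs hf
  refine ⟨hsf, ?_⟩
  have hs' : Summable fun p : ℕ × ℕ => C * (if p = 0 then 0 else Real.exp (-(b * (p.1 + p.2)))) := by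
    refine Summable.mul_left C (Summable.of_nonneg_of_le ?_ ?_ (summable_exp_lattice hb))
    · intro p; split_ifs; exacts [le_rfl, (Real.exp_pos _).le]
    · intro p; split_ifs; exacts [(Real.exp_pos _).le, le_rfl]
  have hle := tsum_of_norm_bounded hs'.hasSum (f := f) (fun p => by
    by_cases hp : p = 0
    · simp [hp, h0]
    · simpa [hp] using hf p)
  rw [Real.norm_eq_abs, tsum_mul_left] at hle
  refine hle.trans ((mul_le_mul_of_nonneg_left (tsum_exp_lattice_ne_zero_le hb) hC).trans_eq ?_)
  ring

/-- Riemann sums of exponentially decaying functions over the quadrant, with varying integrands. -/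
lemma tendsto_riemann_sum {F : ℕ → ℝ × ℝ → ℝ} {F₀ : ℝ × ℝ → ℝ} {h : ℕ → ℝ} {C c : ℝ} (hc : 0 < c)
    (hpos : ∀ i, 0 < h i) (hlim : Tendsto h atTop (𝓝 0))
    (hF : ∀ i y, 0 ≤ y.1 → 0 ≤ y.2 → |F i y| ≤ C * Real.exp (-(c * (y.1 + y.2))))
    (hconv : ∀ᵐ x ∂(volume.restrict quadrant), ∀ y : ℕ → ℝ × ℝ, Tendsto y atTop (𝓝 x) →
      Tendsto (fun i => F i (y i)) atTop (𝓝 (F₀ x))) :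
    Tendsto (fun i => h i ^ 2 * ∑' p : ℕ × ℕ, F i (h i * p.1, h i * p.2)) atTop
      (𝓝 (∫ x in quadrant, F₀ x)) := by
  have hC : 0 ≤ C := by
    have := (abs_nonneg _).trans (hF 0 (0, 0) le_rfl le_rfl)
    simpa using this
  have hsum : ∀ i, Summable fun p : ℕ × ℕ => F i (h i * p.1, h i * p.2) := by
    intro i
    refine Summable.of_norm_bounded ((summable_exp_lattice (mul_pos hc (hpos i))).mul_left C) ?_
    intro p
    have := hF i (h i * p.1, h i * p.2) (mul_nonneg (hpos i).le (Nat.cast_nonneg _))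
      (mul_nonneg (hpos i).le (Nat.cast_nonneg _))
    refine this.trans_eq ?_
    congr 3; simp only; ring
  have heq : ∀ i, h i ^ 2 * ∑' p : ℕ × ℕ, F i (h i * p.1, h i * p.2) =
      ∫ x in quadrant, F i (h i * ⌊x.1 / h i⌋₊, h i * ⌊x.2 / h i⌋₊) := fun i =>
    (integral_floor_quadrant (hpos i) (hsum i)).symm
  simp_rw [heq]
  -- The integrand is evaluated at the lower corner of the cell of `x`, which is why `hconv` allows
  -- moving arguments. Once `h i < 1` each coordinate drops by at most `1`, whence the factor `exp
  -- (2c)` in the majorant.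
  refine tendsto_integral_filter_of_dominated_convergence
    (fun x => C * Real.exp (2 * c) * (Real.exp (-c * x.1) * Real.exp (-c * x.2))) ?_ ?_ ?_ ?_
  · refine Eventually.of_forall fun i => ?_
    have hm : Measurable (fun x : ℝ × ℝ => (⌊x.1 / h i⌋₊, ⌊x.2 / h i⌋₊)) := by fun_prop
    exact ((Measurable.of_discrete (f := fun p : ℕ × ℕ => F i (h i * p.1, h i * p.2))).comp
      hm).aestronglyMeasurable
  · have h1 : ∀ᶠ i in atTop, h i < 1 := hlim.eventually (gt_mem_nhds one_pos)
    filter_upwards [h1] with i hi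
    filter_upwards [ae_restrict_mem measurableSet_quadrant] with x hx
    have key : ∀ y : ℝ, y - 1 ≤ h i * ⌊y / h i⌋₊ := by
      intro y
      have := Nat.lt_floor_add_one (y / h i)
      rw [div_lt_iff₀ (hpos i)] at this
      nlinarith
    refine (hF i _ (mul_nonneg (hpos i).le (Nat.cast_nonneg _))
      (mul_nonneg (hpos i).le (Nat.cast_nonneg _))).trans ?_
    rw [mul_assoc, ← Real.exp_add, ← Real.exp_add]
    refine mul_le_mul_of_nonneg_left (Real.exp_le_exp.2 ?_) hC
    have k1 := key x.1
    have k2 := key x.2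
    simp only
    nlinarith
  · refine Integrable.const_mul ?_ _
    rw [quadrant, Measure.volume_eq_prod, ← Measure.prod_restrict]
    have : Integrable (fun y : ℝ => Real.exp (-c * y)) (volume.restrict (Ici 0)) := by
      have := (integrableOn_Ici_iff_integrableOn_Ioi (by simp)).2
        (integrableOn_exp_mul_Ioi (neg_lt_zero.2 hc) 0)
      exact this
    exact this.mul_prod this
  · filter_upwards [hconv, ae_restrict_mem measurableSet_quadrant] with x hx hxq
    refine hx _ (Tendsto.prodMk_nhds ?_ ?_)
    all_goals
      refine tendsto_of_tendsto_of_tendsto_of_le_of_le (g := fun i => _ - h i) (h := fun _ => _)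
        (by simpa using tendsto_const_nhds.sub hlim) tendsto_const_nhds (fun i => ?_) (fun i => ?_)
    · have := Nat.lt_floor_add_one (x.1 / h i)
      rw [div_lt_iff₀ (hpos i)] at this
      nlinarith
    · have := Nat.floor_le (div_nonneg hxq.1 (hpos i).le)
      rw [le_div_iff₀ (hpos i)] at this
      simp only; linarith
    · have := Nat.lt_floor_add_one (x.2 / h i)
      rw [div_lt_iff₀ (hpos i)] at this
      nlinarith
    · have := Nat.floor_le (div_nonneg hxq.2 (hpos i).le)
      rw [le_div_iff₀ (hpos i)] at this
      simp only; linarith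

/-! ### Sums over coprime vectors -/

/-- Every nonzero vector of `ℕ²` is a unique positive multiple of a coprime one. -/
def multiple (p : ℕ+ × Direction) : ℕ × ℕ := ((p.1 : ℕ) * p.2.1.1, (p.1 : ℕ) * p.2.1.2)

lemma multiple_injective : Function.Injective multiple := by
  rintro ⟨d, x, hx⟩ ⟨d', x', hx'⟩ h
  simp only [multiple, Prod.mk.injEq] at h
  have hd : (d : ℕ) = d' := by
    have h1 : Nat.gcd (d * x.1) (d * x.2) = d := by
      rw [Nat.gcd_mul_left, Nat.Coprime.gcd_eq_one hx, mul_one]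
    have h2 : Nat.gcd (d' * x'.1) (d' * x'.2) = d' := by
      rw [Nat.gcd_mul_left, Nat.Coprime.gcd_eq_one hx', mul_one]
    rw [← h1, ← h2, h.1, h.2]
  have hd' : d = d' := PNat.coe_injective hd
  subst hd'
  have e1 := Nat.eq_of_mul_eq_mul_left d.pos h.1
  have e2 := Nat.eq_of_mul_eq_mul_left d.pos h.2
  exact Prod.ext rfl (Subtype.ext (Prod.ext e1 e2))

lemma mem_range_multiple {p : ℕ × ℕ} (hp : p ≠ 0) : p ∈ range multiple := by
  have hg : 0 < Nat.gcd p.1 p.2 := by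
    rcases Nat.eq_zero_or_pos (Nat.gcd p.1 p.2) with h | h
    · rw [Nat.gcd_eq_zero_iff] at h
      exact absurd (Prod.ext h.1 h.2) hp
    · exact h
  refine ⟨⟨⟨_, hg⟩, ⟨(p.1 / Nat.gcd p.1 p.2, p.2 / Nat.gcd p.1 p.2),
    Nat.coprime_div_gcd_div_gcd hg⟩⟩, ?_⟩
  refine Prod.ext ?_ ?_
  · exact Nat.mul_div_cancel' (Nat.gcd_dvd_left _ _)
  · exact Nat.mul_div_cancel' (Nat.gcd_dvd_right _ _)

lemma tsum_multiple {f : ℕ × ℕ → ℝ} (h0 : f 0 = 0) :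
    ∑' p : ℕ+ × Direction, f (multiple p) = ∑' p, f p :=
  multiple_injective.tsum_eq fun p hp => mem_range_multiple fun h => hp (by rw [h, h0])

/-- Grouping the pairs by their product `n` leaves `c n` times the sum of `μ` over the divisors of
`n`, which vanishes unless `n = 1`. -/
lemma tsum_mul_moebius {c : ℕ+ → ℝ} (hs : Summable fun p : ℕ+ × ℕ+ => c (p.1 * p.2)) :
    Summable (fun p : ℕ+ × ℕ+ => (ArithmeticFunction.moebius p.1 : ℝ) * c (p.1 * p.2)) ∧
    ∑' p : ℕ+ × ℕ+, (ArithmeticFunction.moebius p.1 : ℝ) * c (p.1 * p.2) = c 1 := by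
  have hsum : Summable fun p : ℕ+ × ℕ+ =>
      (ArithmeticFunction.moebius p.1 : ℝ) * c (p.1 * p.2) := by
    refine Summable.of_norm_bounded hs.norm fun p => ?_
    rw [norm_mul]
    refine mul_le_of_le_one_left (norm_nonneg _) ?_
    rw [Real.norm_eq_abs]
    exact_mod_cast ArithmeticFunction.abs_moebius_le_one
  refine ⟨hsum, ?_⟩
  have hσ : Summable fun q : Σ n : ℕ+, Nat.divisorsAntidiagonal n =>
      (ArithmeticFunction.moebius (sigmaAntidiagonalEquivProd q).1 : ℝ) *
        c ((sigmaAntidiagonalEquivProd q).1 * (sigmaAntidiagonalEquivProd q).2) :=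
    sigmaAntidiagonalEquivProd.summable_iff.2 hsum
  rw [← sigmaAntidiagonalEquivProd.tsum_eq, hσ.tsum_sigma]
  have hinner : ∀ n : ℕ+, ∑' q : Nat.divisorsAntidiagonal n,
      (ArithmeticFunction.moebius (sigmaAntidiagonalEquivProd ⟨n, q⟩).1 : ℝ) *
        c ((sigmaAntidiagonalEquivProd ⟨n, q⟩).1 * (sigmaAntidiagonalEquivProd ⟨n, q⟩).2) =
      if n = 1 then c 1 else 0 := by
    intro n
    have h1 : ∀ q : Nat.divisorsAntidiagonal n,
        (ArithmeticFunction.moebius (sigmaAntidiagonalEquivProd ⟨n, q⟩).1 : ℝ) *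
          c ((sigmaAntidiagonalEquivProd ⟨n, q⟩).1 * (sigmaAntidiagonalEquivProd ⟨n, q⟩).2) =
        (ArithmeticFunction.moebius q.1.1 : ℝ) * c n := by
      rintro ⟨⟨a, b⟩, hq⟩
      have hab := (Nat.mem_divisorsAntidiagonal.1 hq).1
      congr 2
      apply PNat.coe_injective
      exact hab
    simp_rw [h1]
    rw [tsum_mul_right, tsum_fintype, Finset.sum_coe_sort (Nat.divisorsAntidiagonal n)
      (fun q => (ArithmeticFunction.moebius q.1 : ℝ)),
      Nat.sum_divisorsAntidiagonal (fun a _ => (ArithmeticFunction.moebius a : ℝ))]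
    have h2 : ∑ i ∈ (n : ℕ).divisors, (ArithmeticFunction.moebius i : ℝ)
        = ((1 : ArithmeticFunction ℤ) n : ℝ) := by
      rw [← ArithmeticFunction.moebius_mul_coe_zeta, ArithmeticFunction.coe_mul_zeta_apply]
      push_cast
      rfl
    rw [h2, ArithmeticFunction.one_apply]
    by_cases hn : n = 1
    · simp [hn]
    · have : (n : ℕ) ≠ 1 := fun h => hn (PNat.coe_injective h)
      simp [hn, this]
  refine (tsum_congr hinner).trans ?_
  exact tsum_ite_eq 1 (fun _ => c 1)

lemma summable_pnat_inv_pow {k : ℕ} (hk : 1 < k) : Summable fun n : ℕ+ => 1 / (n : ℝ) ^ k :=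
  (Real.summable_one_div_nat_pow.2 hk).comp_injective PNat.coe_injective

lemma tsum_pnat_inv_pow {k : ℕ} (hk : 1 < k) :
    ∑' n : ℕ+, 1 / (n : ℝ) ^ k = (riemannZeta k).re := by
  rw [zeta_nat_eq_tsum_of_gt_one hk]
  have h1 : ∑' n : ℕ+, 1 / ((n : ℕ) : ℝ) ^ k = ∑' n : ℕ, 1 / (n : ℝ) ^ k := by
    refine PNat.coe_injective.tsum_eq (f := fun n : ℕ => 1 / (n : ℝ) ^ k) fun n hn => ?_
    have hn0 : n ≠ 0 := by
      rintro rfl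
      apply hn
      simp [(by lia : k ≠ 0)]
    exact ⟨⟨n, Nat.pos_of_ne_zero hn0⟩, rfl⟩
  have h2 : ∑' n : ℕ, 1 / (n : ℂ) ^ k = ((∑' n : ℕ, 1 / (n : ℝ) ^ k : ℝ) : ℂ) := by
    rw [Complex.ofReal_tsum]
    push_cast
    rfl
  rw [h2, Complex.ofReal_re]
  exact h1

lemma summable_inv_sq_mul_inv_sq :
    Summable fun p : ℕ+ × ℕ+ => 1 / (p.1 : ℝ) ^ 2 * (1 / (p.2 : ℝ) ^ 2) :=
  (summable_pnat_inv_pow one_lt_two).mul_of_nonneg (summable_pnat_inv_pow one_lt_two)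
    (fun _ => by positivity) (fun _ => by positivity)

lemma zeta_two_re_pos : 0 < (riemannZeta 2).re := by
  have h := tsum_pnat_inv_pow one_lt_two
  push_cast at h
  rw [← h]
  exact (summable_pnat_inv_pow one_lt_two).tsum_pos (fun _ => by positivity) 1 (by norm_num)

lemma zeta_three_re_pos : 0 < (riemannZeta 3).re := by
  have h := tsum_pnat_inv_pow (k := 3) (by norm_num)
  push_cast at h
  rw [← h]
  exact (summable_pnat_inv_pow (by norm_num)).tsum_pos (fun _ => by positivity) 1 (by norm_num)

lemma summable_moebius_inv_sq :
    Summable fun m : ℕ+ => (ArithmeticFunction.moebius m : ℝ) * (1 / (m : ℝ) ^ 2) := by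
  refine Summable.of_norm_bounded (summable_pnat_inv_pow one_lt_two) fun m => ?_
  rw [norm_mul, Real.norm_of_nonneg (by positivity : 0 ≤ 1 / (m : ℝ) ^ 2)]
  refine mul_le_of_le_one_left (by positivity) ?_
  rw [Real.norm_eq_abs]
  exact_mod_cast ArithmeticFunction.abs_moebius_le_one

/-- `tsum_mul_moebius` with `c n = n⁻²`, where the double sum factors. -/
lemma tsum_moebius_inv_sq :
    ∑' m : ℕ+, (ArithmeticFunction.moebius m : ℝ) * (1 / (m : ℝ) ^ 2) = 1 / (riemannZeta 2).re := by
  have h := tsum_mul_moebius (c := fun n : ℕ+ => 1 / (n : ℝ) ^ 2) (by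
    refine summable_inv_sq_mul_inv_sq.congr fun p => ?_
    push_cast; field_simp)
  have h2 := h.2
  rw [h.1.tsum_prod] at h2
  have h3 : ∀ m : ℕ+, ∑' d : ℕ+, (ArithmeticFunction.moebius m : ℝ) * (1 / ((m * d : ℕ+) : ℝ) ^ 2) =
      (ArithmeticFunction.moebius m : ℝ) * (1 / (m : ℝ) ^ 2) * (riemannZeta 2).re := by
    intro m
    have hz := tsum_pnat_inv_pow one_lt_two
    push_cast at hz
    rw [← hz, ← tsum_mul_left]
    refine tsum_congr fun d => ?_
    push_cast; field_simp
  rw [tsum_congr h3, tsum_mul_right] at h2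
  rw [eq_div_iff zeta_two_re_pos.ne', h2]
  simp

lemma summable_multiple_of_le {f : ℕ × ℕ → ℝ} {C b : ℝ} (hb : 0 < b)
    (hf : ∀ p, |f p| ≤ C * Real.exp (-(b * (p.1 + p.2)))) :
    Summable fun p : ℕ+ × Direction => f (multiple p) :=
  (Summable.of_norm_bounded ((summable_exp_lattice hb).mul_left C) hf).comp_injective
    multiple_injective

/-- Lattice sums over coprime vectors, summed over their multiples with weights `1/k`. -/
lemma tendsto_coprime_sum {F : ℕ → ℝ × ℝ → ℝ} {F₀ : ℝ × ℝ → ℝ} {α : ℕ → ℝ} {C c : ℝ} (hc : 0 < c)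
    (hpos : ∀ i, 0 < α i) (hlim : Tendsto α atTop (𝓝 0)) (hzero : ∀ i, F i 0 = 0)
    (hF : ∀ i y, 0 ≤ y.1 → 0 ≤ y.2 → |F i y| ≤ C * Real.exp (-(c * (y.1 + y.2))))
    (hconv : ∀ᵐ x ∂(volume.restrict quadrant), ∀ y : ℕ → ℝ × ℝ, Tendsto y atTop (𝓝 x) →
      Tendsto (fun i => F i (y i)) atTop (𝓝 (F₀ x))) :
    Tendsto (fun i => α i ^ 2 * ∑' p : ℕ+ × Direction,
        1 / (p.1 : ℝ) * F i (α i * (p.1 * p.2.1.1), α i * (p.1 * p.2.1.2))) atTop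
      (𝓝 ((riemannZeta 3).re / (riemannZeta 2).re * ∫ x in quadrant, F₀ x)) := by
  set I := ∫ x in quadrant, F₀ x with hI
  have hC : 0 ≤ C := by
    have := (abs_nonneg _).trans (hF 0 (0, 0) le_rfl le_rfl)
    simpa using this
  -- the lattice sum `S` and the coprime sum `A` at scale `n`
  let S : ℕ → ℕ+ → ℝ := fun i n => ∑' p : ℕ × ℕ, F i (α i * n * p.1, α i * n * p.2)
  let A : ℕ → ℕ+ → ℝ := fun i n => ∑' x : Direction, F i (α i * n * x.1.1, α i * n * x.1.2)
  have hαn : ∀ i (n : ℕ+), 0 < α i * n := fun i n => mul_pos (hpos i) (by exact_mod_cast n.pos)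
  have hbound : ∀ i (n : ℕ+) (p : ℕ × ℕ), |F i (α i * n * p.1, α i * n * p.2)| ≤
      C * Real.exp (-(c * (α i * n) * (p.1 + p.2))) := by
    intro i n p
    refine (hF i _ (mul_nonneg (hαn i n).le (Nat.cast_nonneg _))
      (mul_nonneg (hαn i n).le (Nat.cast_nonneg _))).trans_eq ?_
    congr 3; simp only; ring
  have hz : ∀ i (n : ℕ+), F i (α i * n * ((0 : ℕ × ℕ).1 : ℕ), α i * n * ((0 : ℕ × ℕ).2 : ℕ)) = 0 := by
    intro i n
    have : ((α i * n * ((0 : ℕ × ℕ).1 : ℕ), α i * n * ((0 : ℕ × ℕ).2 : ℕ)) : ℝ × ℝ) = 0 := by simp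
    rw [this, hzero]
  -- The decay `n⁻²` at every scale relies on `F i 0 = 0`; it yields the summable majorant in the
  -- multiplier `k` and the Möbius index `m`.
  have hSle : ∀ i n, |S i n| ≤ 2 * C / c ^ 2 * (1 / α i ^ 2) * (1 / (n : ℝ) ^ 2) := by
    intro i n
    refine (abs_tsum_lattice_le (mul_pos hc (hαn i n)) (hz i n) (hbound i n)).2.trans_eq ?_
    have := (hpos i).ne'
    field_simp
  have hsm : ∀ i (n : ℕ+), Summable fun p : ℕ+ × Direction =>
      F i (α i * n * (multiple p).1, α i * n * (multiple p).2) := fun i n =>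
    summable_multiple_of_le (f := fun p : ℕ × ℕ => F i (α i * n * p.1, α i * n * p.2))
      (mul_pos hc (hαn i n)) (hbound i n)
  have hSA : ∀ i n, S i n = ∑' d : ℕ+, A i (n * d) := by
    intro i n
    have h1 := tsum_multiple (f := fun p : ℕ × ℕ => F i (α i * n * p.1, α i * n * p.2)) (hz i n)
    change _ = S i n at h1
    rw [← h1, (hsm i n).tsum_prod]
    refine tsum_congr fun d => tsum_congr fun x => ?_
    simp only [multiple]
    push_cast
    congr 2 <;> ring
  have hAle : ∀ i n, |A i n| ≤ 2 * C / c ^ 2 * (1 / α i ^ 2) * (1 / (n : ℝ) ^ 2) := by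
    intro i n
    have hs1 : Summable fun p : ℕ × ℕ => |F i (α i * n * p.1, α i * n * p.2)| :=
      (abs_tsum_lattice_le (mul_pos hc (hαn i n)) (hz i n) (hbound i n)).1.abs
    have hinj : Function.Injective fun x : Direction => x.1 := Subtype.val_injective
    have hs2 := hs1.comp_injective hinj
    have h3 : |A i n| ≤ ∑' x : Direction, |F i (α i * n * x.1.1, α i * n * x.1.2)| := by
      have := norm_tsum_le_tsum_norm (f := fun x : Direction =>
        F i (α i * n * x.1.1, α i * n * x.1.2)) hs2
      simpa using this
    have h4 : ∑' x : Direction, |F i (α i * n * x.1.1, α i * n * x.1.2)| ≤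
        ∑' p : ℕ × ℕ, |F i (α i * n * p.1, α i * n * p.2)| :=
      Summable.tsum_le_tsum_of_inj _ hinj (fun _ _ => abs_nonneg _) (fun _ => le_rfl) hs2 hs1
    have h5 := abs_tsum_lattice_le (f := fun p : ℕ × ℕ => |F i (α i * n * p.1, α i * n * p.2)|)
      (mul_pos hc (hαn i n)) (by rw [hz i n, abs_zero])
      (fun p => by rw [abs_abs]; exact hbound i n p)
    refine (h3.trans (h4.trans ((le_abs_self _).trans h5.2))).trans_eq ?_
    have := (hpos i).ne'
    field_simp
  have hAsum : ∀ i (n : ℕ+), Summable fun p : ℕ+ × ℕ+ => A i (n * (p.1 * p.2)) := by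
    intro i n
    refine Summable.of_norm_bounded (summable_inv_sq_mul_inv_sq.mul_left
      (2 * C / c ^ 2 * (1 / α i ^ 2) * (1 / (n : ℝ) ^ 2))) fun p => ?_
    refine (hAle i _).trans_eq ?_
    have := (hpos i).ne'
    push_cast
    field_simp
  -- Möbius inversion of `hSA`: the sum over coprime vectors in terms of full lattice sums.
  have hmoeb : ∀ i (n : ℕ+), ∑' m : ℕ+, (ArithmeticFunction.moebius m : ℝ) * S i (n * m) = A i n := by
    intro i n
    have h := tsum_mul_moebius (c := fun k => A i (n * k)) (hAsum i n)
    have h2 := h.2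
    rw [h.1.tsum_prod, mul_one] at h2
    rw [← h2]
    refine tsum_congr fun m => ?_
    rw [hSA, ← tsum_mul_left]
    exact tsum_congr fun d => by rw [mul_assoc]
  have hle1 : ∀ m : ℕ+, |(ArithmeticFunction.moebius m : ℝ)| ≤ 1 := fun m => by
    exact_mod_cast ArithmeticFunction.abs_moebius_le_one
  have hterm : ∀ i (p : ℕ+ × ℕ+), |α i ^ 2 * (1 / (p.1 : ℝ) *
      ((ArithmeticFunction.moebius p.2 : ℝ) * S i (p.1 * p.2)))| ≤
      2 * C / c ^ 2 * (1 / (p.1 : ℝ) ^ 2 * (1 / (p.2 : ℝ) ^ 2)) := by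
    intro i p
    have hp1 : (1 : ℝ) ≤ p.1 := by exact_mod_cast (one_le : 1 ≤ p.1)
    rw [abs_mul, abs_mul, abs_mul, abs_of_nonneg (sq_nonneg (α i)),
      abs_of_nonneg (by positivity : 0 ≤ 1 / (p.1 : ℝ))]
    calc α i ^ 2 * (1 / (p.1 : ℝ) * (|(ArithmeticFunction.moebius p.2 : ℝ)| * |S i (p.1 * p.2)|))
        ≤ α i ^ 2 * (1 * (1 * (2 * C / c ^ 2 * (1 / α i ^ 2) *
          (1 / ((p.1 * p.2 : ℕ+) : ℝ) ^ 2)))) := by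
          gcongr
          · rw [div_le_one (by linarith)]; exact hp1
          · exact hle1 _
          · exact hSle _ _
      _ = _ := by
          have := (hpos i).ne'
          push_cast
          field_simp
  have hrep : ∀ i, α i ^ 2 * ∑' p : ℕ+ × Direction,
        1 / (p.1 : ℝ) * F i (α i * (p.1 * p.2.1.1), α i * (p.1 * p.2.1.2)) =
      ∑' p : ℕ+ × ℕ+, α i ^ 2 * (1 / (p.1 : ℝ) *
        ((ArithmeticFunction.moebius p.2 : ℝ) * S i (p.1 * p.2))) := by
    intro i
    have hs1 : Summable fun p : ℕ+ × Direction =>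
        1 / (p.1 : ℝ) * F i (α i * (p.1 * p.2.1.1), α i * (p.1 * p.2.1.2)) := by
      refine Summable.of_norm_bounded (hsm i 1).norm fun p => ?_
      have hp1 : (1 : ℝ) ≤ p.1 := by exact_mod_cast (one_le : 1 ≤ p.1)
      rw [norm_mul, Real.norm_of_nonneg (by positivity : 0 ≤ 1 / (p.1 : ℝ))]
      have : F i (α i * (p.1 * p.2.1.1), α i * (p.1 * p.2.1.2)) =
          F i (α i * ((1 : ℕ+) : ℕ) * (multiple p).1, α i * ((1 : ℕ+) : ℕ) * (multiple p).2) := by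
        simp [multiple]
      rw [this]
      refine mul_le_of_le_one_left (norm_nonneg _) ?_
      rw [div_le_one (by linarith)]; exact hp1
    have hs2 : Summable fun p : ℕ+ × ℕ+ => α i ^ 2 * (1 / (p.1 : ℝ) *
        ((ArithmeticFunction.moebius p.2 : ℝ) * S i (p.1 * p.2))) :=
      Summable.of_norm_bounded (summable_inv_sq_mul_inv_sq.mul_left _) (hterm i)
    rw [hs1.tsum_prod, hs2.tsum_prod, ← tsum_mul_left]
    refine tsum_congr fun k => ?_
    dsimp only
    rw [tsum_mul_left, tsum_mul_left, tsum_mul_left, hmoeb]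
    congr 2
    refine tsum_congr fun x => ?_
    congr 2 <;> ring
  simp_rw [hrep]
  -- Each `α² S(k m)` tends to `I/(k m)²`. With the weights `1/k` and `μ(m)` the sum over `k` is
  -- `ζ(3)` and the sum over `m` is `1/ζ(2)`.
  have hlimsum : (riemannZeta 3).re / (riemannZeta 2).re * I = ∑' p : ℕ+ × ℕ+,
      1 / (p.1 : ℝ) ^ 3 * ((ArithmeticFunction.moebius p.2 : ℝ) * (1 / (p.2 : ℝ) ^ 2)) * I := by
    have h3 := tsum_pnat_inv_pow (k := 3) (by norm_num)
    push_cast at h3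
    rw [tsum_mul_right, div_eq_mul_one_div, ← tsum_moebius_inv_sq, ← h3]
    congr 1
    exact tsum_mul_tsum_of_summable_norm (summable_pnat_inv_pow (by norm_num)).norm
      summable_moebius_inv_sq.norm
  rw [hlimsum]
  refine tendsto_tsum_of_dominated_convergence (summable_inv_sq_mul_inv_sq.mul_left (2 * C / c ^ 2))
    (fun p => ?_) (Eventually.of_forall fun i p => hterm i p)
  have hp1 : (0 : ℝ) < p.1 := by exact_mod_cast p.1.pos
  have hR := tendsto_riemann_sum (h := fun i => α i * ((p.1 * p.2 : ℕ+) : ℕ)) hc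
    (fun i => hαn i _) (by simpa using hlim.mul_const (((p.1 * p.2 : ℕ+) : ℕ) : ℝ)) hF hconv
  have hR2 := hR.const_mul (1 / (p.1 : ℝ) ^ 3 *
    ((ArithmeticFunction.moebius p.2 : ℝ) * (1 / (p.2 : ℝ) ^ 2)))
  refine hR2.congr fun i => ?_
  change _ * (_ * S i (p.1 * p.2)) = _
  push_cast
  field_simp

/-! ### The integrals over a cone -/

/-- The data of a geometric measure concentrated on the slopes in `[t₀, t₁]`. -/
structure SlopeModel where
  /-- smallest slope -/
  t₀ : ℝ
  /-- largest slope -/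
  t₁ : ℝ
  /-- slope of the end point -/
  c : ℝ
  /-- decay rate as a function of the slope -/
  E : ℝ → ℝ
  /-- lower bound of the decay rate -/
  Emin : ℝ
  /-- upper bound of the decay rate -/
  Emax : ℝ
  t₀_nonneg : 0 ≤ t₀
  t₀_lt : t₀ < t₁
  c_pos : 0 < c
  continuous_E : Continuous E
  Emin_pos : 0 < Emin
  Emin_le : ∀ t, Emin ≤ E t
  le_Emax : ∀ t, E t ≤ Emax

namespace SlopeModel

variable (M : SlopeModel)

/-- The vectors whose `ρ`-tilted slope lies in `[t₀, t₁]`. -/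
def cone (ρ : ℝ) : Set (ℝ × ℝ) := {y | 0 < y.1 ∧ M.t₀ * y.1 ≤ ρ * y.2 ∧ ρ * y.2 ≤ M.t₁ * y.1}

/-- The decay exponent, a function homogeneous of degree one. -/
def height (ρ σ : ℝ) (y : ℝ × ℝ) : ℝ :=
  M.E (ρ * y.2 / y.1) * y.1 * ((M.c * y.1 + σ * y.2) / (M.c * y.1 + ρ * y.2))

open Classical in
/-- The density `exp (-height)` on the cone. -/
def density (ρ σ : ℝ) (y : ℝ × ℝ) : ℝ := if y ∈ M.cone ρ then Real.exp (-M.height ρ σ y) else 0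

/-- The exponential rate in terms of `y₁ + y₂`. -/
def rate : ℝ := M.Emin / (4 * (1 + 2 * M.t₁))

lemma t₁_pos : 0 < M.t₁ := M.t₀_nonneg.trans_lt M.t₀_lt

lemma rate_pos : 0 < M.rate := by
  have := M.t₁_pos
  have := M.Emin_pos
  unfold rate; positivity

lemma E_pos (t : ℝ) : 0 < M.E t := M.Emin_pos.trans_le (M.Emin_le t)

lemma Emax_pos : 0 < M.Emax := (M.E_pos 0).trans_le (M.le_Emax 0)

lemma mem_cone_smul {ρ k : ℝ} (hk : 0 < k) (y : ℝ × ℝ) :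
    (k * y.1, k * y.2) ∈ M.cone ρ ↔ y ∈ M.cone ρ := by
  simp only [cone, mem_ofPred_eq, mul_pos_iff_of_pos_left hk]
  have e1 : M.t₀ * (k * y.1) = k * (M.t₀ * y.1) := by ring
  have e2 : M.t₁ * (k * y.1) = k * (M.t₁ * y.1) := by ring
  have e3 : ρ * (k * y.2) = k * (ρ * y.2) := by ring
  rw [e1, e2, e3, mul_le_mul_iff_right₀ hk, mul_le_mul_iff_right₀ hk]

lemma height_smul {ρ σ k : ℝ} (hk : 0 < k) (y : ℝ × ℝ) :
    M.height ρ σ (k * y.1, k * y.2) = k * M.height ρ σ y := by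
  unfold height
  simp only
  have e1 : ρ * (k * y.2) / (k * y.1) = ρ * y.2 / y.1 := by
    rw [mul_left_comm, mul_div_mul_left _ _ hk.ne']
  have e2 : (M.c * (k * y.1) + σ * (k * y.2)) / (M.c * (k * y.1) + ρ * (k * y.2)) =
      (M.c * y.1 + σ * y.2) / (M.c * y.1 + ρ * y.2) := by
    rw [← mul_div_mul_left _ (M.c * y.1 + ρ * y.2) hk.ne']
    congr 1 <;> ring
  rw [e1, e2]; ring

lemma ratio_bounds {ρ σ : ℝ} (hρ : ρ ∈ Icc (1 / 2 : ℝ) 2) (hσ : σ ∈ Icc (1 / 2 : ℝ) 2) {y : ℝ × ℝ}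
    (h1 : 0 < y.1) (h2 : 0 ≤ y.2) :
    1 / 4 ≤ (M.c * y.1 + σ * y.2) / (M.c * y.1 + ρ * y.2) ∧
      (M.c * y.1 + σ * y.2) / (M.c * y.1 + ρ * y.2) ≤ 4 := by
  have hc : 0 < M.c * y.1 := mul_pos M.c_pos h1
  have hd : 0 < M.c * y.1 + ρ * y.2 := by nlinarith [hρ.1]
  have ha : ρ * y.2 ≤ 2 * y.2 := mul_le_mul_of_nonneg_right hρ.2 h2
  have hb : 1 / 2 * y.2 ≤ ρ * y.2 := mul_le_mul_of_nonneg_right hρ.1 h2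
  have ha' : σ * y.2 ≤ 2 * y.2 := mul_le_mul_of_nonneg_right hσ.2 h2
  have hb' : 1 / 2 * y.2 ≤ σ * y.2 := mul_le_mul_of_nonneg_right hσ.1 h2
  constructor
  · rw [le_div_iff₀ hd]; nlinarith
  · rw [div_le_iff₀ hd]; nlinarith

/-- In the cone `y₂ ≤ 2 t₁ y₁`, because `ρ ≥ 1/2`, so `y₁` controls `y₁ + y₂`; the tilt ratio loses
at most a factor `4`. These two losses make up the constant in `rate`. -/
lemma rate_mul_le_height {ρ σ : ℝ} (hρ : ρ ∈ Icc (1 / 2 : ℝ) 2) (hσ : σ ∈ Icc (1 / 2 : ℝ) 2)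
    {y : ℝ × ℝ} (hy : y ∈ M.cone ρ) (h2 : 0 ≤ y.2) :
    M.rate * (y.1 + y.2) ≤ M.height ρ σ y := by
  obtain ⟨h1, h3, h4⟩ := hy
  have hr := (M.ratio_bounds hρ hσ h1 h2).1
  have ht := M.t₁_pos
  have hy2 : y.2 ≤ 2 * M.t₁ * y.1 := by nlinarith [hρ.1]
  have hE := M.Emin_le (ρ * y.2 / y.1)
  calc M.rate * (y.1 + y.2) ≤ M.rate * ((1 + 2 * M.t₁) * y.1) :=
        mul_le_mul_of_nonneg_left (by linarith) M.rate_pos.le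
    _ = M.Emin * y.1 * (1 / 4) := by unfold rate; field_simp
    _ ≤ M.height ρ σ y := by
        unfold height
        have := M.E_pos (ρ * y.2 / y.1)
        gcongr

lemma height_le {ρ σ : ℝ} (hρ : ρ ∈ Icc (1 / 2 : ℝ) 2) (hσ : σ ∈ Icc (1 / 2 : ℝ) 2)
    {y : ℝ × ℝ} (h1 : 0 < y.1) (h2 : 0 ≤ y.2) :
    M.height ρ σ y ≤ 4 * M.Emax * (y.1 + y.2) := by
  have hr := (M.ratio_bounds hρ hσ h1 h2)
  have hE := M.le_Emax (ρ * y.2 / y.1)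
  have hE1 := M.Emax_pos
  calc M.height ρ σ y ≤ M.Emax * y.1 * 4 := by
        unfold height
        have h4 := hr.2
        have h5 : 0 ≤ (M.c * y.1 + σ * y.2) / (M.c * y.1 + ρ * y.2) := by linarith [hr.1]
        gcongr
    _ ≤ 4 * M.Emax * (y.1 + y.2) := by nlinarith [mul_nonneg hE1.le h2]

lemma density_nonneg (ρ σ : ℝ) (y : ℝ × ℝ) : 0 ≤ M.density ρ σ y := by
  unfold density; split_ifs; exacts [(Real.exp_pos _).le, le_rfl]

lemma density_le {ρ σ : ℝ} (hρ : ρ ∈ Icc (1 / 2 : ℝ) 2) (hσ : σ ∈ Icc (1 / 2 : ℝ) 2)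
    {y : ℝ × ℝ} (h2 : 0 ≤ y.2) :
    M.density ρ σ y ≤ Real.exp (-(M.rate * (y.1 + y.2))) := by
  unfold density
  split_ifs with h
  · exact Real.exp_le_exp.2 (neg_le_neg (M.rate_mul_le_height hρ hσ h h2))
  · exact (Real.exp_pos _).le

end SlopeModel

/-! ### Null rays and convergence of the densities. -/

lemma volume_line (t : ℝ) : volume {x : ℝ × ℝ | x.2 = t * x.1} = 0 := by
  have hm : MeasurableSet {x : ℝ × ℝ | x.2 = t * x.1} :=
    measurableSet_eq_fun measurable_snd (measurable_fst.const_mul t)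
  rw [Measure.volume_eq_prod, Measure.measure_prod_null hm]
  refine Eventually.of_forall fun a => ?_
  have : Prod.mk a ⁻¹' {x : ℝ × ℝ | x.2 = t * x.1} = {t * a} := by
    ext b; simp
  simp only [this]; simp

lemma ae_quadrant_fst_pos : ∀ᵐ x ∂(volume.restrict quadrant), 0 < x.1 := by
  have h0 : volume {x : ℝ × ℝ | x.1 = 0} = 0 := by
    have : {x : ℝ × ℝ | x.1 = 0} = {0} ×ˢ univ := by ext x; simp
    rw [this, Measure.volume_eq_prod, Measure.prod_prod]; simp
  have h1 : ∀ᵐ x : ℝ × ℝ, x.1 ≠ 0 := by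
    rw [ae_iff]; simpa using h0
  filter_upwards [ae_restrict_of_ae h1, ae_restrict_mem measurableSet_quadrant] with x hx hq
  exact lt_of_le_of_ne hq.1 (Ne.symm hx)

lemma ae_quadrant_ne_line (t : ℝ) : ∀ᵐ x ∂(volume.restrict quadrant), x.2 ≠ t * x.1 := by
  refine ae_restrict_of_ae ?_
  rw [ae_iff]; simpa using volume_line t

namespace SlopeModel

variable (M : SlopeModel)

/-- The density jumps only across the two boundary rays of the cone. Away from them strict
inequalities persist along `y`, both inside and outside. -/
lemma tendsto_density {ρ σ : ℕ → ℝ} (hρ : Tendsto ρ atTop (𝓝 1)) (hσ : Tendsto σ atTop (𝓝 1))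
    {x : ℝ × ℝ} (hx : 0 < x.1) (hx2 : 0 ≤ x.2) (h0 : x.2 ≠ M.t₀ * x.1) (h1 : x.2 ≠ M.t₁ * x.1)
    {y : ℕ → ℝ × ℝ} (hy : Tendsto y atTop (𝓝 x)) :
    Tendsto (fun i => M.density (ρ i) (σ i) (y i)) atTop (𝓝 (M.density 1 1 x)) := by
  have y1 : Tendsto (fun i => (y i).1) atTop (𝓝 x.1) := (continuous_fst.tendsto x).comp hy
  have y2 : Tendsto (fun i => (y i).2) atTop (𝓝 x.2) := (continuous_snd.tendsto x).comp hy
  have ry2 : Tendsto (fun i => ρ i * (y i).2) atTop (𝓝 (1 * x.2)) := hρ.mul y2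
  have sy2 : Tendsto (fun i => σ i * (y i).2) atTop (𝓝 (1 * x.2)) := hσ.mul y2
  have hcx : 0 < M.c * x.1 + 1 * x.2 := by nlinarith [mul_pos M.c_pos hx]
  have hh : Tendsto (fun i => M.height (ρ i) (σ i) (y i)) atTop (𝓝 (M.height 1 1 x)) := by
    unfold height
    refine Tendsto.mul (Tendsto.mul ?_ y1) ?_
    · exact (M.continuous_E.tendsto _).comp (ry2.div y1 hx.ne')
    · exact ((y1.const_mul M.c).add sy2).div ((y1.const_mul M.c).add ry2) hcx.ne'
  have p1 : ∀ᶠ i in atTop, 0 < (y i).1 := y1.eventually (lt_mem_nhds hx)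
  have l0 : Tendsto (fun i => M.t₀ * (y i).1) atTop (𝓝 (M.t₀ * x.1)) := y1.const_mul _
  have l1 : Tendsto (fun i => M.t₁ * (y i).1) atTop (𝓝 (M.t₁ * x.1)) := y1.const_mul _
  by_cases hin : M.t₀ * x.1 < x.2 ∧ x.2 < M.t₁ * x.1
  · have e0 : ∀ᶠ i in atTop, M.t₀ * (y i).1 < ρ i * (y i).2 :=
      l0.eventually_lt ry2 (by linarith [hin.1])
    have e1 : ∀ᶠ i in atTop, ρ i * (y i).2 < M.t₁ * (y i).1 :=
      ry2.eventually_lt l1 (by linarith [hin.2])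
    have hxc : x ∈ M.cone 1 := ⟨hx, by linarith [hin.1], by linarith [hin.2]⟩
    have : M.density 1 1 x = Real.exp (-M.height 1 1 x) := by simp [density, hxc]
    rw [this]
    refine ((Real.continuous_exp.tendsto _).comp hh.neg).congr' ?_
    filter_upwards [p1, e0, e1] with i a b d
    have hc : y i ∈ M.cone (ρ i) := ⟨a, b.le, d.le⟩
    simp [density, hc]
  · have hxc : x ∉ M.cone 1 := by
      rintro ⟨_, a, b⟩
      rw [one_mul] at a b
      exact hin ⟨lt_of_le_of_ne a (Ne.symm h0), lt_of_le_of_ne b h1⟩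
    have : M.density 1 1 x = 0 := by simp [density, hxc]
    rw [this]
    refine tendsto_const_nhds.congr' ?_
    rw [not_and_or, not_lt, not_lt] at hin
    rcases hin with h | h
    · have hlt : 1 * x.2 < M.t₀ * x.1 := by rw [one_mul]; exact lt_of_le_of_ne h h0
      filter_upwards [ry2.eventually_lt l0 hlt] with i hi
      have hc : y i ∉ M.cone (ρ i) := fun hc => absurd hc.2.1 (not_le.2 hi)
      simp [density, hc]
    · have hlt : M.t₁ * x.1 < 1 * x.2 := by rw [one_mul]; exact lt_of_le_of_ne h (Ne.symm h1)
      filter_upwards [l1.eventually_lt ry2 hlt] with i hi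
      have hc : y i ∉ M.cone (ρ i) := fun hc => absurd hc.2.2 (not_le.2 hi)
      simp [density, hc]

/-- Half of the exponential decay absorbs the linear factor. -/
lemma one_add_mul_exp_le {a s : ℝ} (ha : 0 < a) (hs : 0 ≤ s) :
    (1 + s) * Real.exp (-(a * s)) ≤ (1 + 2 / a) * Real.exp (-(a / 2 * s)) := by
  have h1 := Real.add_one_le_exp (a / 2 * s)
  have e : Real.exp (-(a * s)) = Real.exp (-(a / 2 * s)) * Real.exp (-(a / 2 * s)) := by
    rw [← Real.exp_add]; congr 1; ring
  have hinv : Real.exp (a / 2 * s) * Real.exp (-(a / 2 * s)) = 1 := by rw [← Real.exp_add]; simp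
  have h2 : 1 + s ≤ (1 + 2 / a) * Real.exp (a / 2 * s) := by
    have : (1 + 2 / a) * (a / 2 * s + 1) ≤ (1 + 2 / a) * Real.exp (a / 2 * s) := by gcongr
    refine le_trans ?_ this
    have : (1 + 2 / a) * (a / 2 * s + 1) = 1 + s + (a / 2 * s + 2 / a) := by field_simp; ring
    rw [this]
    have : 0 ≤ a / 2 * s + 2 / a := by positivity
    linarith
  rw [e, ← mul_assoc]
  refine mul_le_mul_of_nonneg_right ?_ (Real.exp_pos _).le
  calc (1 + s) * Real.exp (-(a / 2 * s))
      ≤ (1 + 2 / a) * Real.exp (a / 2 * s) * Real.exp (-(a / 2 * s)) := by gcongr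
    _ = 1 + 2 / a := by rw [mul_assoc, hinv, mul_one]

lemma mul_density_le {ρ σ : ℝ} (hρ : ρ ∈ Icc (1 / 2 : ℝ) 2) (hσ : σ ∈ Icc (1 / 2 : ℝ) 2)
    {G : ℝ × ℝ → ℝ} {C : ℝ} (hG : ∀ y, 0 ≤ y.1 → 0 ≤ y.2 → |G y| ≤ C * (1 + (y.1 + y.2)))
    {y : ℝ × ℝ} (h1 : 0 ≤ y.1) (h2 : 0 ≤ y.2) :
    |G y * M.density ρ σ y| ≤ C * (1 + 2 / M.rate) * Real.exp (-(M.rate / 2 * (y.1 + y.2))) := by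
  have hC : 0 ≤ C := by
    have := (abs_nonneg _).trans (hG (0, 0) le_rfl le_rfl)
    simpa using this
  rw [abs_mul, abs_of_nonneg (M.density_nonneg ρ σ y)]
  calc |G y| * M.density ρ σ y
      ≤ C * (1 + (y.1 + y.2)) * Real.exp (-(M.rate * (y.1 + y.2))) :=
        mul_le_mul (hG y h1 h2) (M.density_le hρ hσ h2) (M.density_nonneg ρ σ y)
          ((abs_nonneg _).trans (hG y h1 h2))
    _ = C * ((1 + (y.1 + y.2)) * Real.exp (-(M.rate * (y.1 + y.2)))) := by ring
    _ ≤ C * ((1 + 2 / M.rate) * Real.exp (-(M.rate / 2 * (y.1 + y.2)))) :=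
        mul_le_mul_of_nonneg_left (one_add_mul_exp_le M.rate_pos (by linarith)) hC
    _ = _ := by ring

lemma tendsto_density_sum {α ρ σ : ℕ → ℝ} (hα : ∀ i, 0 < α i) (hα0 : Tendsto α atTop (𝓝 0))
    (hρI : ∀ i, ρ i ∈ Icc (1 / 2 : ℝ) 2) (hσI : ∀ i, σ i ∈ Icc (1 / 2 : ℝ) 2)
    (hρ : Tendsto ρ atTop (𝓝 1)) (hσ : Tendsto σ atTop (𝓝 1)) {G : ℝ × ℝ → ℝ} {C : ℝ}
    (hG : ∀ y, 0 ≤ y.1 → 0 ≤ y.2 → |G y| ≤ C * (1 + (y.1 + y.2)))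
    (hGc : ∀ᵐ x ∂(volume.restrict quadrant), ContinuousAt G x) :
    Tendsto (fun i => α i ^ 2 * ∑' p : ℕ+ × Direction, 1 / (p.1 : ℝ) *
        (G (α i * (p.1 * p.2.1.1), α i * (p.1 * p.2.1.2)) *
          M.density (ρ i) (σ i) (α i * (p.1 * p.2.1.1), α i * (p.1 * p.2.1.2)))) atTop
      (𝓝 ((riemannZeta 3).re / (riemannZeta 2).re *
        ∫ x in quadrant, G x * M.density 1 1 x)) := by
  refine tendsto_coprime_sum (F := fun i y => G y * M.density (ρ i) (σ i) y)
    (half_pos M.rate_pos) hα hα0 (fun i => ?_)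
    (fun i y h1 h2 => M.mul_density_le (hρI i) (hσI i) hG h1 h2) ?_
  · have : (0 : ℝ × ℝ) ∉ M.cone (ρ i) := fun h => lt_irrefl _ h.1
    simp [density, this]
  · filter_upwards [hGc, ae_quadrant_fst_pos, ae_quadrant_ne_line M.t₀, ae_quadrant_ne_line M.t₁,
      ae_restrict_mem measurableSet_quadrant] with x hx h1 h2 h3 hq y hy
    exact (hx.tendsto.comp hy).mul (M.tendsto_density hρ hσ h1 hq.2 h2 h3 hy)

end SlopeModel

/-! ### Integration in the coordinates radius and slope. -/

lemma lintegral_Ici_comp_mul {r : ℝ} (hr : 0 < r) (f : ℝ → ℝ≥0∞) :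
    ∫⁻ y in Ici 0, f y = ENNReal.ofReal r * ∫⁻ t in Ici 0, f (r * t) := by
  have himg : (fun t : ℝ => r * t) '' Ici 0 = Ici 0 := by
    ext y
    constructor
    · rintro ⟨t, ht, rfl⟩; exact mul_nonneg hr.le ht
    · intro hy; exact ⟨y / r, div_nonneg hy hr.le, by field_simp⟩
  have h := lintegral_image_eq_lintegral_abs_deriv_mul (s := Ici (0 : ℝ)) (f := fun t => r * t)
    (f' := fun _ => r) measurableSet_Ici
    (fun t _ => by simpa using ((hasDerivAt_id t).const_mul r).hasDerivWithinAt)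
    (fun a _ b _ hab => mul_left_cancel₀ hr.ne' hab) f
  rw [himg, abs_of_pos hr] at h
  rw [h, lintegral_const_mul' _ _ ENNReal.ofReal_ne_top]

lemma lintegral_pow_mul_exp {E : ℝ} (hE : 0 < E) (d : ℕ) :
    ∫⁻ r in Ioi 0, ENNReal.ofReal (r ^ d * Real.exp (-(r * E))) =
      ENNReal.ofReal (d.factorial / E ^ (d + 1)) := by
  have h := Real.integral_rpow_mul_exp_neg_mul_Ioi (a := d + 1) (r := E) (by positivity) hE
  have h1 : ∫ r in Ioi (0 : ℝ), r ^ d * Real.exp (-(r * E)) = d.factorial / E ^ (d + 1) := by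
    rw [Real.Gamma_nat_eq_factorial] at h
    have e1 : (1 / E) ^ ((d : ℝ) + 1) * (d.factorial : ℝ) = d.factorial / E ^ (d + 1) := by
      have : ((d : ℝ) + 1) = ((d + 1 : ℕ) : ℝ) := by push_cast; ring
      rw [this, Real.rpow_natCast, one_div, inv_pow]; field_simp
    rw [← e1, ← h]
    refine setIntegral_congr_fun measurableSet_Ioi fun r hr => ?_
    have : ((d : ℝ) + 1 - 1) = (d : ℝ) := by ring
    simp only [this, Real.rpow_natCast]
    rw [mul_comm r E]
  have hpos : 0 < (d.factorial : ℝ) / E ^ (d + 1) := by positivity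
  rw [← ofReal_integral_eq_lintegral_ofReal, h1]
  -- Integrability comes for free: the Bochner integral of a nonintegrable function is `0`, but this
  -- one is positive.
  · by_contra hc
    have := integral_undef hc
    rw [h1] at this
    exact hpos.ne' this
  · filter_upwards [ae_restrict_mem measurableSet_Ioi] with r hr
    have : (0 : ℝ) < r := hr
    positivity

/-- Integration over the quadrant in the coordinates `(r, r t)`. -/
lemma lintegral_quadrant_slope {d : ℕ} {ψ E : ℝ → ℝ} (hψ : Measurable ψ) (hψ0 : ∀ t, 0 ≤ ψ t)
    (hE : Measurable E) (hE0 : ∀ t, 0 < E t) :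
    ∫⁻ x in quadrant, ENNReal.ofReal (x.1 ^ d * ψ (x.2 / x.1) * Real.exp (-(x.1 * E (x.2 / x.1)))) =
      ∫⁻ t in Ici 0, ENNReal.ofReal ((d + 1).factorial * ψ t / E t ^ (d + 2)) := by
  have hm : Measurable fun x : ℝ × ℝ =>
      ENNReal.ofReal (x.1 ^ d * ψ (x.2 / x.1) * Real.exp (-(x.1 * E (x.2 / x.1)))) := by fun_prop
  have hm2 : Measurable fun x : ℝ × ℝ =>
      ENNReal.ofReal (x.1 ^ (d + 1) * Real.exp (-(x.1 * E x.2)) * ψ x.2) := by fun_prop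
  rw [quadrant, Measure.volume_eq_prod, ← Measure.prod_restrict, lintegral_prod _ hm.aemeasurable,
    ← setLIntegral_congr (Ioi_ae_eq_Ici (a := (0 : ℝ)))]
  -- The substitution `y = r t` contributes a Jacobian `r`, so the radial integral carries `r^(d+1)`
  -- and equals `(d+1)!/E^(d+2)`.
  have hinner : ∀ r ∈ Ioi (0 : ℝ), ∫⁻ y in Ici 0,
      ENNReal.ofReal (r ^ d * ψ (y / r) * Real.exp (-(r * E (y / r)))) =
      ∫⁻ t in Ici 0, ENNReal.ofReal (r ^ (d + 1) * Real.exp (-(r * E t)) * ψ t) := by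
    intro r hr
    have hr' : (0 : ℝ) < r := hr
    rw [lintegral_Ici_comp_mul hr', ← lintegral_const_mul' _ _ ENNReal.ofReal_ne_top]
    refine lintegral_congr fun t => ?_
    rw [← ENNReal.ofReal_mul hr'.le, mul_div_cancel_left₀ _ hr'.ne']
    congr 1; ring
  rw [setLIntegral_congr_fun measurableSet_Ioi hinner]
  rw [lintegral_lintegral_swap (f := fun r t =>
    ENNReal.ofReal (r ^ (d + 1) * Real.exp (-(r * E t)) * ψ t)) hm2.aemeasurable]
  refine lintegral_congr fun t => ?_
  simp_rw [ENNReal.ofReal_mul' (hψ0 t)]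
  rw [lintegral_mul_const' _ _ ENNReal.ofReal_ne_top, lintegral_pow_mul_exp (hE0 t),
    ← ENNReal.ofReal_mul' (hψ0 t)]
  congr 1; ring

/-- Both integrands are nonnegative, so the identity of Lebesgue integrals transfers without any
integrability assumption. -/
lemma integral_quadrant_slope {d : ℕ} {ψ E : ℝ → ℝ} (hψ : Measurable ψ) (hψ0 : ∀ t, 0 ≤ ψ t)
    (hE : Measurable E) (hE0 : ∀ t, 0 < E t) :
    ∫ x in quadrant, x.1 ^ d * ψ (x.2 / x.1) * Real.exp (-(x.1 * E (x.2 / x.1))) =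
      ∫ t in Ici 0, (d + 1).factorial * ψ t / E t ^ (d + 2) := by
  have hm : Measurable fun x : ℝ × ℝ =>
      x.1 ^ d * ψ (x.2 / x.1) * Real.exp (-(x.1 * E (x.2 / x.1))) := by fun_prop
  have hm2 : Measurable fun t => (d + 1).factorial * ψ t / E t ^ (d + 2) := by fun_prop
  rw [integral_eq_lintegral_of_nonneg_ae _ hm.aestronglyMeasurable,
    integral_eq_lintegral_of_nonneg_ae _ hm2.aestronglyMeasurable,
    lintegral_quadrant_slope hψ hψ0 hE hE0]
  · refine Eventually.of_forall fun t => ?_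
    have := hψ0 t
    have := hE0 t
    simp only [Pi.zero_apply]; positivity
  · filter_upwards [ae_restrict_mem measurableSet_quadrant] with x hx
    have := hψ0 (x.2 / x.1)
    have h1 : (0 : ℝ) ≤ x.1 := hx.1
    simp only [Pi.zero_apply]; positivity

namespace SlopeModel

variable (M : SlopeModel)

/-- For `ρ = σ = 1` the tilt ratio is `1` and the height is `x₁ E(x₂/x₁)`. The case `d = 0` serves
log-partition functions, `d = 1` serves means. -/
lemma integral_mul_density {d : ℕ} {ψ : ℝ → ℝ} (hψ : Measurable ψ) (hψ0 : ∀ t, 0 ≤ ψ t)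
    {G : ℝ × ℝ → ℝ} (hG : ∀ y, 0 < y.1 → 0 ≤ y.2 → G y = y.1 ^ d * ψ (y.2 / y.1)) :
    ∫ x in quadrant, G x * M.density 1 1 x =
      ∫ t in Icc M.t₀ M.t₁, (d + 1).factorial * ψ t / M.E t ^ (d + 2) := by
  have h := integral_quadrant_slope (d := d) (ψ := (Icc M.t₀ M.t₁).indicator ψ) (E := M.E)
    (hψ.indicator measurableSet_Icc) (fun t => indicator_nonneg (fun t _ => hψ0 t) t)
    M.continuous_E.measurable M.E_pos
  have h2 : ∫ t in Ici 0, (d + 1).factorial * (Icc M.t₀ M.t₁).indicator ψ t / M.E t ^ (d + 2) =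
      ∫ t in Icc M.t₀ M.t₁, (d + 1).factorial * ψ t / M.E t ^ (d + 2) := by
    have : ∀ t, (d + 1).factorial * (Icc M.t₀ M.t₁).indicator ψ t / M.E t ^ (d + 2) =
        (Icc M.t₀ M.t₁).indicator (fun t => (d + 1).factorial * ψ t / M.E t ^ (d + 2)) t := by
      intro t
      by_cases ht : t ∈ Icc M.t₀ M.t₁ <;> simp [ht]
    simp_rw [this]
    rw [setIntegral_indicator measurableSet_Icc,
      inter_eq_self_of_subset_right
        (show Icc M.t₀ M.t₁ ⊆ Ici 0 from fun t ht => M.t₀_nonneg.trans ht.1)]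
  rw [← h2, ← h]
  refine integral_congr_ae ?_
  filter_upwards [ae_quadrant_fst_pos, ae_restrict_mem measurableSet_quadrant] with x h1 hq
  have hx2 : (0 : ℝ) ≤ x.2 := hq.2
  have hmem : x ∈ M.cone 1 ↔ x.2 / x.1 ∈ Icc M.t₀ M.t₁ := by
    simp only [cone, mem_ofPred_eq, mem_Icc, one_mul, le_div_iff₀ h1, div_le_iff₀ h1]
    tauto
  have hh : M.height 1 1 x = x.1 * M.E (x.2 / x.1) := by
    have : 0 < M.c * x.1 + 1 * x.2 := by nlinarith [mul_pos M.c_pos h1]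
    rw [height, div_self this.ne', one_mul, mul_one, mul_comm]
  rw [hG x h1 hx2]
  by_cases hc : x.2 / x.1 ∈ Icc M.t₀ M.t₁
  · simp [density, hmem, hc, hh]
  · simp [density, hmem, hc]

end SlopeModel

/-! ### Means and deviations of additive functionals -/

/-- The mean of the additive functional `linSum W` under `geomMeasure q`. -/
def meanSum (q W : Direction → ℝ) : ℝ := ∑' x, W x * (q x / (1 - q x))

lemma tsum_prod_swap {β γ : Type*} {f : β × γ → ℝ} (hf : Summable f) :
    ∑' p, f p = ∑' c, ∑' b, f (b, c) := by
  have hs : Summable fun p : γ × β => f (p.2, p.1) := (Equiv.prodComm γ β).summable_iff.2 hf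
  rw [← (Equiv.prodComm γ β).tsum_eq]
  exact hs.tsum_prod

lemma size_pos (x : Direction) : (0 : ℝ) < x.1.1 + x.1.2 := by
  rcases Nat.eq_zero_or_pos x.1.1 with h1 | h1
  · rcases Nat.eq_zero_or_pos x.1.2 with h2 | h2
    · have := x.2
      rw [h1, h2] at this
      simp at this
    · have : (0 : ℝ) < x.1.2 := by exact_mod_cast h2
      have := Nat.cast_nonneg (α := ℝ) x.1.1
      linarith
  · have : (0 : ℝ) < x.1.1 := by exact_mod_cast h1
    have := Nat.cast_nonneg (α := ℝ) x.1.2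
    linarith

lemma summable_exp_direction {b : ℝ} (hb : 0 < b) :
    Summable fun x : Direction => Real.exp (-(b * (x.1.1 + x.1.2))) :=
  (summable_exp_lattice hb).comp_injective
    (Subtype.val_injective : Function.Injective fun x : Direction => x.1)

lemma tsum_exp_direction_le {b : ℝ} (hb : 0 < b) :
    ∑' x : Direction, Real.exp (-(b * (x.1.1 + x.1.2))) ≤ 2 / b ^ 2 := by
  refine le_trans ?_ (tsum_exp_lattice_ne_zero_le hb)
  refine Summable.tsum_le_tsum_of_inj (fun x : Direction => x.1) Subtype.val_injective ?_ ?_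
    (summable_exp_direction hb) ?_
  · intro p _; split_ifs; exacts [le_rfl, (Real.exp_pos _).le]
  · intro x
    have : x.1 ≠ 0 := by
      intro h
      have := size_pos x
      simp [h] at this
    simp [this]
  · refine Summable.of_nonneg_of_le ?_ ?_ (summable_exp_lattice hb)
    · intro p; split_ifs; exacts [le_rfl, (Real.exp_pos _).le]
    · intro p; split_ifs; exacts [(Real.exp_pos _).le, le_rfl]

/-- The square root of `sq_mul_exp_div_le`, with one factor `exp (-y/2)` kept. -/
lemma mul_exp_div_le {y : ℝ} (hy : 0 < y) :
    y * (Real.exp (-y) / (1 - Real.exp (-y))) ≤ Real.exp (-(y / 2)) := by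
  have h := sq_mul_exp_div_le hy
  have e : Real.exp (-y) = Real.exp (-(y / 2)) ^ 2 := by rw [← Real.exp_nat_mul]; congr 1; ring
  have h1 : Real.exp (-y) < 1 := Real.exp_lt_one_iff.2 (by linarith)
  set u := Real.exp (-(y / 2))
  have h2 : (y * (u / (1 - Real.exp (-y)))) ^ 2 ≤ 1 := by
    refine le_trans (le_of_eq ?_) h
    rw [mul_pow, div_pow, e]
  have h3 : y * (u / (1 - Real.exp (-y))) ≤ 1 := by
    have h4 : 0 ≤ y * (u / (1 - Real.exp (-y))) := by positivity
    exact (pow_le_one_iff_of_nonneg h4 two_ne_zero).1 h2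
  calc y * (Real.exp (-y) / (1 - Real.exp (-y))) = u * (y * (u / (1 - Real.exp (-y)))) := by
        nth_rewrite 1 [e]; ring
    _ ≤ u * 1 := by gcongr
    _ = u := mul_one u

section Deviation

variable {q W : Direction → ℝ} {b : ℝ}

lemma lt_one_of_le_exp (hb : 0 < b) (hq : ∀ x, q x ≤ Real.exp (-(b * (x.1.1 + x.1.2))))
    (x : Direction) : q x < 1 :=
  (hq x).trans_lt (Real.exp_lt_one_iff.2 (neg_lt_zero.2 (mul_pos hb (size_pos x))))

lemma summable_of_le_exp (hb : 0 < b) (h0 : ∀ x, 0 ≤ q x)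
    (hq : ∀ x, q x ≤ Real.exp (-(b * (x.1.1 + x.1.2)))) : Summable q :=
  Summable.of_nonneg_of_le h0 hq (summable_exp_direction hb)

lemma summable_meanSum (hb : 0 < b) (h0 : ∀ x, 0 ≤ q x)
    (hq : ∀ x, q x ≤ Real.exp (-(b * (x.1.1 + x.1.2)))) (hW : ∀ x, |W x| ≤ x.1.1 + x.1.2) :
    Summable fun x => W x * (q x / (1 - q x)) := by
  refine Summable.of_norm_bounded ((summable_exp_direction (half_pos hb)).mul_left (1 / b))
    fun x => ?_
  have hx := size_pos x
  have h1 := lt_one_of_le_exp hb hq x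
  have he : Real.exp (-(b * (x.1.1 + x.1.2))) < 1 :=
    Real.exp_lt_one_iff.2 (neg_lt_zero.2 (mul_pos hb hx))
  have h2 : q x / (1 - q x) ≤
      Real.exp (-(b * (x.1.1 + x.1.2))) / (1 - Real.exp (-(b * (x.1.1 + x.1.2)))) :=
    div_le_div₀ (Real.exp_pos _).le (hq x) (by linarith) (by linarith [hq x])
  have h3 := mul_exp_div_le (mul_pos hb hx)
  have h4 : 0 ≤ q x / (1 - q x) := div_nonneg (h0 x) (by linarith)
  rw [norm_mul, Real.norm_eq_abs, Real.norm_of_nonneg h4]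
  calc |W x| * (q x / (1 - q x)) ≤ (x.1.1 + x.1.2) *
        (Real.exp (-(b * (x.1.1 + x.1.2))) / (1 - Real.exp (-(b * (x.1.1 + x.1.2))))) :=
        mul_le_mul (hW x) h2 h4 hx.le
    _ = 1 / b * (b * (x.1.1 + x.1.2) *
        (Real.exp (-(b * (x.1.1 + x.1.2))) / (1 - Real.exp (-(b * (x.1.1 + x.1.2)))))) := by
        field_simp
    _ ≤ 1 / b * Real.exp (-(b * (x.1.1 + x.1.2) / 2)) := by gcongr
    _ = 1 / b * Real.exp (-(b / 2 * (x.1.1 + x.1.2))) := by congr 3; ring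

lemma tilt_le (hq : ∀ x, q x ≤ Real.exp (-(b * (x.1.1 + x.1.2)))) {v : ℝ} {x : Direction}
    (hv : |v| ≤ b / 2 * (x.1.1 + x.1.2)) :
    q x * Real.exp |v| ≤ Real.exp (-(b / 2 * (x.1.1 + x.1.2))) := by
  calc q x * Real.exp |v| ≤ Real.exp (-(b * (x.1.1 + x.1.2))) *
        Real.exp (b / 2 * (x.1.1 + x.1.2)) :=
        mul_le_mul (hq x) (Real.exp_le_exp.2 hv) (Real.exp_pos _).le (Real.exp_pos _).le
    _ = _ := by rw [← Real.exp_add]; congr 1; ring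

/-- A tilt with `s ≤ 1/2` uses up at most half of the decay `b`, so the tilted parameters stay below
`1`. The second-order terms are at most `16 s²` times an exponential of rate `b/4`, and their sum
over directions is at most `16 s² · 2/(b/4)² = 512 s²/b²`. -/
lemma logPart_tilt_le (hb : 0 < b) (h0 : ∀ x, 0 ≤ q x)
    (hq : ∀ x, q x ≤ Real.exp (-(b * (x.1.1 + x.1.2)))) (hW : ∀ x, |W x| ≤ x.1.1 + x.1.2)
    {s : ℝ} (hs0 : 0 < s) (hs : s ≤ 1 / 2) :
    logPart (fun x => q x * Real.exp (s * b * W x)) ≤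
      logPart q + s * b * meanSum q W + 512 * s ^ 2 / b ^ 2 := by
  have hv : ∀ x : Direction, |s * b * W x| ≤ b / 2 * (x.1.1 + x.1.2) := by
    intro x
    rw [abs_mul, abs_of_pos (mul_pos hs0 hb)]
    calc s * b * |W x| ≤ 1 / 2 * b * (x.1.1 + x.1.2) := by
          gcongr
          exact hW x
      _ = _ := by ring
  have hterm : ∀ x : Direction, -Real.log (1 - q x * Real.exp (s * b * W x)) ≤
      -Real.log (1 - q x) + s * b * (W x * (q x / (1 - q x))) +
        16 * s ^ 2 * Real.exp (-(b / 4 * (x.1.1 + x.1.2))) := by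
    intro x
    have hx := size_pos x
    have hbx : 0 < b / 2 * (x.1.1 + x.1.2) := mul_pos (half_pos hb) hx
    refine (neg_log_tilt_le (h0 x) (tilt_le hq (hv x))
      (Real.exp_lt_one_iff.2 (neg_lt_zero.2 hbx))).trans ?_
    have h4 := sq_mul_exp_div_le_exp hbx
    have hsq : (s * b * W x) ^ 2 ≤ 4 * s ^ 2 * (b / 2 * (x.1.1 + x.1.2)) ^ 2 := by
      have : (W x) ^ 2 ≤ ((x.1.1 : ℝ) + x.1.2) ^ 2 := by
        rw [← sq_abs (W x)]
        exact pow_le_pow_left₀ (abs_nonneg _) (hW x) 2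
      calc (s * b * W x) ^ 2 = (s * b) ^ 2 * W x ^ 2 := by ring
        _ ≤ (s * b) ^ 2 * ((x.1.1 : ℝ) + x.1.2) ^ 2 := by gcongr
        _ = _ := by ring
    have h5 : (s * b * W x) ^ 2 * (Real.exp (-(b / 2 * (x.1.1 + x.1.2))) /
        (1 - Real.exp (-(b / 2 * (x.1.1 + x.1.2)))) ^ 2) ≤
        16 * s ^ 2 * Real.exp (-(b / 4 * (x.1.1 + x.1.2))) := by
      calc _ ≤ 4 * s ^ 2 * (b / 2 * (x.1.1 + x.1.2)) ^ 2 *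
            (Real.exp (-(b / 2 * (x.1.1 + x.1.2))) /
              (1 - Real.exp (-(b / 2 * (x.1.1 + x.1.2)))) ^ 2) := by gcongr
        _ = 4 * s ^ 2 * ((b / 2 * (x.1.1 + x.1.2)) ^ 2 *
            (Real.exp (-(b / 2 * (x.1.1 + x.1.2))) /
              (1 - Real.exp (-(b / 2 * (x.1.1 + x.1.2)))) ^ 2)) := by ring
        _ ≤ 4 * s ^ 2 * (4 * Real.exp (-(b / 2 * (x.1.1 + x.1.2) / 2))) := by gcongr
        _ = 16 * s ^ 2 * Real.exp (-(b / 2 * (x.1.1 + x.1.2) / 2)) := by ring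
        _ = _ := by congr 3; ring
    linarith
  have hqs := summable_of_le_exp hb h0 hq
  have S1 := summable_neg_log_one_sub hqs
  have S2 := (summable_meanSum hb h0 hq hW).mul_left (s * b)
  have S3 := (summable_exp_direction (b := b / 4) (by positivity)).mul_left (16 * s ^ 2)
  have S0 : Summable fun x => q x * Real.exp (s * b * W x) := by
    refine Summable.of_nonneg_of_le (fun x => mul_nonneg (h0 x) (Real.exp_pos _).le) (fun x => ?_)
      (summable_exp_direction (half_pos hb))
    exact (mul_le_mul_of_nonneg_left (Real.exp_le_exp.2 (le_abs_self _)) (h0 x)).trans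
      (tilt_le hq (hv x))
  have hle := (summable_neg_log_one_sub S0).tsum_le_tsum hterm ((S1.add S2).add S3)
  rw [(S1.add S2).tsum_add S3, S1.tsum_add S2, tsum_mul_left, tsum_mul_left] at hle
  have h7 : 16 * s ^ 2 * ∑' x : Direction, Real.exp (-(b / 4 * (x.1.1 + x.1.2))) ≤
      512 * s ^ 2 / b ^ 2 := by
    calc _ ≤ 16 * s ^ 2 * (2 / (b / 4) ^ 2) := by
          gcongr
          exact tsum_exp_direction_le (by positivity)
      _ = _ := by field_simp; ring
  unfold logPart meanSum
  linarith

/-- The exponential rate of deviations of relative size `η`. -/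
def deviationRate (η : ℝ) : ℝ := min (1 / 2) (η / 1024) * η / 2

lemma deviationRate_pos {η : ℝ} (hη : 0 < η) : 0 < deviationRate η := by
  unfold deviationRate
  have : 0 < min (1 / 2) (η / 1024) := lt_min (by norm_num) (by positivity)
  positivity

/-- Chernoff bound with a tilt of size `s b`: a deviation `η/b³` gains `s η/b²` in the exponent,
against a second-order loss `512 s²/b²`. -/
lemma geomMeasure_upper_deviation (hb : 0 < b) (h0 : ∀ x, 0 ≤ q x)
    (hq : ∀ x, q x ≤ Real.exp (-(b * (x.1.1 + x.1.2)))) (hW : ∀ x, |W x| ≤ x.1.1 + x.1.2)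
    {η : ℝ} (hη : 0 < η) :
    geomMeasure q {Γ | meanSum q W + η / b ^ 3 ≤ linSum W Γ} ≤
      ENNReal.ofReal (Real.exp (-(deviationRate η / b ^ 2))) := by
  -- With `s ≤ η/1024` the loss is at most half of the gain; the cap `1/2` is the requirement of
  -- `logPart_tilt_le`.
  set s := min (1 / 2) (η / 1024) with hs
  have hs0 : 0 < s := lt_min (by norm_num) (by positivity)
  have hs1 : s ≤ 1 / 2 := min_le_left _ _
  have hs2 : s ≤ η / 1024 := min_le_right _ _
  have hsb : 0 < s * b := mul_pos hs0 hb
  have hv : ∀ x : Direction, |s * b * W x| ≤ b / 2 * (x.1.1 + x.1.2) := by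
    intro x
    rw [abs_mul, abs_of_pos hsb]
    calc s * b * |W x| ≤ 1 / 2 * b * (x.1.1 + x.1.2) := by
          gcongr
          exact hW x
      _ = _ := by ring
  have ht : ∀ x : Direction, q x * Real.exp (s * b * W x) ≤
      Real.exp (-(b / 2 * (x.1.1 + x.1.2))) := fun x =>
    (mul_le_mul_of_nonneg_left (Real.exp_le_exp.2 (le_abs_self _)) (h0 x)).trans
      (tilt_le hq (hv x))
  have h1 := lt_one_of_le_exp (half_pos hb) ht
  have hsm := summable_of_le_exp (half_pos hb)
    (fun x => mul_nonneg (h0 x) (Real.exp_pos _).le) ht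
  have hset : {Γ : PolyLine | meanSum q W + η / b ^ 3 ≤ linSum W Γ} =
      {Γ | s * b * (meanSum q W + η / b ^ 3) ≤ linSum (fun x => s * b * W x) Γ} := by
    ext Γ
    have : linSum (fun x => s * b * W x) Γ = s * b * linSum W Γ := by
      unfold linSum
      rw [Finsupp.sum, Finsupp.sum, Finset.mul_sum]
      exact Finset.sum_congr rfl fun x _ => by ring
    simp only [mem_ofPred_eq, this, mul_le_mul_iff_right₀ hsb]
  rw [hset]
  refine (geomMeasure_le_exp h0 h1 hsm _).trans (ENNReal.ofReal_le_ofReal (Real.exp_le_exp.2 ?_))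
  have hl := logPart_tilt_le hb h0 hq hW hs0 hs1
  have e1 : s * b * (meanSum q W + η / b ^ 3) = s * b * meanSum q W + s * η / b ^ 2 := by
    field_simp
  have e2 : 512 * s ^ 2 / b ^ 2 ≤ s * η / 2 / b ^ 2 := by
    gcongr
    nlinarith
  have e3 : deviationRate η / b ^ 2 = s * η / b ^ 2 - s * η / 2 / b ^ 2 := by
    unfold deviationRate; rw [← hs]; ring
  rw [e1, e3]
  linarith

lemma linSum_neg (W : Direction → ℝ) (Γ : PolyLine) :
    linSum (fun x => -W x) Γ = -linSum W Γ := by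
  unfold linSum
  rw [Finsupp.sum, Finsupp.sum, ← Finset.sum_neg_distrib]
  exact Finset.sum_congr rfl fun x _ => by ring

lemma geomMeasure_deviation (hb : 0 < b) (h0 : ∀ x, 0 ≤ q x)
    (hq : ∀ x, q x ≤ Real.exp (-(b * (x.1.1 + x.1.2)))) (hW : ∀ x, |W x| ≤ x.1.1 + x.1.2)
    {η : ℝ} (hη : 0 < η) :
    geomMeasure q {Γ | η / b ^ 3 ≤ |linSum W Γ - meanSum q W|} ≤
      2 * ENNReal.ofReal (Real.exp (-(deviationRate η / b ^ 2))) := by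
  have h1 := geomMeasure_upper_deviation hb h0 hq hW hη
  have h2 := geomMeasure_upper_deviation hb h0 hq (W := fun x => -W x)
    (fun x => by rw [abs_neg]; exact hW x) hη
  have hm : meanSum q (fun x => -W x) = -meanSum q W := by
    unfold meanSum
    rw [← tsum_neg]
    exact tsum_congr fun x => by ring
  have hsub : {Γ : PolyLine | η / b ^ 3 ≤ |linSum W Γ - meanSum q W|} ⊆
      {Γ | meanSum q W + η / b ^ 3 ≤ linSum W Γ} ∪
      {Γ | meanSum q (fun x => -W x) + η / b ^ 3 ≤ linSum (fun x => -W x) Γ} := by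
    intro Γ h
    simp only [mem_union, mem_ofPred_eq, hm, linSum_neg] at h ⊢
    rcases le_abs.1 h with h | h
    · left; linarith
    · right; linarith
  refine (measure_mono hsub).trans ((measure_union_le _ _).trans ?_)
  rw [two_mul]
  exact add_le_add h1 h2

end Deviation

/-! ### Geometric parameters of a model and their power series. -/

namespace SlopeModel

variable (M : SlopeModel)

/-- The parameters of the geometric multiplicities at scale `α`. -/
def param (α ρ σ : ℝ) (x : Direction) : ℝ := M.density ρ σ (α * x.1.1, α * x.1.2)

lemma param_nonneg (α ρ σ : ℝ) (x : Direction) : 0 ≤ M.param α ρ σ x := M.density_nonneg _ _ _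

lemma param_le {α ρ σ : ℝ} (hα : 0 ≤ α) (hρ : ρ ∈ Icc (1 / 2 : ℝ) 2) (hσ : σ ∈ Icc (1 / 2 : ℝ) 2)
    (x : Direction) : M.param α ρ σ x ≤ Real.exp (-(α * M.rate * (x.1.1 + x.1.2))) := by
  refine (M.density_le hρ hσ (y := (α * x.1.1, α * x.1.2))
    (mul_nonneg hα (Nat.cast_nonneg _))).trans_eq ?_
  congr 2; simp only; ring

/-- Homogeneity of the height and invariance of the cone under dilations. This converts power series
in the parameters into sums over lattice vectors. -/
lemma density_multiple {α ρ σ : ℝ} (k : ℕ+) (x : Direction) :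
    M.density ρ σ (α * (k * x.1.1), α * (k * x.1.2)) = M.param α ρ σ x ^ (k : ℕ) := by
  have hk : (0 : ℝ) < k := by exact_mod_cast k.pos
  have e : ((α * (k * x.1.1), α * (k * x.1.2)) : ℝ × ℝ) =
      (k * (α * x.1.1, α * x.1.2).1, k * (α * x.1.1, α * x.1.2).2) := by
    ext <;> simp only <;> ring
  unfold param density
  rw [e, M.mem_cone_smul hk, M.height_smul hk]
  split_ifs with h
  · rw [← Real.exp_nat_mul]; congr 1; ring
  · rw [zero_pow k.ne_zero]

variable {α ρ σ : ℝ}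

lemma summable_density_sum (hα : 0 < α) (hρ : ρ ∈ Icc (1 / 2 : ℝ) 2) (hσ : σ ∈ Icc (1 / 2 : ℝ) 2)
    {G : ℝ × ℝ → ℝ} {C : ℝ} (hG : ∀ y, 0 ≤ y.1 → 0 ≤ y.2 → |G y| ≤ C * (1 + (y.1 + y.2))) :
    Summable fun p : ℕ+ × Direction => 1 / (p.1 : ℝ) *
        (G (α * (p.1 * p.2.1.1), α * (p.1 * p.2.1.2)) *
          M.density ρ σ (α * (p.1 * p.2.1.1), α * (p.1 * p.2.1.2))) := by
  have hs := summable_multiple_of_le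
    (f := fun p : ℕ × ℕ => G (α * p.1, α * p.2) * M.density ρ σ (α * p.1, α * p.2))
    (mul_pos hα (half_pos M.rate_pos)) (C := C * (1 + 2 / M.rate)) (fun p => by
      refine (M.mul_density_le hρ hσ hG (y := (α * p.1, α * p.2)) (by positivity)
        (by positivity)).trans_eq ?_
      congr 3; simp only; ring)
  refine Summable.of_norm_bounded hs.norm fun p => ?_
  have hp1 : (1 : ℝ) ≤ p.1 := by exact_mod_cast (one_le : 1 ≤ p.1)
  rw [norm_mul, Real.norm_of_nonneg (by positivity : 0 ≤ 1 / (p.1 : ℝ))]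
  have : ‖G (α * (p.1 * p.2.1.1), α * (p.1 * p.2.1.2)) *
      M.density ρ σ (α * (p.1 * p.2.1.1), α * (p.1 * p.2.1.2))‖ =
      ‖G (α * ((multiple p).1 : ℕ), α * ((multiple p).2 : ℕ)) *
        M.density ρ σ (α * ((multiple p).1 : ℕ), α * ((multiple p).2 : ℕ))‖ := by
    simp [multiple]
  rw [this]
  refine mul_le_of_le_one_left (norm_nonneg _) ?_
  rw [div_le_one (by linarith)]; exact hp1

lemma param_lt_one (hα : 0 < α) (hρ : ρ ∈ Icc (1 / 2 : ℝ) 2) (hσ : σ ∈ Icc (1 / 2 : ℝ) 2)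
    (x : Direction) : M.param α ρ σ x < 1 :=
  lt_one_of_le_exp (mul_pos hα M.rate_pos) (M.param_le hα.le hρ hσ) x

/-- Homogeneity of `G` produces a factor `α k`; the `k` cancels the weight `1/k`, and the geometric
series over `k ≥ 1` is `q/(1-q)`. -/
lemma density_sum_eq_meanSum (hα : 0 < α) (hρ : ρ ∈ Icc (1 / 2 : ℝ) 2)
    (hσ : σ ∈ Icc (1 / 2 : ℝ) 2)
    {G : ℝ × ℝ → ℝ} {C : ℝ} (hG : ∀ y, 0 ≤ y.1 → 0 ≤ y.2 → |G y| ≤ C * (1 + (y.1 + y.2)))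
    (hhom : ∀ k y, 0 < k → G (k * y.1, k * y.2) = k * G y) :
    ∑' p : ℕ+ × Direction, 1 / (p.1 : ℝ) *
        (G (α * (p.1 * p.2.1.1), α * (p.1 * p.2.1.2)) *
          M.density ρ σ (α * (p.1 * p.2.1.1), α * (p.1 * p.2.1.2))) =
      α * meanSum (M.param α ρ σ) (fun x => G (x.1.1, x.1.2)) := by
  have hs := (M.summable_density_sum hα hρ hσ hG)
  rw [tsum_prod_swap hs, meanSum,
    ← tsum_mul_left]
  refine tsum_congr fun x => ?_
  have h1 := M.param_lt_one hα hρ hσ x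
  have h0 := M.param_nonneg α ρ σ x
  have hterm : ∀ k : ℕ+, 1 / (k : ℝ) * (G (α * (k * x.1.1), α * (k * x.1.2)) *
      M.density ρ σ (α * (k * x.1.1), α * (k * x.1.2))) =
      α * G (x.1.1, x.1.2) * M.param α ρ σ x ^ (k : ℕ) := by
    intro k
    have hk : (0 : ℝ) < k := by exact_mod_cast k.pos
    have hGk : G (α * (k * x.1.1), α * (k * x.1.2)) = α * k * G (x.1.1, x.1.2) := by
      rw [← hhom (α * k) (x.1.1, x.1.2) (mul_pos hα hk)]
      congr 2 <;> ring
    rw [M.density_multiple, hGk]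
    field_simp
  refine (tsum_congr hterm).trans ?_
  rw [tsum_mul_left, tsum_pnat_eq_tsum_succ (f := fun n => M.param α ρ σ x ^ n)]
  simp_rw [pow_succ]
  rw [tsum_mul_right, tsum_geometric_of_lt_one h0 h1]
  ring

/-- The series of `-log (1 - q)`; dilation invariance of `K` makes its indicator independent of the
multiple `k`. -/
lemma density_sum_eq_logPart (hα : 0 < α) (hρ : ρ ∈ Icc (1 / 2 : ℝ) 2)
    (hσ : σ ∈ Icc (1 / 2 : ℝ) 2) {K : Set (ℝ × ℝ)}
    (hK : ∀ k y, 0 < k → ((k * y.1, k * y.2) ∈ K ↔ y ∈ K)) :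
    ∑' p : ℕ+ × Direction, 1 / (p.1 : ℝ) *
        (K.indicator 1 ((α * (p.1 * p.2.1.1), α * (p.1 * p.2.1.2)) : ℝ × ℝ) *
          M.density ρ σ (α * (p.1 * p.2.1.1), α * (p.1 * p.2.1.2))) =
      logPart (fun x => K.indicator 1 ((x.1.1, x.1.2) : ℝ × ℝ) * M.param α ρ σ x) := by
  have hs := (M.summable_density_sum hα hρ hσ (G := K.indicator 1) (C := 1) (fun y h1 h2 => by
    by_cases h : y ∈ K <;> simp [h] <;> linarith))
  rw [tsum_prod_swap hs, logPart]
  refine tsum_congr fun x => ?_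
  have h1 := M.param_lt_one hα hρ hσ x
  have h0 := M.param_nonneg α ρ σ x
  by_cases hx : ((x.1.1, x.1.2) : ℝ × ℝ) ∈ K
  · have hterm : ∀ k : ℕ+, 1 / (k : ℝ) * (K.indicator 1
        ((α * (k * x.1.1), α * (k * x.1.2)) : ℝ × ℝ) *
        M.density ρ σ (α * (k * x.1.1), α * (k * x.1.2))) = M.param α ρ σ x ^ (k : ℕ) / (k : ℕ) := by
      intro k
      have hk : (0 : ℝ) < k := by exact_mod_cast k.pos
      have hmem : ((α * (k * x.1.1), α * (k * x.1.2)) : ℝ × ℝ) ∈ K := by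
        rw [← mul_assoc, ← mul_assoc]
        exact (hK (α * k) (x.1.1, x.1.2) (mul_pos hα hk)).2 hx
      rw [M.density_multiple, indicator_of_mem hmem]
      simp only [Pi.one_apply]
      field_simp
    refine (tsum_congr hterm).trans ?_
    rw [tsum_pnat_eq_tsum_succ (f := fun n : ℕ => M.param α ρ σ x ^ n / (n : ℝ)),
      indicator_of_mem hx]
    simp only [Pi.one_apply, one_mul]
    push_cast
    exact (Real.hasSum_pow_div_log_of_abs_lt_one (by rwa [abs_of_nonneg h0])).tsum_eq
  · have hterm : ∀ k : ℕ+, 1 / (k : ℝ) * (K.indicator 1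
        ((α * (k * x.1.1), α * (k * x.1.2)) : ℝ × ℝ) *
        M.density ρ σ (α * (k * x.1.1), α * (k * x.1.2))) = 0 := by
      intro k
      have hk : (0 : ℝ) < k := by exact_mod_cast k.pos
      have hmem : ((α * (k * x.1.1), α * (k * x.1.2)) : ℝ × ℝ) ∉ K := by
        rw [← mul_assoc, ← mul_assoc]
        exact fun h => hx ((hK (α * k) (x.1.1, x.1.2) (mul_pos hα hk)).1 h)
      rw [indicator_of_notMem hmem]
      ring
    refine (tsum_congr hterm).trans ?_
    simp [hx]

end SlopeModel

/-! ### A lower bound for the probability of a prescribed end point -/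

/-- Take `f = (den, num)` of a rational `r` strictly between `a` and `b`. Bézout gives a vector
completing `f` to a basis, and adding multiples of `f` keeps the determinant while moving the slope
up towards `r`: the slopes of `e` and `f` differ by `1/(e₁ f₁)`. -/
lemma exists_lattice_basis_between {a b : ℝ} (ha : 0 ≤ a) (hab : a < b) :
    ∃ e₁ e₂ f₁ f₂ : ℕ, 0 < e₁ ∧ 0 < f₁ ∧ a * e₁ < e₂ ∧ (f₂ : ℝ) < b * f₁ ∧
      e₁ * f₂ = e₂ * f₁ + 1 := by
  obtain ⟨r, har, hrb⟩ := exists_rat_btwn hab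
  have hr0 : 0 < r := by exact_mod_cast ha.trans_lt har
  have hnum : 0 < r.num := Rat.num_pos.2 hr0
  obtain ⟨p, hp⟩ := Int.eq_ofNat_of_zero_le hnum.le
  have hp0 : 0 < p := by omega
  have hd0 : 0 < r.den := r.den_pos
  have hd0' : (0 : ℝ) < r.den := by exact_mod_cast hd0
  have hrr : (r : ℝ) * r.den = p := by
    have h := Rat.mul_den_eq_num r
    rw [hp] at h
    exact_mod_cast h
  have hcop : Nat.gcd p r.den = 1 := by
    have := r.reduced
    rw [hp] at this
    simpa using this
  have hbez : (p : ℤ) * Nat.gcdA p r.den + r.den * Nat.gcdB p r.den = 1 := by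
    have h := Nat.gcd_eq_gcd_ab p r.den
    rw [hcop] at h
    exact_mod_cast h.symm
  set A := Nat.gcdA p r.den
  set B := Nat.gcdB p r.den
  obtain ⟨N, hN⟩ := exists_nat_gt (1 / (((r : ℝ) - a) * r.den))
  have hra : 0 < ((r : ℝ) - a) * r.den := mul_pos (by linarith) hd0'
  -- Large enough for both coordinates to be nonnegative and for `e₁ > N`, which puts the slope of
  -- `e` above `a`.
  set m : ℤ := |A| + |B| + N + 1 with hm
  have hm0 : 0 ≤ m := by positivity
  have hden1 : (1 : ℤ) ≤ r.den := by exact_mod_cast hd0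
  have hp1 : (1 : ℤ) ≤ p := by exact_mod_cast hp0
  have h1 : (N : ℤ) < A + m * r.den := by
    have := mul_le_mul_of_nonneg_left hden1 hm0
    have := neg_abs_le A
    have := abs_nonneg B
    linarith
  have h2 : 0 ≤ -B + m * p := by
    have := mul_le_mul_of_nonneg_left hp1 hm0
    have := le_abs_self B
    have := abs_nonneg A
    have : (0 : ℤ) ≤ N := Int.natCast_nonneg N
    linarith
  obtain ⟨e₁, he₁⟩ := Int.eq_ofNat_of_zero_le ((Int.natCast_nonneg N).trans h1.le)
  obtain ⟨e₂, he₂⟩ := Int.eq_ofNat_of_zero_le h2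
  have he₁N : N < e₁ := by rw [he₁] at h1; exact_mod_cast h1
  have hdet : e₁ * p = e₂ * r.den + 1 := by
    have : (e₁ : ℤ) * p = e₂ * r.den + 1 := by
      rw [← he₁, ← he₂]; linear_combination hbez
    exact_mod_cast this
  refine ⟨e₁, e₂, r.den, p, by omega, hd0, ?_, ?_, hdet⟩
  · have hdet' : (e₁ : ℝ) * p = e₂ * r.den + 1 := by exact_mod_cast hdet
    have hlt : 1 < ((r : ℝ) - a) * r.den * e₁ := by
      have : (1 / (((r : ℝ) - a) * r.den)) < e₁ := hN.trans (by exact_mod_cast he₁N)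
      rw [div_lt_iff₀ hra] at this
      linarith
    have h3 : a * e₁ * r.den < e₂ * r.den := by
      rw [← hrr] at hdet'
      nlinarith
    exact lt_of_mul_lt_mul_right h3 hd0'.le
  · rw [← hrr]
    exact mul_lt_mul_of_pos_right hrb hd0'

lemma endpoint_fst (Γ : PolyLine) : ((endpoint Γ).1 : ℝ) = linSum (fun x => (x.1.1 : ℝ)) Γ := by
  unfold endpoint linSum Finsupp.sum
  rw [Prod.fst_sum]
  push_cast
  exact Finset.sum_congr rfl fun x _ => by simp

lemma endpoint_snd (Γ : PolyLine) : ((endpoint Γ).2 : ℝ) = linSum (fun x => (x.1.2 : ℝ)) Γ := by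
  unfold endpoint linSum Finsupp.sum
  rw [Prod.snd_sum]
  push_cast
  exact Finset.sum_congr rfl fun x _ => by simp

lemma endpoint_add_single (Γ : PolyLine) (x : Direction) (k : ℕ) :
    endpoint (Γ + Finsupp.single x k) = endpoint Γ + k • x.1 := by
  unfold endpoint
  rw [Finsupp.sum_add_index' (by simp) (by intros; rw [add_smul]),
    Finsupp.sum_single_index (by simp)]

lemma logPart_indicator_add {q : Direction → ℝ} (hs : Summable q) (K : Set Direction) :
    logPart (K.indicator q) + logPart (Kᶜ.indicator q) = logPart q := by
  have h1 := summable_neg_log_one_sub (hs.indicator K)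
  have h2 := summable_neg_log_one_sub (hs.indicator Kᶜ)
  unfold logPart
  rw [← h1.tsum_add h2]
  refine tsum_congr fun x => ?_
  by_cases hx : x ∈ K <;> simp [hx]

/-- Filling the gap to the end point with two directions from an emptied set `K` of directions. -/
lemma geomMeasure_linesTo_ge {q : Direction → ℝ} (h0 : ∀ x, 0 ≤ q x)
    (hs : Summable q) {K : Set Direction} {e f : Direction} (he : e ∈ K) (hf : f ∈ K)
    {n : ℕ × ℕ} {A : Set PolyLine} {p : ℝ} (hp : 0 ≤ p)
    (hA : ∀ Γ ∈ A, ∃ k l : ℕ, endpoint Γ + k • e.1 + l • f.1 = n ∧ p ≤ q e ^ k * q f ^ l) :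
    ENNReal.ofReal (Real.exp (-logPart (K.indicator q)) * p) * geomMeasure (Kᶜ.indicator q) A ≤
      geomMeasure q (linesTo n) := by
  classical
  -- Only lines without edges in `K` carry mass once `K` is emptied, and on them the two weights
  -- differ by the factor `exp (-logPart (K.indicator q))` alone.
  let B : Set PolyLine := {Γ | Γ ∈ A ∧ ∀ x ∈ K, Γ x = 0}
  choose! k l hkl using hA
  -- Injective although `k` and `l` depend on the line: the original is recovered by deleting all
  -- edges in `K`.
  let φ : B → PolyLine := fun Γ => Γ.1 + Finsupp.single e (k Γ.1) + Finsupp.single f (l Γ.1)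
  have hφ : Function.Injective φ := by
    intro Γ Γ' h
    have hfil : ∀ Γ : B, ∀ x, x ∉ K → φ Γ x = Γ.1 x := by
      intro Γ x hx
      have h1 : e ≠ x := fun h => hx (h ▸ he)
      have h2 : f ≠ x := fun h => hx (h ▸ hf)
      simp [φ, h1, h2]
    refine Subtype.ext (Finsupp.ext fun x => ?_)
    by_cases hx : x ∈ K
    · rw [Γ.2.2 x hx, Γ'.2.2 x hx]
    · rw [← hfil Γ x hx, ← hfil Γ' x hx, h]
  have hprod : ∀ Γ : PolyLine, (∃ x ∈ K, Γ x ≠ 0) → geomWeight (Kᶜ.indicator q) Γ = 0 := by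
    rintro Γ ⟨x, hx, hΓ⟩
    unfold geomWeight
    rw [Finsupp.prod, Finset.prod_eq_zero (Finsupp.mem_support_iff.2 hΓ), mul_zero]
    simp [hx, hΓ]
  have hB : geomMeasure (Kᶜ.indicator q) A =
      ∑' Γ : B, ENNReal.ofReal (geomWeight (Kᶜ.indicator q) Γ) := by
    rw [geomMeasure_apply, tsum_subtype B fun Γ => ENNReal.ofReal (geomWeight (Kᶜ.indicator q) Γ)]
    refine tsum_congr fun Γ => ?_
    by_cases hΓ : Γ ∈ A
    · by_cases hΓB : ∀ x ∈ K, Γ x = 0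
      · rw [indicator_of_mem hΓ, indicator_of_mem (show Γ ∈ B from ⟨hΓ, hΓB⟩)]
      · push Not at hΓB
        rw [indicator_of_mem hΓ, hprod Γ hΓB, indicator_of_notMem, ENNReal.ofReal_zero]
        rintro ⟨_, h⟩
        obtain ⟨x, hx, hx'⟩ := hΓB
        exact hx' (h x hx)
    · rw [indicator_of_notMem hΓ, indicator_of_notMem (fun h : Γ ∈ B => hΓ h.1)]
  have hterm : ∀ Γ : B, ENNReal.ofReal (Real.exp (-logPart (K.indicator q)) * p) *
      ENNReal.ofReal (geomWeight (Kᶜ.indicator q) Γ) ≤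
      (linesTo n).indicator (fun Γ => ENNReal.ofReal (geomWeight q Γ)) (φ Γ) := by
    intro Γ
    obtain ⟨hend, hple⟩ := hkl Γ.1 Γ.2.1
    have hmem : φ Γ ∈ linesTo n := by
      change endpoint (Γ.1 + Finsupp.single e (k Γ.1) + Finsupp.single f (l Γ.1)) = n
      rw [endpoint_add_single, endpoint_add_single, hend]
    rw [indicator_of_mem hmem, ← ENNReal.ofReal_mul (by positivity)]
    refine ENNReal.ofReal_le_ofReal ?_
    have hP0 : 0 ≤ Γ.1.prod fun x k => q x ^ k :=
      Finset.prod_nonneg fun x _ => pow_nonneg (h0 x) _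
    have hw1 : geomWeight (Kᶜ.indicator q) Γ.1 =
        Real.exp (-logPart (Kᶜ.indicator q)) * Γ.1.prod fun x k => q x ^ k := by
      unfold geomWeight
      congr 1
      refine Finset.prod_congr rfl fun x hx => ?_
      have : x ∉ K := fun hxK => (Finsupp.mem_support_iff.1 hx) (Γ.2.2 x hxK)
      simp [this]
    have hw2 : geomWeight q (φ Γ) = Real.exp (-logPart q) *
        ((Γ.1.prod fun x k => q x ^ k) * q e ^ (k Γ.1) * q f ^ (l Γ.1)) := by
      unfold geomWeight
      congr 1
      change (Γ.1 + Finsupp.single e (k Γ.1) + Finsupp.single f (l Γ.1)).prod _ = _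
      rw [Finsupp.prod_add_index' (by simp) (by intros; rw [pow_add]),
        Finsupp.prod_add_index' (by simp) (by intros; rw [pow_add]),
        Finsupp.prod_single_index (by simp), Finsupp.prod_single_index (by simp)]
    rw [hw1, hw2, ← logPart_indicator_add hs K, neg_add, Real.exp_add]
    calc _ = Real.exp (-logPart (K.indicator q)) * Real.exp (-logPart (Kᶜ.indicator q)) *
          ((Γ.1.prod fun x k => q x ^ k) * p) := by ring
      _ ≤ Real.exp (-logPart (K.indicator q)) * Real.exp (-logPart (Kᶜ.indicator q)) *
          ((Γ.1.prod fun x k => q x ^ k) * (q e ^ (k Γ.1) * q f ^ (l Γ.1))) := by gcongr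
      _ = _ := by ring
  rw [hB, ← ENNReal.tsum_mul_left, geomMeasure_apply q]
  refine (ENNReal.tsum_le_tsum hterm).trans ?_
  exact ENNReal.tsum_comp_le_tsum_of_injective hφ
    ((linesTo n).indicator (fun Γ => ENNReal.ofReal (geomWeight q Γ)))

lemma meanSum_indicator (q W : Direction → ℝ) (K : Set Direction) :
    meanSum (K.indicator q) W = meanSum q (K.indicator W) := by
  refine tsum_congr fun x => ?_
  by_cases hx : x ∈ K <;> simp [hx]

/-! ### Limits of scaled means. -/

namespace SlopeModel

variable (M : SlopeModel)

/-- The limit of the scaled mean of the functional `x₁ ψ(x₂ / x₁)`. -/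
def limitMean (ψ : ℝ → ℝ) : ℝ :=
  2 * (riemannZeta 3).re / (riemannZeta 2).re * ∫ t in Icc M.t₀ M.t₁, ψ t / M.E t ^ 3

variable {α ρ σ : ℕ → ℝ}

/-- The case `d = 1` of `integral_mul_density`, whence the factor `2! = 2`. The scale is `α³` since
homogeneity contributes one power of `α` beyond the `α²` of the Riemann sum. -/
lemma tendsto_meanSum (hα : ∀ i, 0 < α i) (hα0 : Tendsto α atTop (𝓝 0))
    (hρI : ∀ i, ρ i ∈ Icc (1 / 2 : ℝ) 2) (hσI : ∀ i, σ i ∈ Icc (1 / 2 : ℝ) 2)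
    (hρ : Tendsto ρ atTop (𝓝 1)) (hσ : Tendsto σ atTop (𝓝 1)) {G : ℝ × ℝ → ℝ} {ψ : ℝ → ℝ}
    (hG : ∀ y, 0 ≤ y.1 → 0 ≤ y.2 → |G y| ≤ y.1 + y.2)
    (hhom : ∀ k y, 0 < k → G (k * y.1, k * y.2) = k * G y)
    (hGc : ∀ᵐ x ∂(volume.restrict quadrant), ContinuousAt G x)
    (hψ : Measurable ψ) (hψ0 : ∀ t, 0 ≤ ψ t)
    (hGψ : ∀ y, 0 < y.1 → 0 ≤ y.2 → G y = y.1 * ψ (y.2 / y.1)) :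
    Tendsto (fun i => α i ^ 3 * meanSum (M.param (α i) (ρ i) (σ i)) (fun x => G (x.1.1, x.1.2)))
      atTop (𝓝 (M.limitMean ψ)) := by
  have hG1 : ∀ y : ℝ × ℝ, 0 ≤ y.1 → 0 ≤ y.2 → |G y| ≤ 1 * (1 + (y.1 + y.2)) := fun y h1 h2 =>
    (hG y h1 h2).trans (by linarith)
  have h := M.tendsto_density_sum hα hα0 hρI hσI hρ hσ hG1 hGc
  rw [M.integral_mul_density (d := 1) hψ hψ0 (by simpa using hGψ)] at h
  have hl : (riemannZeta 3).re / (riemannZeta 2).re *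
      ∫ t in Icc M.t₀ M.t₁, ((1 + 1).factorial : ℝ) * ψ t / M.E t ^ (1 + 2) = M.limitMean ψ := by
    have : ∀ t, ((1 + 1).factorial : ℝ) * ψ t / M.E t ^ (1 + 2) = 2 * (ψ t / M.E t ^ 3) := by
      intro t
      norm_num [Nat.factorial]
      ring
    simp_rw [this]
    rw [integral_const_mul, limitMean]; ring
  rw [hl] at h
  refine h.congr fun i => ?_
  rw [M.density_sum_eq_meanSum (hα i) (hρI i) (hσI i) hG1 hhom]
  ring

end SlopeModel

/-- The closed sector of slopes in `[a, b]`. -/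
def sector (a b : ℝ) : Set (ℝ × ℝ) := {y | 0 < y.1 ∧ a * y.1 ≤ y.2 ∧ y.2 ≤ b * y.1}

lemma smul_mem_sector {a b k : ℝ} (hk : 0 < k) (y : ℝ × ℝ) :
    (k * y.1, k * y.2) ∈ sector a b ↔ y ∈ sector a b := by
  simp only [sector, mem_ofPred_eq, mul_pos_iff_of_pos_left hk]
  rw [mul_left_comm a, mul_left_comm b, mul_le_mul_iff_right₀ hk, mul_le_mul_iff_right₀ hk]

lemma mem_sector_iff {a b : ℝ} {y : ℝ × ℝ} (hy : 0 < y.1) :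
    y ∈ sector a b ↔ y.2 / y.1 ∈ Icc a b := by
  simp only [sector, mem_ofPred_eq, mem_Icc, le_div_iff₀ hy, div_le_iff₀ hy]
  tauto

lemma ae_notMem_frontier_sector (a b : ℝ) :
    ∀ᵐ x ∂(volume.restrict quadrant), x ∉ frontier (sector a b) := by
  filter_upwards [ae_quadrant_fst_pos, ae_quadrant_ne_line a, ae_quadrant_ne_line b]
    with x h1 h2 h3 hx
  by_cases hin : a * x.1 < x.2 ∧ x.2 < b * x.1
  · have : x ∈ interior (sector a b) := by
      rw [mem_interior_iff_mem_nhds]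
      have o1 : IsOpen {y : ℝ × ℝ | 0 < y.1} := isOpen_lt continuous_const continuous_fst
      have o2 : IsOpen {y : ℝ × ℝ | a * y.1 < y.2} := isOpen_lt (by fun_prop) continuous_snd
      have o3 : IsOpen {y : ℝ × ℝ | y.2 < b * y.1} := isOpen_lt continuous_snd (by fun_prop)
      filter_upwards [o1.mem_nhds h1, o2.mem_nhds hin.1, o3.mem_nhds hin.2] with y a b c
      exact ⟨a, le_of_lt b, le_of_lt c⟩
    exact hx.2 this
  · have hcl : x ∉ closure (sector a b) := by
      intro hc
      have hsub : sector a b ⊆ {y : ℝ × ℝ | a * y.1 ≤ y.2} ∩ {y | y.2 ≤ b * y.1} :=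
        fun y hy => ⟨hy.2.1, hy.2.2⟩
      have hcl2 : IsClosed ({y : ℝ × ℝ | a * y.1 ≤ y.2} ∩ {y | y.2 ≤ b * y.1}) :=
        (isClosed_le (by fun_prop) continuous_snd).inter (isClosed_le continuous_snd (by fun_prop))
      obtain ⟨c1, c2⟩ := hcl2.closure_subset_iff.2 hsub hc
      exact hin ⟨lt_of_le_of_ne c1 (Ne.symm h2), lt_of_le_of_ne c2 h3⟩
    exact hcl hx.1

lemma ae_continuousAt_indicator_sector (a b : ℝ) {G : ℝ × ℝ → ℝ} (hG : Continuous G) :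
    ∀ᵐ x ∂(volume.restrict quadrant), ContinuousAt ((sector a b).indicator G) x := by
  filter_upwards [ae_notMem_frontier_sector a b] with x hx
  exact hG.continuousOn.continuousAt_indicator hx

lemma ae_continuousAt_indicator_sector_compl (a b : ℝ) {G : ℝ × ℝ → ℝ} (hG : Continuous G) :
    ∀ᵐ x ∂(volume.restrict quadrant), ContinuousAt ((sector a b)ᶜ.indicator G) x := by
  filter_upwards [ae_notMem_frontier_sector a b] with x hx
  exact hG.continuousOn.continuousAt_indicator (by rwa [frontier_compl])

lemma tendsto_exp_neg_div_sq {α : ℕ → ℝ} (hα : ∀ i, 0 < α i) (hα0 : Tendsto α atTop (𝓝 0)) {d : ℝ}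
    (hd : 0 < d) : Tendsto (fun i => ENNReal.ofReal (Real.exp (-(d / α i ^ 2)))) atTop (𝓝 0) := by
  have h1 : Tendsto (fun i => α i ^ 2) atTop (𝓝[>] 0) := by
    refine tendsto_nhdsWithin_iff.2 ⟨by simpa using hα0.pow 2, Eventually.of_forall fun i => ?_⟩
    exact pow_pos (hα i) 2
  have h2 : Tendsto (fun i => d / α i ^ 2) atTop atTop := by
    simp_rw [div_eq_mul_inv]
    exact (tendsto_inv_nhdsGT_zero.comp h1).const_mul_atTop hd
  have h3 := (Real.tendsto_exp_neg_atTop_nhds_zero.comp h2)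
  have h4 := (ENNReal.continuous_ofReal.tendsto 0).comp h3
  rw [ENNReal.ofReal_zero] at h4
  exact h4

/-- Exponentially small probability of deviations from the limit of the means. -/
lemma eventually_deviation_le {α : ℕ → ℝ} (hα : ∀ i, 0 < α i) {r : ℝ}
    (hr : 0 < r) {q : ℕ → Direction → ℝ} (h0 : ∀ i x, 0 ≤ q i x)
    (hq : ∀ i x, q i x ≤ Real.exp (-(α i * r * (x.1.1 + x.1.2)))) {W : Direction → ℝ}
    (hW : ∀ x, |W x| ≤ x.1.1 + x.1.2) {m : ℝ}
    (hm : Tendsto (fun i => α i ^ 3 * meanSum (q i) W) atTop (𝓝 m)) {η : ℝ} (hη : 0 < η) :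
    ∃ d > 0, ∀ᶠ i in atTop, geomMeasure (q i) {Γ | η ≤ |α i ^ 3 * linSum W Γ - m|} ≤
      2 * ENNReal.ofReal (Real.exp (-(d / α i ^ 2))) := by
  -- The deviation bound is used with `b = α r`, so the threshold is rescaled by `r³`; the other
  -- `η/2` absorbs the distance of the scaled mean from `m`.
  have hη' : 0 < η / 2 * r ^ 3 := by positivity
  refine ⟨deviationRate (η / 2 * r ^ 3) / r ^ 2, div_pos (deviationRate_pos hη') (by positivity), ?_⟩
  have hev : ∀ᶠ i in atTop, |α i ^ 3 * meanSum (q i) W - m| < η / 2 := by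
    have := (tendsto_iff_norm_sub_tendsto_zero.1 hm).eventually (gt_mem_nhds (half_pos hη))
    simpa using this
  filter_upwards [hev] with i hi
  have hdev := geomMeasure_deviation (mul_pos (hα i) hr) (h0 i) (hq i) hW hη'
  have hα3 : 0 < α i ^ 3 := pow_pos (hα i) 3
  have e1 : deviationRate (η / 2 * r ^ 3) / r ^ 2 / α i ^ 2 =
      deviationRate (η / 2 * r ^ 3) / (α i * r) ^ 2 := by
    rw [div_div]; congr 1; ring
  rw [e1]
  refine (measure_mono ?_).trans hdev
  intro Γ hΓ
  have hΓ' : η ≤ |α i ^ 3 * linSum W Γ - m| := hΓ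
  change η / 2 * r ^ 3 / (α i * r) ^ 3 ≤ |linSum W Γ - meanSum (q i) W|
  have e2 : η / 2 * r ^ 3 / (α i * r) ^ 3 = η / 2 / α i ^ 3 := by
    field_simp
  rw [e2, div_le_iff₀ hα3]
  have h3 : |linSum W Γ - meanSum (q i) W| * α i ^ 3 =
      |α i ^ 3 * linSum W Γ - α i ^ 3 * meanSum (q i) W| := by
    rw [← mul_sub, abs_mul, abs_of_pos hα3, mul_comm]
  rw [h3]
  have h4 := abs_sub_le (α i ^ 3 * linSum W Γ) (α i ^ 3 * meanSum (q i) W) m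
  linarith

namespace SlopeModel

variable (M : SlopeModel)

/-- The asymptotic regime: scale `α → 0`, tilts tending to `1`, end points of size `α⁻³`. -/
structure Regime (α ρ σ : ℕ → ℝ) (n : ℕ → ℕ × ℕ) : Prop where
  pos : ∀ i, 0 < α i
  lim : Tendsto α atTop (𝓝 0)
  ρ_mem : ∀ i, ρ i ∈ Icc (1 / 2 : ℝ) 2
  σ_mem : ∀ i, σ i ∈ Icc (1 / 2 : ℝ) 2
  ρ_lim : Tendsto ρ atTop (𝓝 1)
  σ_lim : Tendsto σ atTop (𝓝 1)
  fst_lim : Tendsto (fun i => α i ^ 3 * (n i).1) atTop (𝓝 1)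
  snd_lim : Tendsto (fun i => α i ^ 3 * (n i).2) atTop (𝓝 M.c)

lemma integrableOn_div {ψ : ℝ → ℝ} (hψ : Measurable ψ) {B : ℝ}
    (hB : ∀ t ∈ Icc M.t₀ M.t₁, |ψ t| ≤ B) (k : ℕ) :
    IntegrableOn (fun t => ψ t / M.E t ^ k) (Icc M.t₀ M.t₁) := by
  have hm : Measurable fun t => ψ t / M.E t ^ k := hψ.div (M.continuous_E.measurable.pow_const k)
  refine Measure.integrableOn_of_bounded (M := B / M.Emin ^ k) (by simp) hm.aestronglyMeasurable ?_
  filter_upwards [ae_restrict_mem measurableSet_Icc] with t ht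
  have hE := M.Emin_le t
  have h0 := M.Emin_pos
  have hE0 := M.E_pos t
  rw [norm_div, Real.norm_of_nonneg (pow_pos hE0 k).le]
  have hB0 : 0 ≤ B := (abs_nonneg _).trans (hB t ht)
  exact div_le_div₀ hB0 (hB t ht) (pow_pos h0 k) (pow_le_pow_left₀ h0.le hE k)

lemma limitMean_indicator_add {ψ : ℝ → ℝ} (hψ : Measurable ψ) {B : ℝ}
    (hB : ∀ t ∈ Icc M.t₀ M.t₁, |ψ t| ≤ B) {s : Set ℝ} (hs : MeasurableSet s) :
    M.limitMean (s.indicator ψ) + M.limitMean (sᶜ.indicator ψ) = M.limitMean ψ := by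
  have hle : ∀ s : Set ℝ, ∀ t ∈ Icc M.t₀ M.t₁, |s.indicator ψ t| ≤ B := fun s t ht => by
    have := hB t ht
    by_cases h : t ∈ s
    · simpa [h] using this
    · simpa [h] using (abs_nonneg _).trans this
  have h1 := M.integrableOn_div (hψ.indicator hs) (hle s) 3
  have h2 := M.integrableOn_div (hψ.indicator hs.compl) (hle sᶜ) 3
  unfold limitMean
  rw [← mul_add, ← integral_add h1 h2]
  congr 1
  refine integral_congr_ae (Eventually.of_forall fun t => ?_)
  by_cases h : t ∈ s <;> simp [h]

lemma setIntegral_indicator_Icc {ψ : ℝ → ℝ} {a b : ℝ} (ha : M.t₀ ≤ a) (hab : a ≤ b) (hb : b ≤ M.t₁)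
    (k : ℕ) : ∫ t in Icc M.t₀ M.t₁, (Icc a b).indicator ψ t / M.E t ^ k =
      ∫ t in a..b, ψ t / M.E t ^ k := by
  have : ∀ t, (Icc a b).indicator ψ t / M.E t ^ k =
      (Icc a b).indicator (fun t => ψ t / M.E t ^ k) t := fun t => by
    by_cases h : t ∈ Icc a b <;> simp [h]
  simp_rw [this]
  rw [setIntegral_indicator measurableSet_Icc,
    inter_eq_self_of_subset_right (Icc_subset_Icc ha hb), integral_Icc_eq_integral_Ioc,
    intervalIntegral.integral_of_le hab]

lemma intervalIntegrable_div {ψ : ℝ → ℝ} (hψ : Continuous ψ) (k : ℕ) (a b : ℝ) :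
    IntervalIntegrable (fun t => ψ t / M.E t ^ k) volume a b :=
  (hψ.div (M.continuous_E.pow k) fun t => (pow_pos (M.E_pos t) k).ne').intervalIntegrable a b

lemma integral_one_div_le {a b : ℝ} (hab : a ≤ b) (k : ℕ) :
    ∫ t in a..b, (1 : ℝ) / M.E t ^ k ≤ (b - a) / M.Emin ^ k := by
  have h : ∫ t in a..b, (1 : ℝ) / M.E t ^ k ≤ ∫ _ in a..b, 1 / M.Emin ^ k := by
    refine intervalIntegral.integral_mono_on hab (M.intervalIntegrable_div continuous_const k a b)
      intervalIntegrable_const fun t _ => ?_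
    exact one_div_le_one_div_of_le (pow_pos M.Emin_pos k)
      (pow_le_pow_left₀ M.Emin_pos.le (M.Emin_le t) k)
  rw [intervalIntegral.integral_const, smul_eq_mul] at h
  rwa [mul_one_div] at h

lemma zeta_ratio_pos : 0 < (riemannZeta 3).re / (riemannZeta 2).re :=
  div_pos zeta_three_re_pos zeta_two_re_pos

/-- The mean displacement over the slopes in `[a, b]` has a slope strictly between `a` and `b`. -/
lemma limitMean_sector {a b : ℝ} (ha : M.t₀ ≤ a) (hab : a < b) (hb : b ≤ M.t₁) :
    a * M.limitMean ((Icc a b).indicator 1) < M.limitMean ((Icc a b).indicator fun t => |t|) ∧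
    M.limitMean ((Icc a b).indicator fun t => |t|) < b * M.limitMean ((Icc a b).indicator 1) ∧
    M.limitMean ((Icc a b).indicator 1) ≤
      2 * (riemannZeta 3).re / (riemannZeta 2).re / M.Emin ^ 3 * (b - a) ∧
    0 < M.limitMean ((Icc a b).indicator 1) := by
  have hk : 0 < 2 * (riemannZeta 3).re / (riemannZeta 2).re := by
    have := zeta_ratio_pos
    rw [mul_div_assoc]; positivity
  set k := 2 * (riemannZeta 3).re / (riemannZeta 2).re with hkdef
  have e1 : M.limitMean ((Icc a b).indicator 1) = k * ∫ t in a..b, (1 : ℝ) / M.E t ^ 3 := by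
    unfold limitMean
    rw [M.setIntegral_indicator_Icc ha hab.le hb]
    rfl
  have e2 : M.limitMean ((Icc a b).indicator fun t => |t|) =
      k * ∫ t in a..b, t / M.E t ^ 3 := by
    unfold limitMean
    rw [M.setIntegral_indicator_Icc ha hab.le hb, ← hkdef]
    congr 1
    refine intervalIntegral.integral_congr fun t ht => ?_
    rw [uIcc_of_le hab.le] at ht
    simp only [abs_of_nonneg (M.t₀_nonneg.trans (ha.trans ht.1))]
  have i1 := M.intervalIntegrable_div (continuous_const (y := (1 : ℝ))) 3 a b
  have i2 := M.intervalIntegrable_div continuous_id 3 a b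
  simp only [id] at i2
  have p1 : 0 < ∫ t in a..b, (t - a) / M.E t ^ 3 :=
    intervalIntegral.intervalIntegral_pos_of_pos_on
      (M.intervalIntegrable_div (by fun_prop) 3 a b)
      (fun t ht => div_pos (by linarith [ht.1]) (pow_pos (M.E_pos t) 3)) hab
  have p2 : 0 < ∫ t in a..b, (b - t) / M.E t ^ 3 :=
    intervalIntegral.intervalIntegral_pos_of_pos_on
      (M.intervalIntegrable_div (by fun_prop) 3 a b)
      (fun t ht => div_pos (by linarith [ht.2]) (pow_pos (M.E_pos t) 3)) hab
  have p0 : 0 < ∫ t in a..b, (1 : ℝ) / M.E t ^ 3 :=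
    intervalIntegral.intervalIntegral_pos_of_pos_on i1
      (fun t ht => div_pos one_pos (pow_pos (M.E_pos t) 3)) hab
  have s1 : ∫ t in a..b, (t - a) / M.E t ^ 3 =
      (∫ t in a..b, t / M.E t ^ 3) - a * ∫ t in a..b, (1 : ℝ) / M.E t ^ 3 := by
    rw [← intervalIntegral.integral_const_mul, ← intervalIntegral.integral_sub i2 (i1.const_mul a)]
    congr 1; ext t; ring
  have s2 : ∫ t in a..b, (b - t) / M.E t ^ 3 =
      b * (∫ t in a..b, (1 : ℝ) / M.E t ^ 3) - ∫ t in a..b, t / M.E t ^ 3 := by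
    rw [← intervalIntegral.integral_const_mul, ← intervalIntegral.integral_sub (i1.const_mul b) i2]
    congr 1; ext t; ring
  rw [e1, e2]
  refine ⟨?_, ?_, ?_, mul_pos hk p0⟩
  · rw [s1] at p1; nlinarith [mul_pos hk p1]
  · rw [s2] at p2; nlinarith [mul_pos hk p2]
  · have := mul_le_mul_of_nonneg_left (M.integral_one_div_le hab.le 3) hk.le
    refine this.trans_eq ?_
    ring

/-- The directions with slopes in `[a, b]`. -/
def sectorDirections (a b : ℝ) : Set Direction := {x | ((x.1.1, x.1.2) : ℝ × ℝ) ∈ sector a b}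

variable {M} {α ρ σ : ℕ → ℝ} {n : ℕ → ℕ × ℕ}

/-- The quantity times `α²` tends to `ζ(3)/ζ(2) ∫ₐᵇ E⁻²`, which is at most proportional to `b - a`.
Emptying a narrow sector is therefore cheap on the exponential scale `α⁻²`. -/
lemma Regime.eventually_logPart_lt (h : M.Regime α ρ σ n) {a b : ℝ} (ha : M.t₀ ≤ a) (hab : a ≤ b)
    (hb : b ≤ M.t₁) {δ : ℝ}
    (hδ : (riemannZeta 3).re / (riemannZeta 2).re / M.Emin ^ 2 * (b - a) < δ) :
    ∀ᶠ i in atTop, logPart ((sectorDirections a b).indicator (M.param (α i) (ρ i) (σ i))) ≤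
      δ / α i ^ 2 := by
  have hlim := M.tendsto_density_sum h.pos h.lim h.ρ_mem h.σ_mem h.ρ_lim h.σ_lim
    (G := (sector a b).indicator 1) (C := 1) (fun y h1 h2 => by
      by_cases hy : y ∈ sector a b <;> simp [hy] <;> linarith)
    (ae_continuousAt_indicator_sector a b continuous_const)
  have hG : ∀ y : ℝ × ℝ, 0 < y.1 → 0 ≤ y.2 →
      (sector a b).indicator (1 : ℝ × ℝ → ℝ) y = y.1 ^ 0 * (Icc a b).indicator 1 (y.2 / y.1) := by
    intro y h1 _
    by_cases hy : y ∈ sector a b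
    · have hy' := (mem_sector_iff h1).1 hy
      rw [indicator_of_mem hy, indicator_of_mem hy']; simp
    · have hy' : y.2 / y.1 ∉ Icc a b := fun h => hy ((mem_sector_iff h1).2 h)
      rw [indicator_of_notMem hy, indicator_of_notMem hy']; simp
  rw [M.integral_mul_density (d := 0) (ψ := (Icc a b).indicator 1)
    (measurable_const.indicator measurableSet_Icc)
    (fun t => indicator_nonneg (fun _ _ => zero_le_one) t) hG] at hlim
  simp only [zero_add, Nat.factorial_one, Nat.cast_one, one_mul] at hlim
  rw [M.setIntegral_indicator_Icc ha hab hb] at hlim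
  have hle : (riemannZeta 3).re / (riemannZeta 2).re *
      ∫ t in a..b, (1 : ℝ → ℝ) t / M.E t ^ 2 < δ := by
    refine lt_of_le_of_lt ?_ hδ
    refine (mul_le_mul_of_nonneg_left (M.integral_one_div_le hab 2) zeta_ratio_pos.le).trans_eq ?_
    ring
  filter_upwards [hlim.eventually (gt_mem_nhds hle)] with i hi
  rw [M.density_sum_eq_logPart (h.pos i) (h.ρ_mem i) (h.σ_mem i)
    (fun k y hk => smul_mem_sector hk y)] at hi
  have hα2 : 0 < α i ^ 2 := pow_pos (h.pos i) 2
  rw [le_div_iff₀ hα2]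
  have : (fun x : Direction => (sector a b).indicator 1 ((x.1.1, x.1.2) : ℝ × ℝ) *
      M.param (α i) (ρ i) (σ i) x) =
      (sectorDirections a b).indicator (M.param (α i) (ρ i) (σ i)) := by
    ext x
    by_cases hx : ((x.1.1, x.1.2) : ℝ × ℝ) ∈ sector a b
    · have hx' : x ∈ sectorDirections a b := hx
      simp [hx, hx']
    · have hx' : x ∉ sectorDirections a b := hx
      simp [hx, hx']
  rw [this] at hi
  linarith

lemma Regime.tendsto_meanSum_off_sector (h : M.Regime α ρ σ n) (a b : ℝ) {G : ℝ × ℝ → ℝ}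
    (hGc : Continuous G) {ψ : ℝ → ℝ} (hψ : Measurable ψ) (hψ0 : ∀ t, 0 ≤ ψ t)
    (hG : ∀ y, 0 ≤ y.1 → 0 ≤ y.2 → |G y| ≤ y.1 + y.2)
    (hhom : ∀ k y, 0 < k → G (k * y.1, k * y.2) = k * G y)
    (hGψ : ∀ y, 0 < y.1 → 0 ≤ y.2 → G y = y.1 * ψ (y.2 / y.1)) :
    Tendsto (fun i => α i ^ 3 * meanSum
        ((sectorDirections a b)ᶜ.indicator (M.param (α i) (ρ i) (σ i)))
        (fun x => G (x.1.1, x.1.2)))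
      atTop (𝓝 (M.limitMean ((Icc a b)ᶜ.indicator ψ))) := by
  have hlim := M.tendsto_meanSum h.pos h.lim h.ρ_mem h.σ_mem h.ρ_lim h.σ_lim
    (G := (sector a b)ᶜ.indicator G) (ψ := (Icc a b)ᶜ.indicator ψ)
    (fun y h1 h2 => by
      by_cases hy : y ∈ sector a b
      · simp [hy]; linarith
      · simpa [hy] using hG y h1 h2)
    (fun k y hk => by
      by_cases hy : y ∈ sector a b
      · have := (smul_mem_sector hk y).2 hy
        simp [hy, this]
      · have : (k * y.1, k * y.2) ∉ sector a b := fun h => hy ((smul_mem_sector hk y).1 h)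
        simp [hy, this, hhom k y hk])
    (ae_continuousAt_indicator_sector_compl a b hGc) (hψ.indicator measurableSet_Icc.compl)
    (fun t => indicator_nonneg (fun t _ => hψ0 t) t)
    (fun y h1 h2 => by
      by_cases hy : y ∈ sector a b
      · have hy' : y.2 / y.1 ∉ (Icc a b)ᶜ := fun h => h ((mem_sector_iff h1).1 hy)
        have hy'' : y ∉ (sector a b)ᶜ := fun h => h hy
        rw [indicator_of_notMem hy'', indicator_of_notMem hy', mul_zero]
      · have hy' : y.2 / y.1 ∈ (Icc a b)ᶜ := fun h => hy ((mem_sector_iff h1).2 h)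
        rw [indicator_of_mem (show y ∈ (sector a b)ᶜ from hy), indicator_of_mem hy', hGψ y h1 h2])
  refine hlim.congr fun i => ?_
  rw [meanSum_indicator]
  congr 2

lemma Regime.indicator_param_le (h : M.Regime α ρ σ n) (K : Set Direction) (i : ℕ)
    (x : Direction) : K.indicator (M.param (α i) (ρ i) (σ i)) x ≤
      Real.exp (-(α i * M.rate * (x.1.1 + x.1.2))) := by
  by_cases hx : x ∈ K
  · simpa [hx] using M.param_le (h.pos i).le (h.ρ_mem i) (h.σ_mem i) x
  · simpa [hx] using (Real.exp_pos _).le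

/-- Concentration of the end point once the slopes in `[a, b]` are excluded. -/
lemma Regime.eventually_endpoint_near (h : M.Regime α ρ σ n) (a b : ℝ) {η : ℝ} (hη : 0 < η) :
    ∀ᶠ i in atTop, 1 / 2 ≤ geomMeasure
      ((sectorDirections a b)ᶜ.indicator (M.param (α i) (ρ i) (σ i)))
      {Γ | |α i ^ 3 * (endpoint Γ).1 - M.limitMean ((Icc a b)ᶜ.indicator 1)| < η ∧
        |α i ^ 3 * (endpoint Γ).2 - M.limitMean ((Icc a b)ᶜ.indicator fun t => |t|)| < η} := by
  have h0 : ∀ i x, 0 ≤ (sectorDirections a b)ᶜ.indicator (M.param (α i) (ρ i) (σ i)) x :=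
    fun i x => indicator_nonneg (fun x _ => M.param_nonneg _ _ _ x) x
  have m1 := h.tendsto_meanSum_off_sector a b (G := fun y => y.1) (ψ := 1) continuous_fst
    measurable_const (fun _ => zero_le_one) (fun y h1 h2 => by rw [abs_of_nonneg h1]; linarith)
    (fun k y _ => rfl) (fun y _ _ => by simp)
  have m2 := h.tendsto_meanSum_off_sector a b (G := fun y => y.2) (ψ := fun t => |t|)
    continuous_snd (by fun_prop) (fun t => abs_nonneg t)
    (fun y h1 h2 => by rw [abs_of_nonneg h2]; linarith) (fun k y _ => rfl)
    (fun y h1 h2 => by rw [abs_of_nonneg (div_nonneg h2 h1.le)]; field_simp)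
  obtain ⟨d1, hd1, ev1⟩ := eventually_deviation_le h.pos M.rate_pos h0 (h.indicator_param_le _)
    (fun x => by rw [abs_of_nonneg (by positivity)]; linarith [Nat.cast_nonneg (α := ℝ) x.1.2])
    m1 hη
  obtain ⟨d2, hd2, ev2⟩ := eventually_deviation_le h.pos M.rate_pos h0 (h.indicator_param_le _)
    (fun x => by rw [abs_of_nonneg (by positivity)]; linarith [Nat.cast_nonneg (α := ℝ) x.1.1])
    m2 hη
  have lim0 : Tendsto (fun i => 2 * ENNReal.ofReal (Real.exp (-(d1 / α i ^ 2))) +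
      2 * ENNReal.ofReal (Real.exp (-(d2 / α i ^ 2)))) atTop (𝓝 (2 * 0 + 2 * 0)) :=
    (ENNReal.Tendsto.const_mul (tendsto_exp_neg_div_sq h.pos h.lim hd1) (by simp)).add
      (ENNReal.Tendsto.const_mul (tendsto_exp_neg_div_sq h.pos h.lim hd2) (by simp))
  rw [mul_zero, add_zero] at lim0
  have hhalf : (0 : ℝ≥0∞) < 1 / 2 := by simp
  filter_upwards [ev1, ev2, lim0.eventually (gt_mem_nhds hhalf)] with i e1 e2 e3
  have hb := mul_pos (h.pos i) M.rate_pos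
  have hprob := isProbabilityMeasure_geomMeasure (h0 i)
    (lt_one_of_le_exp hb (h.indicator_param_le _ i))
    (summable_of_le_exp hb (h0 i) (h.indicator_param_le _ i))
  set μ := geomMeasure ((sectorDirections a b)ᶜ.indicator (M.param (α i) (ρ i) (σ i)))
  set A : Set PolyLine :=
    {Γ | |α i ^ 3 * (endpoint Γ).1 - M.limitMean ((Icc a b)ᶜ.indicator 1)| < η ∧
        |α i ^ 3 * (endpoint Γ).2 - M.limitMean ((Icc a b)ᶜ.indicator fun t => |t|)| < η} with hA
  have hAc : μ Aᶜ ≤ 1 / 2 := by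
    refine le_trans (le_trans (measure_mono ?_) ((measure_union_le _ _).trans (add_le_add e1 e2)))
      e3.le
    intro Γ hΓ
    by_contra hcon
    simp only [mem_union, mem_ofPred_eq, not_or, not_le, ← endpoint_fst, ← endpoint_snd] at hcon
    exact hΓ hcon
  have hone : μ A + μ Aᶜ = 1 := by
    rw [measure_add_measure_compl MeasurableSpace.measurableSet_top, measure_univ]
  by_contra hlt
  rw [not_le] at hlt
  have : μ A + μ Aᶜ < 1 / 2 + 1 / 2 := ENNReal.add_lt_add_of_lt_of_le (by
    exact ne_top_of_le_ne_top (by simp) hAc) hlt hAc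
  rw [hone, ENNReal.add_halves] at this
  exact lt_irrefl _ this

end SlopeModel

/-- Cramer's rule with determinant `1`: the coefficients are integers. They are positive because the
scaled gap is within `η` of `(w₁, w₂)`, which lies in the open cone of `e` and `f` with a margin
exceeding the error. -/
lemma exists_lattice_filling {e₁ e₂ f₁ f₂ : ℕ} (hdet : e₁ * f₂ = e₂ * f₁ + 1) {n ξ : ℕ × ℕ}
    {s w₁ w₂ η : ℝ} (hs : 0 < s) (h1 : |s * n.1 - s * ξ.1 - w₁| ≤ η)
    (h2 : |s * n.2 - s * ξ.2 - w₂| ≤ η) (hf : η * (f₁ + f₂) < w₁ * f₂ - w₂ * f₁)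
    (he : η * (e₁ + e₂) < e₁ * w₂ - e₂ * w₁) :
    ∃ k l : ℕ, ξ.1 + k * e₁ + l * f₁ = n.1 ∧ ξ.2 + k * e₂ + l * f₂ = n.2 := by
  obtain ⟨h1a, h1b⟩ := abs_le.1 h1
  obtain ⟨h2a, h2b⟩ := abs_le.1 h2
  have ce1 : (0 : ℝ) ≤ e₁ := Nat.cast_nonneg _
  have ce2 : (0 : ℝ) ≤ e₂ := Nat.cast_nonneg _
  have cf1 : (0 : ℝ) ≤ f₁ := Nat.cast_nonneg _
  have cf2 : (0 : ℝ) ≤ f₂ := Nat.cast_nonneg _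
  have hk : (0 : ℤ) ≤ ((n.1 : ℤ) - ξ.1) * f₂ - ((n.2 : ℤ) - ξ.2) * f₁ := by
    have : 0 < s * (((n.1 : ℝ) - ξ.1) * f₂ - ((n.2 : ℝ) - ξ.2) * f₁) := by
      nlinarith [mul_le_mul_of_nonneg_right h1a cf2, mul_le_mul_of_nonneg_right h2b cf1]
    have h3 := (mul_pos_iff_of_pos_left hs).1 this
    exact_mod_cast h3.le
  have hl : (0 : ℤ) ≤ e₁ * ((n.2 : ℤ) - ξ.2) - e₂ * ((n.1 : ℤ) - ξ.1) := by
    have : 0 < s * (e₁ * ((n.2 : ℝ) - ξ.2) - e₂ * ((n.1 : ℝ) - ξ.1)) := by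
      nlinarith [mul_le_mul_of_nonneg_right h2a ce1, mul_le_mul_of_nonneg_right h1b ce2]
    have h3 := (mul_pos_iff_of_pos_left hs).1 this
    exact_mod_cast h3.le
  obtain ⟨k, hk'⟩ := Int.eq_ofNat_of_zero_le hk
  obtain ⟨l, hl'⟩ := Int.eq_ofNat_of_zero_le hl
  have hdet' : (e₁ : ℤ) * f₂ = e₂ * f₁ + 1 := by exact_mod_cast hdet
  refine ⟨k, l, ?_, ?_⟩
  · have : (ξ.1 : ℤ) + k * e₁ + l * f₁ = n.1 := by
      rw [← hk', ← hl']; linear_combination ((n.1 : ℤ) - ξ.1) * hdet'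
    exact_mod_cast this
  · have : (ξ.2 : ℤ) + k * e₂ + l * f₂ = n.2 := by
      rw [← hk', ← hl']; linear_combination ((n.2 : ℤ) - ξ.2) * hdet'
    exact_mod_cast this

/-! ### The cost of emptying and refilling a sector, and the conditioned measure. -/

namespace SlopeModel

variable (M : SlopeModel)

lemma le_param {α ρ σ : ℝ} (hα : 0 < α) (hρ : ρ ∈ Icc (1 / 2 : ℝ) 2) (hσ : σ ∈ Icc (1 / 2 : ℝ) 2)
    {x : Direction} (hx : ((x.1.1, x.1.2) : ℝ × ℝ) ∈ M.cone ρ) :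
    Real.exp (-(α * (4 * M.Emax) * (x.1.1 + x.1.2))) ≤ M.param α ρ σ x := by
  have hx1 : (0 : ℝ) < x.1.1 := hx.1
  have hmem : ((α * x.1.1, α * x.1.2) : ℝ × ℝ) ∈ M.cone ρ :=
    (M.mem_cone_smul hα (x.1.1, x.1.2)).2 hx
  unfold param density
  rw [if_pos hmem]
  refine Real.exp_le_exp.2 (neg_le_neg ?_)
  refine (M.height_le hρ hσ (y := (α * x.1.1, α * x.1.2)) (mul_pos hα hx1)
    (mul_nonneg hα.le (Nat.cast_nonneg _))).trans_eq ?_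
  simp only; ring

variable {M} {α ρ σ : ℕ → ℝ} {n : ℕ → ℕ × ℕ}

lemma Regime.eventually_mem_cone (h : M.Regime α ρ σ n) {x : Direction} (hx : 0 < x.1.1)
    (h0 : M.t₀ * x.1.1 < x.1.2) (h1 : (x.1.2 : ℝ) < M.t₁ * x.1.1) :
    ∀ᶠ i in atTop, ((x.1.1, x.1.2) : ℝ × ℝ) ∈ M.cone (ρ i) := by
  have hl : Tendsto (fun i => ρ i * (x.1.2 : ℝ)) atTop (𝓝 (1 * x.1.2)) := h.ρ_lim.mul_const _
  rw [one_mul] at hl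
  filter_upwards [hl.eventually (lt_mem_nhds h0), hl.eventually (gt_mem_nhds h1)] with i a b
  exact ⟨Nat.cast_pos.2 hx, a.le, b.le⟩

/-- Starting the interval at the midpoint of `[t₀, t₁]` keeps both slopes in the interior, so that
`e` and `f` lie in the tilted cone as soon as `ρ` is close to `1`. Coprimality follows from the
determinant. -/
lemma exists_basis_directions (M : SlopeModel) {δ : ℝ} (hδ : 0 < δ) :
    ∃ e f : Direction, 0 < e.1.1 ∧ 0 < f.1.1 ∧ e.1.1 * f.1.2 = e.1.2 * f.1.1 + 1 ∧
      M.t₀ * e.1.1 < e.1.2 ∧ (f.1.2 : ℝ) < M.t₁ * f.1.1 ∧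
      (f.1.2 : ℝ) / f.1.1 - (e.1.2 : ℝ) / e.1.1 ≤ δ := by
  set s := (M.t₀ + M.t₁) / 2 with hs
  have hlt := M.t₀_lt
  obtain ⟨e₁, e₂, f₁, f₂, he₁, hf₁, hae, hfb, hdet⟩ :=
    exists_lattice_basis_between (a := s) (b := min (s + δ) M.t₁)
      (by linarith [M.t₀_nonneg]) (lt_min (by linarith) (by linarith))
  have he₁' : (0 : ℝ) < e₁ := by exact_mod_cast he₁
  have hf₁' : (0 : ℝ) < f₁ := by exact_mod_cast hf₁
  have he_cop : Nat.Coprime e₁ e₂ := by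
    rw [Nat.coprime_iff_gcd_eq_one]
    have h1 : Nat.gcd e₁ e₂ ∣ e₂ * f₁ + 1 := hdet ▸ (Nat.gcd_dvd_left e₁ e₂).mul_right f₂
    exact Nat.dvd_one.1 ((Nat.dvd_add_right ((Nat.gcd_dvd_right e₁ e₂).mul_right f₁)).1 h1)
  have hf_cop : Nat.Coprime f₁ f₂ := by
    rw [Nat.coprime_iff_gcd_eq_one]
    have h1 : Nat.gcd f₁ f₂ ∣ e₂ * f₁ + 1 := hdet ▸ (Nat.gcd_dvd_right f₁ f₂).mul_left e₁
    exact Nat.dvd_one.1 ((Nat.dvd_add_right ((Nat.gcd_dvd_left f₁ f₂).mul_left e₂)).1 h1)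
  refine ⟨⟨(e₁, e₂), he_cop⟩, ⟨(f₁, f₂), hf_cop⟩, he₁, hf₁, hdet, ?_, ?_, ?_⟩
  · exact lt_trans (mul_lt_mul_of_pos_right (by linarith) he₁') hae
  · exact hfb.trans_le (mul_le_mul_of_nonneg_right (min_le_right _ _) hf₁'.le)
  · have h1 : s < (e₂ : ℝ) / e₁ := by rwa [lt_div_iff₀ he₁']
    have h2 : (f₂ : ℝ) / f₁ < s + δ := by
      rw [div_lt_iff₀ hf₁']
      exact hfb.trans_le (mul_le_mul_of_nonneg_right (min_le_left _ _) hf₁'.le)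
    simp only
    linarith

/-- An edge costs at most `4 Emax α` per unit of `x₁ + x₂`, so the cost of the filling depends only
on the size of the gap and not on how it is split between `e` and `f`. -/
lemma le_param_pow_mul_pow {α ρ σ : ℝ} (hα : 0 < α) (hρ : ρ ∈ Icc (1 / 2 : ℝ) 2)
    (hσ : σ ∈ Icc (1 / 2 : ℝ) 2) {e f : Direction} (he : ((e.1.1, e.1.2) : ℝ × ℝ) ∈ M.cone ρ)
    (hf : ((f.1.1, f.1.2) : ℝ × ℝ) ∈ M.cone ρ) {n ξ : ℕ × ℕ} {k l : ℕ} {w : ℝ}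
    (h1 : ξ.1 + k * e.1.1 + l * f.1.1 = n.1) (h2 : ξ.2 + k * e.1.2 + l * f.1.2 = n.2)
    (hw : α ^ 3 * n.1 - α ^ 3 * ξ.1 + (α ^ 3 * n.2 - α ^ 3 * ξ.2) ≤ w) :
    Real.exp (-(4 * M.Emax * w / α ^ 2)) ≤ M.param α ρ σ e ^ k * M.param α ρ σ f ^ l := by
  have g1 := pow_le_pow_left₀ (Real.exp_pos _).le (M.le_param hα hρ hσ he) k
  have g2 := pow_le_pow_left₀ (Real.exp_pos _).le (M.le_param hα hρ hσ hf) l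
  refine le_trans ?_ (mul_le_mul g1 g2 (by positivity) (pow_nonneg (M.param_nonneg _ _ _ e) k))
  rw [← Real.exp_nat_mul, ← Real.exp_nat_mul, ← Real.exp_add]
  refine Real.exp_le_exp.2 ?_
  have c1 : (ξ.1 : ℝ) + k * e.1.1 + l * f.1.1 = n.1 := by exact_mod_cast h1
  have c2 : (ξ.2 : ℝ) + k * e.1.2 + l * f.1.2 = n.2 := by exact_mod_cast h2
  have hsum : (k : ℝ) * -(α * (4 * M.Emax) * (e.1.1 + e.1.2)) +
      l * -(α * (4 * M.Emax) * (f.1.1 + f.1.2)) =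
      -(4 * M.Emax * (α ^ 3 * n.1 - α ^ 3 * ξ.1 + (α ^ 3 * n.2 - α ^ 3 * ξ.2)) / α ^ 2) := by
    rw [← c1, ← c2]
    field_simp
    ring
  rw [hsum]
  have := M.Emax_pos
  gcongr

/-- A lower bound for the probability of the end point from emptying a cone spanned by a lattice
basis. -/
lemma Regime.eventually_le_linesTo_of_basis (h : M.Regime α ρ σ n) (H1 : M.limitMean 1 = 1)
    (H2 : M.limitMean (fun t => |t|) = M.c) {e f : Direction} (he₁ : 0 < e.1.1) (hf₁ : 0 < f.1.1)
    (hdet : e.1.1 * f.1.2 = e.1.2 * f.1.1 + 1) (het : M.t₀ * e.1.1 < e.1.2)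
    (hft : (f.1.2 : ℝ) < M.t₁ * f.1.1) {δ κ : ℝ}
    (hδ : (riemannZeta 3).re / (riemannZeta 2).re / M.Emin ^ 2 *
      ((f.1.2 : ℝ) / f.1.1 - (e.1.2 : ℝ) / e.1.1) < δ)
    (hκ : 8 * M.Emax * ((1 + M.t₁) * (2 * (riemannZeta 3).re / (riemannZeta 2).re / M.Emin ^ 3 *
      ((f.1.2 : ℝ) / f.1.1 - (e.1.2 : ℝ) / e.1.1))) ≤ κ) :
    ∀ᶠ i in atTop, ENNReal.ofReal (Real.exp (-(δ / α i ^ 2)) * Real.exp (-(κ / α i ^ 2))) *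
      (1 / 2) ≤ geomMeasure (M.param (α i) (ρ i) (σ i)) (linesTo (n i)) := by
  have hEmax := M.Emax_pos
  have ht1 := M.t₁_pos
  have he₁' : (0 : ℝ) < e.1.1 := by exact_mod_cast he₁
  have hf₁' : (0 : ℝ) < f.1.1 := by exact_mod_cast hf₁
  have hdet' : (e.1.1 : ℝ) * f.1.2 = e.1.2 * f.1.1 + 1 := by exact_mod_cast hdet
  obtain ⟨a, ha⟩ : ∃ a : ℝ, a = (e.1.2 : ℝ) / e.1.1 := ⟨_, rfl⟩
  obtain ⟨b, hb⟩ : ∃ b : ℝ, b = (f.1.2 : ℝ) / f.1.1 := ⟨_, rfl⟩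
  rw [← ha, ← hb] at hδ hκ
  have hea : a * e.1.1 = e.1.2 := by rw [ha]; field_simp
  have hfb : b * f.1.1 = f.1.2 := by rw [hb]; field_simp
  have hab : a < b := by
    rw [ha, hb, div_lt_div_iff₀ he₁' hf₁']
    linarith
  have hta : M.t₀ < a := by rwa [ha, lt_div_iff₀ he₁']
  have hbt : b < M.t₁ := by rwa [hb, div_lt_iff₀ hf₁']
  have heb : (e.1.2 : ℝ) < b * e.1.1 := by rw [← hea]; gcongr
  have haf : a * f.1.1 < (f.1.2 : ℝ) := by rw [← hfb]; gcongr
  have heK : e ∈ sectorDirections a b := ⟨he₁', hea.le, heb.le⟩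
  have hfK : f ∈ sectorDirections a b := ⟨hf₁', haf.le, hfb.ge⟩
  obtain ⟨hw_lo, hw_hi, hw_le, hw_pos⟩ := M.limitMean_sector hta.le hab hbt.le
  have hadd1 := M.limitMean_indicator_add (ψ := 1) measurable_const (B := 1)
    (fun t _ => by simp) (measurableSet_Icc (a := a) (b := b))
  have hadd2 := M.limitMean_indicator_add (ψ := fun t => |t|) (by fun_prop) (B := M.t₁)
    (fun t ht => by rw [abs_abs, abs_of_nonneg (M.t₀_nonneg.trans ht.1)]; exact ht.2)
    (measurableSet_Icc (a := a) (b := b))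
  -- The full means match the target, so the displacement missing after emptying is in the limit
  -- exactly the mean displacement `(w₁, w₂)` of the sector.
  rw [H1] at hadd1
  rw [H2] at hadd2
  have hnear := fun η (hη : 0 < η) => h.eventually_endpoint_near a b (η := η) hη
  generalize M.limitMean ((Icc a b).indicator 1) = w₁ at *
  generalize M.limitMean ((Icc a b).indicator fun t => |t|) = w₂ at *
  generalize M.limitMean ((Icc a b)ᶜ.indicator 1) = m₁ at *
  generalize M.limitMean ((Icc a b)ᶜ.indicator fun t => |t|) = m₂ at *
  have hw₂pos : 0 < w₂ := by
    have : 0 ≤ a * w₁ := mul_nonneg (M.t₀_nonneg.trans hta.le) hw_pos.le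
    linarith
  have hw₂le : w₂ ≤ M.t₁ * w₁ := hw_hi.le.trans (by gcongr)
  -- Both determinants are positive because the slope of `(w₁, w₂)` is strictly between those of `e`
  -- and `f`.
  have hD1 : 0 < w₁ * f.1.2 - w₂ * f.1.1 := by rw [← hfb]; nlinarith
  have hD2 : 0 < e.1.1 * w₂ - e.1.2 * w₁ := by rw [← hea]; nlinarith
  -- The error is `2η`: one `η` from the random end point and one from `n`. The last condition
  -- bounds the gap by twice `w₁ + w₂`.
  obtain ⟨η, hη0, hη1, hη2, hη3⟩ : ∃ η > 0, 2 * η * (f.1.1 + f.1.2) < w₁ * f.1.2 - w₂ * f.1.1 ∧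
      2 * η * (e.1.1 + e.1.2) < e.1.1 * w₂ - e.1.2 * w₁ ∧ 4 * η ≤ w₁ + w₂ := by
    have q1 : ∀ᶠ η : ℝ in 𝓝[>] 0, 2 * η * (f.1.1 + f.1.2) < w₁ * f.1.2 - w₂ * f.1.1 :=
      ((by fun_prop : Continuous fun η : ℝ => 2 * η * (f.1.1 + f.1.2)).tendsto' 0 0
        (by simp)).eventually (gt_mem_nhds hD1) |>.filter_mono nhdsWithin_le_nhds
    have q2 : ∀ᶠ η : ℝ in 𝓝[>] 0, 2 * η * (e.1.1 + e.1.2) < e.1.1 * w₂ - e.1.2 * w₁ :=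
      ((by fun_prop : Continuous fun η : ℝ => 2 * η * (e.1.1 + e.1.2)).tendsto' 0 0
        (by simp)).eventually (gt_mem_nhds hD2) |>.filter_mono nhdsWithin_le_nhds
    have q3 : ∀ᶠ η : ℝ in 𝓝[>] 0, 4 * η < w₁ + w₂ :=
      ((by fun_prop : Continuous fun η : ℝ => 4 * η).tendsto' 0 0
        (by simp)).eventually (gt_mem_nhds (by linarith)) |>.filter_mono nhdsWithin_le_nhds
    have q0 : ∀ᶠ η : ℝ in 𝓝[>] 0, 0 < η := self_mem_nhdsWithin
    obtain ⟨η, hη, a1, a2, a3⟩ := (q0.and (q1.and (q2.and q3))).exists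
    exact ⟨η, hη, a1, a2, a3.le⟩
  have hfill : 4 * M.Emax * (2 * (w₁ + w₂)) ≤ κ := by
    refine le_trans ?_ hκ
    have h4 : w₁ + w₂ ≤ (1 + M.t₁) * w₁ := by linarith
    have h5 := h4.trans (mul_le_mul_of_nonneg_left hw_le (by linarith))
    have h6 := mul_le_mul_of_nonneg_left h5 (by positivity : 0 ≤ 8 * M.Emax)
    linarith
  have hlog := h.eventually_logPart_lt hta.le hab.le hbt.le hδ
  have hn1 : ∀ᶠ i in atTop, |α i ^ 3 * (n i).1 - 1| < η := by
    have := (tendsto_iff_norm_sub_tendsto_zero.1 h.fst_lim).eventually (gt_mem_nhds hη0)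
    simpa using this
  have hn2 : ∀ᶠ i in atTop, |α i ^ 3 * (n i).2 - M.c| < η := by
    have := (tendsto_iff_norm_sub_tendsto_zero.1 h.snd_lim).eventually (gt_mem_nhds hη0)
    simpa using this
  have hce := h.eventually_mem_cone he₁ het (heb.trans (by gcongr))
  have hcf := h.eventually_mem_cone hf₁ (lt_trans (by gcongr) haf) hft
  filter_upwards [hnear η hη0, hlog, hn1, hn2, hce, hcf] with i en el en1 en2 ece ecf
  have hα := h.pos i
  have hα3 : 0 < α i ^ 3 := pow_pos hα 3
  have hq0 := fun x => M.param_nonneg (α i) (ρ i) (σ i) x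
  have hqs := summable_of_le_exp (mul_pos hα M.rate_pos) hq0
    (M.param_le hα.le (h.ρ_mem i) (h.σ_mem i))
  have hge := geomMeasure_linesTo_ge (n := n i) (p := Real.exp (-(κ / α i ^ 2)))
    hq0 hqs heK hfK (Real.exp_pos _).le (A := {Γ | |α i ^ 3 * (endpoint Γ).1 - m₁| < η ∧
        |α i ^ 3 * (endpoint Γ).2 - m₂| < η}) (by
    rintro Γ ⟨hΓ1, hΓ2⟩
    have b1 : |α i ^ 3 * (n i).1 - α i ^ 3 * (endpoint Γ).1 - w₁| ≤ 2 * η := by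
      rw [abs_lt] at hΓ1 en1
      rw [abs_le]; constructor <;> linarith [hΓ1.1, hΓ1.2, en1.1, en1.2]
    have b2 : |α i ^ 3 * (n i).2 - α i ^ 3 * (endpoint Γ).2 - w₂| ≤ 2 * η := by
      rw [abs_lt] at hΓ2 en2
      rw [abs_le]; constructor <;> linarith [hΓ2.1, hΓ2.2, en2.1, en2.2]
    obtain ⟨k, l, hkl1, hkl2⟩ := exists_lattice_filling hdet hα3 b1 b2 hη1 hη2
    refine ⟨k, l, Prod.ext ?_ ?_, le_trans ?_ (le_param_pow_mul_pow hα (h.ρ_mem i) (h.σ_mem i) ece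
      ecf hkl1 hkl2 (w := 2 * (w₁ + w₂)) ?_)⟩
    · simpa using hkl1
    · simpa using hkl2
    · gcongr
    · linarith [(abs_le.1 b1).2, (abs_le.1 b2).2])
  refine le_trans ?_ hge
  gcongr

/-- The probability of the prescribed end point is subexponential in `α⁻²`. -/
theorem Regime.eventually_le_linesTo (h : M.Regime α ρ σ n) (H1 : M.limitMean 1 = 1)
    (H2 : M.limitMean (fun t => |t|) = M.c) {ε : ℝ} (hε : 0 < ε) :
    ∀ᶠ i in atTop, ENNReal.ofReal (Real.exp (-(ε / α i ^ 2))) ≤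
      geomMeasure (M.param (α i) (ρ i) (σ i)) (linesTo (n i)) := by
  have hEmin := M.Emin_pos
  have hEmax := M.Emax_pos
  have ht1 := M.t₁_pos
  have hz := zeta_ratio_pos
  set k₁ := (riemannZeta 3).re / (riemannZeta 2).re / M.Emin ^ 2 with hk₁
  set k₂ := 2 * (riemannZeta 3).re / (riemannZeta 2).re / M.Emin ^ 3 with hk₂
  have hk₂0 : 0 < k₂ := by rw [hk₂, mul_div_assoc]; positivity
  -- Both costs are linear in the sector width: emptying takes `ε/2`, filling `ε/4`, and the
  -- remaining `ε/4` absorbs the constant factor `1/2`.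
  obtain ⟨δ, hδ0, hδ1, hδ2⟩ : ∃ δ > 0, k₁ * δ < ε / 2 ∧
      8 * M.Emax * ((1 + M.t₁) * (k₂ * δ)) < ε / 4 := by
    have q1 : ∀ᶠ δ : ℝ in 𝓝[>] 0, k₁ * δ < ε / 2 :=
      ((by fun_prop : Continuous fun δ : ℝ => k₁ * δ).tendsto' 0 0
        (by simp)).eventually (gt_mem_nhds (half_pos hε)) |>.filter_mono nhdsWithin_le_nhds
    have q2 : ∀ᶠ δ : ℝ in 𝓝[>] 0, 8 * M.Emax * ((1 + M.t₁) * (k₂ * δ)) < ε / 4 :=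
      ((by fun_prop : Continuous fun δ : ℝ => 8 * M.Emax * ((1 + M.t₁) * (k₂ * δ))).tendsto' 0 0
        (by simp)).eventually (gt_mem_nhds (by positivity)) |>.filter_mono nhdsWithin_le_nhds
    have q0 : ∀ᶠ δ : ℝ in 𝓝[>] 0, 0 < δ := self_mem_nhdsWithin
    exact (q0.and (q1.and q2)).exists
  obtain ⟨e, f, he₁, hf₁, hdet, het, hft, hef⟩ := M.exists_basis_directions hδ0
  have hbase := h.eventually_le_linesTo_of_basis H1 H2 he₁ hf₁ hdet het hft (δ := ε / 2)
    (κ := ε / 4) (lt_of_le_of_lt (by gcongr) hδ1) (le_trans (by gcongr) hδ2.le)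
  have hhalf : (0 : ℝ≥0∞) < 1 / 2 := by simp
  have hsmall := (tendsto_exp_neg_div_sq h.pos h.lim (d := ε / 4) (by positivity)).eventually
    (gt_mem_nhds hhalf)
  filter_upwards [hbase, hsmall] with i e1 e2
  refine le_trans ?_ e1
  calc ENNReal.ofReal (Real.exp (-(ε / α i ^ 2)))
      = ENNReal.ofReal (Real.exp (-(ε / 2 / α i ^ 2)) * Real.exp (-(ε / 4 / α i ^ 2))) *
        ENNReal.ofReal (Real.exp (-(ε / 4 / α i ^ 2))) := by
        rw [← ENNReal.ofReal_mul (by positivity), ← Real.exp_add, ← Real.exp_add]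
        congr 2; ring
    _ ≤ _ := by gcongr

/-- Exponentially unlikely deviations remain unlikely given the end point. -/
theorem Regime.tendsto_cond_deviation (h : M.Regime α ρ σ n) (H1 : M.limitMean 1 = 1)
    (H2 : M.limitMean (fun t => |t|) = M.c) {W : Direction → ℝ} (hW : ∀ x, |W x| ≤ x.1.1 + x.1.2)
    {m : ℝ} (hm : Tendsto (fun i => α i ^ 3 * meanSum (M.param (α i) (ρ i) (σ i)) W) atTop (𝓝 m))
    {η : ℝ} (hη : 0 < η) :
    Tendsto (fun i => ProbabilityTheory.cond (geomMeasure (M.param (α i) (ρ i) (σ i)))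
      (linesTo (n i)) {Γ | η ≤ |α i ^ 3 * linSum W Γ - m|}) atTop (𝓝 0) := by
  obtain ⟨d, hd, ev⟩ := eventually_deviation_le h.pos M.rate_pos
    (fun i x => M.param_nonneg (α i) (ρ i) (σ i) x)
    (fun i x => M.param_le (h.pos i).le (h.ρ_mem i) (h.σ_mem i) x) hW hm hη
  -- Dividing by a probability of at least `exp (-(d/2)/α²)` costs only half of the exponent.
  have hlow := h.eventually_le_linesTo H1 H2 (half_pos hd)
  have hlim : Tendsto (fun i => 2 * ENNReal.ofReal (Real.exp (-(d / 2 / α i ^ 2)))) atTop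
      (𝓝 (2 * 0)) :=
    ENNReal.Tendsto.const_mul (tendsto_exp_neg_div_sq h.pos h.lim (half_pos hd)) (by simp)
  rw [mul_zero] at hlim
  refine tendsto_of_tendsto_of_tendsto_of_le_of_le' tendsto_const_nhds hlim
    (Eventually.of_forall fun _ => zero_le) ?_
  filter_upwards [ev, hlow] with i e1 e2
  rw [ProbabilityTheory.cond_apply MeasurableSpace.measurableSet_top]
  calc _ ≤ (ENNReal.ofReal (Real.exp (-(d / 2 / α i ^ 2))))⁻¹ *
        (2 * ENNReal.ofReal (Real.exp (-(d / α i ^ 2)))) :=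
        mul_le_mul' (ENNReal.inv_le_inv.2 e2) ((measure_mono inter_subset_right).trans e1)
    _ = 2 * ENNReal.ofReal (Real.exp (-(d / 2 / α i ^ 2))) := by
        rw [← ENNReal.ofReal_inv_of_pos (Real.exp_pos _), ← Real.exp_neg, mul_left_comm,
          ← ENNReal.ofReal_mul (Real.exp_pos _).le, ← Real.exp_add]
        congr 3; ring

end SlopeModel

/-! ### The curve -/

/-- The graph of a `C³` increasing strictly convex function with curvature bounded from below. -/
structure Admissible (g : ℝ → ℝ) : Prop where
  zero : g 0 = 0
  mono : StrictMonoOn g (Icc 0 1)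
  conv : StrictConvexOn ℝ (Icc 0 1) g
  smooth : ContDiffOn ℝ 3 g (Icc 0 1)
  curv : ∃ K₀ : ℝ, 0 < K₀ ∧ ∀ u ∈ Icc (0 : ℝ) 1, K₀ ≤ curvature g u

lemma kappa_pos : 0 < kappa := by
  have := zeta_three_re_pos
  have := zeta_two_re_pos
  unfold kappa; positivity

lemma kappa_pow_three : kappa ^ 3 = 2 * (riemannZeta 3).re / (riemannZeta 2).re := by
  have := zeta_three_re_pos
  have := zeta_two_re_pos
  unfold kappa
  rw [← Real.rpow_natCast, ← Real.rpow_mul (by positivity)]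
  norm_num

lemma rpow_third_pow_three {x : ℝ} (hx : 0 ≤ x) : (x ^ (1 / 3 : ℝ)) ^ 3 = x := by
  rw [← Real.rpow_natCast, ← Real.rpow_mul hx]
  norm_num

namespace Admissible

variable {g : ℝ → ℝ}

lemma one_pos (h : Admissible g) : 0 < g 1 := by
  have := h.mono (left_mem_Icc.2 zero_le_one) (right_mem_Icc.2 zero_le_one) zero_lt_one
  rwa [h.zero] at this

lemma differentiableOn (h : Admissible g) : DifferentiableOn ℝ g (Icc 0 1) := h.smooth.differentiableOn (by norm_num)

lemma contDiffOn_slopeFn (h : Admissible g) : ContDiffOn ℝ 2 (slopeFn g) (Icc 0 1) :=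
  h.smooth.derivWithin (uniqueDiffOn_Icc zero_lt_one) (by norm_num)

lemma continuousOn_slopeFn (h : Admissible g) : ContinuousOn (slopeFn g) (Icc 0 1) := h.contDiffOn_slopeFn.continuousOn

lemma hasDerivWithinAt_slopeFn (h : Admissible g) {u : ℝ} (hu : u ∈ Icc (0 : ℝ) 1) :
    HasDerivWithinAt (slopeFn g) (slopeFn' g u) (Icc 0 1) u :=
  (h.contDiffOn_slopeFn.differentiableOn (by norm_num) u hu).hasDerivWithinAt

lemma continuousOn_slopeFn' (h : Admissible g) : ContinuousOn (slopeFn' g) (Icc 0 1) :=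
  h.contDiffOn_slopeFn.continuousOn_derivWithin (uniqueDiffOn_Icc zero_lt_one) (by norm_num)

lemma strictMonoOn_slopeFn (h : Admissible g) : StrictMonoOn (slopeFn g) (Icc 0 1) :=
  h.conv.strictMonoOn_derivWithin h.differentiableOn

lemma slopeFn_nonneg (h : Admissible g) (u : ℝ) : 0 ≤ slopeFn g u := h.mono.monotoneOn.derivWithin_nonneg

lemma exists_le_slopeFn' (h : Admissible g) : ∃ K > 0, ∀ u ∈ Icc (0 : ℝ) 1, K ≤ slopeFn' g u := by
  obtain ⟨K, hK, hle⟩ := h.curv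
  refine ⟨K, hK, fun u hu => ?_⟩
  have h1 := hle u hu
  have h2 : (1 : ℝ) ≤ (1 + slopeFn g u ^ 2) ^ (3 / 2 : ℝ) :=
    Real.one_le_rpow (by nlinarith [sq_nonneg (slopeFn g u)]) (by norm_num)
  unfold curvature at h1
  rw [le_div_iff₀ (by linarith)] at h1
  nlinarith

lemma slopeFn'_pos (h : Admissible g) {u : ℝ} (hu : u ∈ Icc (0 : ℝ) 1) : 0 < slopeFn' g u := by
  obtain ⟨K, hK, hle⟩ := h.exists_le_slopeFn'
  exact hK.trans_le (hle u hu)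

lemma image_slopeFn (h : Admissible g) : slopeFn g '' Icc 0 1 = Icc (slopeFn g 0) (slopeFn g 1) := by
  apply Subset.antisymm
  · rintro _ ⟨u, hu, rfl⟩
    exact ⟨h.strictMonoOn_slopeFn.monotoneOn (left_mem_Icc.2 zero_le_one) hu hu.1,
      h.strictMonoOn_slopeFn.monotoneOn hu (right_mem_Icc.2 zero_le_one) hu.2⟩
  · exact intermediate_value_Icc zero_le_one h.continuousOn_slopeFn

lemma slopeFn_zero_lt_one (h : Admissible g) : slopeFn g 0 < slopeFn g 1 :=
  h.strictMonoOn_slopeFn (left_mem_Icc.2 zero_le_one) (right_mem_Icc.2 zero_le_one) zero_lt_one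

lemma minSlope_eq (h : Admissible g) : minSlope g = slopeFn g 0 := by
  unfold minSlope; rw [h.image_slopeFn, csInf_Icc h.slopeFn_zero_lt_one.le]

lemma maxSlope_eq (h : Admissible g) : maxSlope g = slopeFn g 1 := by
  unfold maxSlope; rw [h.image_slopeFn, csSup_Icc h.slopeFn_zero_lt_one.le]

lemma uParam_slopeFn (h : Admissible g) {v : ℝ} (hv : v ∈ Icc (0 : ℝ) 1) :
    uParam g (ENNReal.ofReal (slopeFn g v)) = v := by
  have hset : {u : ℝ | u ∈ Icc (0 : ℝ) 1 ∧
      ENNReal.ofReal (slopeFn g u) ≤ ENNReal.ofReal (slopeFn g v)} = Icc 0 v := by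
    ext u
    simp only [mem_ofPred_eq]
    constructor
    · rintro ⟨hu, hle⟩
      rw [ENNReal.ofReal_le_ofReal_iff (h.slopeFn_nonneg v)] at hle
      exact ⟨hu.1, (h.strictMonoOn_slopeFn.le_iff_le hu hv).1 hle⟩
    · rintro ⟨h0, hle⟩
      have hu : u ∈ Icc (0 : ℝ) 1 := ⟨h0, hle.trans hv.2⟩
      exact ⟨hu, ENNReal.ofReal_le_ofReal (h.strictMonoOn_slopeFn.monotoneOn hu hv hle)⟩
  unfold uParam
  rw [hset, csSup_Icc hv.1]

lemma uParam_top : uParam g ⊤ = 1 := by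
  unfold uParam
  simp only [le_top, and_true]
  exact csSup_Icc zero_le_one

lemma uParam_mem (t : ℝ≥0∞) : uParam g t ∈ Icc (0 : ℝ) 1 :=
  ⟨Real.sSup_nonneg fun _ hu => hu.1.1, Real.sSup_le (fun _ hu => hu.1.2) zero_le_one⟩

lemma uParam_mono : Monotone (uParam g) := by
  intro s t hst
  refine Real.sSup_le (fun u hu => le_csSup ⟨1, fun v hv => hv.1.2⟩ ⟨hu.1, hu.2.trans hst⟩)
    (uParam_mem t).1

/-- The geometric model that belongs to the curve. -/
lemma exists_slopeModel (h : Admissible g) : ∃ M : SlopeModel, M.t₀ = slopeFn g 0 ∧ M.t₁ = slopeFn g 1 ∧ M.c = g 1 ∧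
    ∀ u ∈ Icc (0 : ℝ) 1, M.E (slopeFn g u) = kappa * slopeFn' g u ^ (1 / 3 : ℝ) := by
  obtain ⟨K, hK, hKle⟩ := h.exists_le_slopeFn'
  obtain ⟨B, hB⟩ := (isCompact_Icc.image_of_continuousOn h.continuousOn_slopeFn').bddAbove
  have hBle : ∀ u ∈ Icc (0 : ℝ) 1, slopeFn' g u ≤ B := fun u hu => hB (mem_image_of_mem _ hu)
  have hle := h.slopeFn_zero_lt_one.le
  let p : Icc (0 : ℝ) 1 → ℝ := fun u => slopeFn g u
  have hpc : Continuous p := h.continuousOn_slopeFn.domRestrict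
  have hpi : Function.Injective p := fun u v huv =>
    Subtype.ext (h.strictMonoOn_slopeFn.injOn u.2 v.2 huv)
  -- An injective continuous map on a compact space is an embedding, which gives the continuity of
  -- the inverse `w` of the slope.
  have hemb := hpc.isClosedEmbedding hpi
  let w : Icc (slopeFn g 0) (slopeFn g 1) → Icc (0 : ℝ) 1 := fun t =>
    ⟨uParam g (ENNReal.ofReal t), uParam_mem _⟩
  have hwp : ∀ u (hu : u ∈ Icc (0 : ℝ) 1) (t : Icc (slopeFn g 0) (slopeFn g 1)),
      (t : ℝ) = slopeFn g u → w t = ⟨u, hu⟩ := fun u hu t ht =>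
    Subtype.ext (by simp only [w]; rw [ht, h.uParam_slopeFn hu])
  have hpw : p ∘ w = Subtype.val := by
    ext t
    obtain ⟨u, hu, hut⟩ : (t : ℝ) ∈ slopeFn g '' Icc 0 1 := by rw [h.image_slopeFn]; exact t.2
    rw [Function.comp_apply, hwp u hu t hut.symm]
    exact hut
  have hwc : Continuous w := hemb.isInducing.continuous_iff.2 (by rw [hpw]; exact continuous_subtype_val)
  -- The rate is extended constantly beyond `[t₀, t₁]`; the cone cuts those slopes off, and global
  -- continuity and bounds become available.
  let E : ℝ → ℝ := fun t => kappa * slopeFn' g (w (projIcc _ _ hle t)) ^ (1 / 3 : ℝ)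
  have hEc : Continuous E := by
    have h1 : Continuous fun t => slopeFn' g (w (projIcc _ _ hle t)) :=
      h.continuousOn_slopeFn'.domRestrict.comp (hwc.comp continuous_projIcc)
    exact continuous_const.mul (h1.rpow_const fun _ => Or.inr (by norm_num))
  have hk := kappa_pos
  refine ⟨{ t₀ := slopeFn g 0, t₁ := slopeFn g 1, c := g 1, E := E, Emin := kappa * K ^ (1 / 3 : ℝ),
            Emax := kappa * B ^ (1 / 3 : ℝ), t₀_nonneg := h.slopeFn_nonneg 0,
            t₀_lt := h.slopeFn_zero_lt_one, c_pos := h.one_pos, continuous_E := hEc,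
            Emin_pos := by positivity, Emin_le := fun t => ?_, le_Emax := fun t => ?_ },
    rfl, rfl, rfl, fun u hu => ?_⟩
  · have := hKle _ (w (projIcc _ _ hle t)).2
    simp only [E]
    gcongr
  · have h1 := hBle _ (w (projIcc _ _ hle t)).2
    have h0 := h.slopeFn'_pos (w (projIcc _ _ hle t)).2
    simp only [E]
    gcongr
  · have hmem : slopeFn g u ∈ Icc (slopeFn g 0) (slopeFn g 1) := by
      rw [← h.image_slopeFn]; exact mem_image_of_mem _ hu
    simp only [E]
    rw [projIcc_of_mem hle hmem, hwp u hu _ rfl]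

variable {M : SlopeModel}

/-- In the model of the curve, limits of means are integrals along the curve. -/
lemma limitMean_eq (h : Admissible g) (h0 : M.t₀ = slopeFn g 0) (h1 : M.t₁ = slopeFn g 1)
    (hE : ∀ u ∈ Icc (0 : ℝ) 1, M.E (slopeFn g u) = kappa * slopeFn' g u ^ (1 / 3 : ℝ))
    (ψ : ℝ → ℝ) : M.limitMean ψ = ∫ u in Icc (0 : ℝ) 1, ψ (slopeFn g u) := by
  have hk := kappa_pos
  unfold SlopeModel.limitMean
  -- Under `t = g'(u)` one has `dt = g'' du` and `E³ = κ³ g''`: the second derivative and the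
  -- constant `2ζ(3)/ζ(2) = κ³` both cancel.
  rw [← kappa_pow_three, h0, h1, ← h.image_slopeFn, integral_image_eq_integral_abs_deriv_smul
    measurableSet_Icc (fun u hu => h.hasDerivWithinAt_slopeFn hu) h.strictMonoOn_slopeFn.injOn,
    ← integral_const_mul]
  refine setIntegral_congr_fun measurableSet_Icc fun u hu => ?_
  have hp := h.slopeFn'_pos hu
  simp only [hE u hu, abs_of_pos hp, smul_eq_mul, mul_pow, rpow_third_pow_three hp.le]
  field_simp

lemma integral_slopeFn (h : Admissible g) : ∫ u in Icc (0 : ℝ) 1, slopeFn g u = g 1 := by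
  rw [integral_Icc_eq_integral_Ioc, ← intervalIntegral.integral_of_le zero_le_one,
    intervalIntegral.integral_eq_sub_of_hasDerivAt_of_le zero_le_one h.differentiableOn.continuousOn,
    h.zero, sub_zero]
  · intro u hu
    have hu' : u ∈ Icc (0 : ℝ) 1 := Ioo_subset_Icc_self hu
    exact (h.differentiableOn u hu').hasDerivWithinAt.hasDerivAt (Icc_mem_nhds hu.1 hu.2)
  · rw [intervalIntegrable_iff_integrableOn_Icc_of_le zero_le_one]
    exact h.continuousOn_slopeFn.integrableOn_Icc

lemma limitMean_one (h : Admissible g) (h0 : M.t₀ = slopeFn g 0) (h1 : M.t₁ = slopeFn g 1)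
    (hE : ∀ u ∈ Icc (0 : ℝ) 1, M.E (slopeFn g u) = kappa * slopeFn' g u ^ (1 / 3 : ℝ)) :
    M.limitMean 1 = 1 := by
  rw [h.limitMean_eq h0 h1 hE]
  simp

lemma limitMean_abs (h : Admissible g) (h0 : M.t₀ = slopeFn g 0) (h1 : M.t₁ = slopeFn g 1)
    (hE : ∀ u ∈ Icc (0 : ℝ) 1, M.E (slopeFn g u) = kappa * slopeFn' g u ^ (1 / 3 : ℝ)) :
    M.limitMean (fun t => |t|) = g 1 := by
  rw [h.limitMean_eq h0 h1 hE, ← h.integral_slopeFn]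
  simp_rw [abs_of_nonneg (h.slopeFn_nonneg _)]

lemma continuousOn_speed (h : Admissible g) : ContinuousOn (fun u => √(1 + slopeFn g u ^ 2)) (Icc 0 1) :=
  (continuousOn_const.add (h.continuousOn_slopeFn.pow 2)).sqrt

lemma limitMean_length_top (h : Admissible g) (h0 : M.t₀ = slopeFn g 0) (h1 : M.t₁ = slopeFn g 1)
    (hE : ∀ u ∈ Icc (0 : ℝ) 1, M.E (slopeFn g u) = kappa * slopeFn' g u ^ (1 / 3 : ℝ)) :
    M.limitMean (fun t => √(1 + t ^ 2)) = curveLength g ⊤ := by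
  rw [h.limitMean_eq h0 h1 hE, curveLength, uParam_top, intervalIntegral.integral_of_le zero_le_one,
    integral_Icc_eq_integral_Ioc]

lemma limitMean_length (h : Admissible g) (h0 : M.t₀ = slopeFn g 0) (h1 : M.t₁ = slopeFn g 1)
    (hE : ∀ u ∈ Icc (0 : ℝ) 1, M.E (slopeFn g u) = kappa * slopeFn' g u ^ (1 / 3 : ℝ))
    {v : ℝ} (hv : v ∈ Icc (0 : ℝ) 1) :
    M.limitMean ((Icc 0 (slopeFn g v)).indicator fun t => √(1 + t ^ 2)) =
      curveLength g (ENNReal.ofReal (slopeFn g v)) := by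
  rw [h.limitMean_eq h0 h1 hE, curveLength, h.uParam_slopeFn hv,
    intervalIntegral.integral_of_le hv.1, ← integral_Icc_eq_integral_Ioc,
    ← inter_eq_self_of_subset_right (Icc_subset_Icc_right hv.2 : Icc 0 v ⊆ Icc 0 1),
    ← setIntegral_indicator measurableSet_Icc]
  refine setIntegral_congr_fun measurableSet_Icc fun u hu => ?_
  by_cases huv : u ≤ v
  · have h2 : slopeFn g u ∈ Icc 0 (slopeFn g v) :=
      ⟨h.slopeFn_nonneg u, h.strictMonoOn_slopeFn.monotoneOn hu hv huv⟩
    rw [indicator_of_mem h2, indicator_of_mem (show u ∈ Icc 0 v from ⟨hu.1, huv⟩)]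
  · have h2 : slopeFn g u ∉ Icc 0 (slopeFn g v) := fun hm =>
      huv ((h.strictMonoOn_slopeFn.le_iff_le hu hv).1 hm.2)
    rw [indicator_of_notMem h2, indicator_of_notMem (fun hm => huv hm.2)]

/-- A finite set of slopes that controls the distance of the length functions. -/
lemma exists_slope_grid (h : Admissible g) {ε : ℝ} (hε : 0 < ε) :
    ∃ S : Finset ℝ≥0∞, (∀ t ∈ S, t = ⊤ ∨ ∃ v ∈ Icc (0 : ℝ) 1, t = ENNReal.ofReal (slopeFn g v)) ∧
      ∀ F : ℝ≥0∞ → ℝ, Monotone F → (∀ t, 0 ≤ F t) →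
        (∀ t ∈ S, |F t - curveLength g t| ≤ ε / 2) → ∀ t, |F t - curveLength g t| ≤ ε := by
  classical
  obtain ⟨L, hL⟩ := (isCompact_Icc.image_of_continuousOn h.continuousOn_speed).bddAbove
  have hLle : ∀ u ∈ Icc (0 : ℝ) 1, √(1 + slopeFn g u ^ 2) ≤ L := fun u hu =>
    hL (mem_image_of_mem _ hu)
  obtain ⟨N, hN⟩ := exists_nat_gt (L / (ε / 2))
  have hL0 : 0 ≤ L := (Real.sqrt_nonneg _).trans (hLle 0 (left_mem_Icc.2 zero_le_one))
  have hN0 : (0 : ℝ) < N := lt_of_le_of_lt (by positivity) hN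
  have hint : ∀ a ∈ Icc (0 : ℝ) 1, ∀ b ∈ Icc (0 : ℝ) 1,
      IntervalIntegrable (fun u => √(1 + slopeFn g u ^ 2)) volume a b := fun a ha b hb =>
    (h.continuousOn_speed.mono (uIcc_subset_Icc ha hb)).intervalIntegrable
  have hzero : (0 : ℝ) ∈ Icc (0 : ℝ) 1 := left_mem_Icc.2 zero_le_one
  have hdiff : ∀ a ∈ Icc (0 : ℝ) 1, ∀ b ∈ Icc (0 : ℝ) 1, a ≤ b →
      0 ≤ (∫ u in (0 : ℝ)..b, √(1 + slopeFn g u ^ 2)) - (∫ u in (0 : ℝ)..a, √(1 + slopeFn g u ^ 2)) ∧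
      (∫ u in (0 : ℝ)..b, √(1 + slopeFn g u ^ 2)) - (∫ u in (0 : ℝ)..a, √(1 + slopeFn g u ^ 2)) ≤
        L * (b - a) := by
    intro a ha b hb hab
    rw [intervalIntegral.integral_interval_sub_left (hint 0 hzero b hb) (hint 0 hzero a ha)]
    refine ⟨intervalIntegral.integral_nonneg hab fun _ _ => Real.sqrt_nonneg _, ?_⟩
    have := intervalIntegral.integral_mono_on hab (hint a ha b hb)
      (intervalIntegrable_const (c := L)) fun u hu => hLle u ⟨ha.1.trans hu.1, hu.2.trans hb.2⟩
    rw [intervalIntegral.integral_const, smul_eq_mul] at this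
    linarith
  have hCmono : Monotone (curveLength g) := fun s t hst => by
    have := (hdiff _ (uParam_mem (g := g) s) _ (uParam_mem (g := g) t) (uParam_mono hst)).1
    unfold curveLength
    linarith
  have hgrid : ∀ j : ℕ, j ≤ N → (j : ℝ) / N ∈ Icc (0 : ℝ) 1 := fun j hj =>
    ⟨by positivity, by rw [div_le_one hN0]; exact_mod_cast hj⟩
  let s : ℕ → ℝ≥0∞ := fun j => ENNReal.ofReal (slopeFn g (j / N))
  have hC : ∀ j ≤ N, curveLength g (s j) = ∫ u in (0 : ℝ)..(j / N), √(1 + slopeFn g u ^ 2) := by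
    intro j hj
    simp only [s, curveLength]
    rw [h.uParam_slopeFn (hgrid j hj)]
  -- Consecutive grid slopes enclose an arc of length at most `L/N < ε/2`. The slope `⊤` is needed
  -- because `F` may still grow beyond the largest tangent slope.
  refine ⟨insert ⊤ ((Finset.range (N + 1)).image s), ?_, ?_⟩
  · intro t ht
    rcases Finset.mem_insert.1 ht with rfl | ht
    · exact Or.inl rfl
    · obtain ⟨j, hj, rfl⟩ := Finset.mem_image.1 ht
      exact Or.inr ⟨_, hgrid j (by simpa [Nat.lt_succ_iff] using hj), rfl⟩
  · intro F hF hF0 hS t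
    have hsj : ∀ j ≤ N, |F (s j) - curveLength g (s j)| ≤ ε / 2 := fun j hj =>
      hS _ (Finset.mem_insert_of_mem (Finset.mem_image_of_mem _ (Finset.mem_range.2 (by omega))))
    have htop : |F ⊤ - curveLength g ⊤| ≤ ε / 2 := hS _ (Finset.mem_insert_self _ _)
    have hbetween : ∀ a b : ℝ≥0∞, a ≤ t → t ≤ b → |F a - curveLength g a| ≤ ε / 2 →
        |F b - curveLength g b| ≤ ε / 2 → curveLength g b - curveLength g a ≤ ε / 2 →
        |F t - curveLength g t| ≤ ε := by
      intro a b hat htb ha hb hab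
      have := hF hat
      have := hF htb
      have := hCmono hat
      have := hCmono htb
      rw [abs_le] at ha hb ⊢
      constructor <;> linarith [ha.1, ha.2, hb.1, hb.2]
    -- Below the smallest tangent slope the curve has no length, and `F` is squeezed between `0` and
    -- its value at `s 0`; no grid point further left is needed.
    rcases lt_or_ge t (s 0) with hlt | hge
    · have h1 : curveLength g (s 0) = 0 := by rw [hC 0 (Nat.zero_le _)]; simp
      have h2 : 0 ≤ curveLength g t := by
        have := (hdiff 0 hzero _ (uParam_mem (g := g) t) (uParam_mem (g := g) t).1).1
        simpa [curveLength] using this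
      have h3 := hCmono hlt.le
      have h4 := hF hlt.le
      have h5 := hF0 t
      have h6 := abs_le.1 (hsj 0 (Nat.zero_le _))
      rw [abs_le]
      constructor <;> linarith [h6.1, h6.2]
    · rcases le_or_gt (s N) t with hNt | htN
      · refine hbetween (s N) ⊤ hNt le_top (hsj N le_rfl) htop ?_
        have : curveLength g ⊤ = curveLength g (s N) := by
          rw [hC N le_rfl, curveLength, uParam_top, div_self hN0.ne']
        rw [this]; simp; positivity
      · have hex : ∃ j, j < N ∧ s j ≤ t ∧ t < s (j + 1) := by
          by_contra hcon
          push Not at hcon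
          have : ∀ j ≤ N, s j ≤ t := by
            intro j
            induction j with
            | zero => intro _; exact hge
            | succ j ih => intro hj; exact hcon j (by omega) (ih (by omega))
          exact absurd htN (not_lt.2 (this N le_rfl))
        obtain ⟨j, hjN, hj1, hj2⟩ := hex
        refine hbetween (s j) (s (j + 1)) hj1 hj2.le (hsj j hjN.le) (hsj (j + 1) hjN) ?_
        rw [hC j hjN.le, hC (j + 1) hjN]
        have hjj : (j : ℝ) / N ≤ ((j + 1 : ℕ) : ℝ) / N := by gcongr; simp
        refine (hdiff _ (hgrid j hjN.le) _ (hgrid (j + 1) hjN) hjj).2.trans ?_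
        rw [div_lt_iff₀ (half_pos hε)] at hN
        have : L * (((j + 1 : ℕ) : ℝ) / N - (j : ℝ) / N) = L / N := by push_cast; ring
        rw [this, div_le_iff₀ hN0]
        linarith

end Admissible

/-! ### The parameters of the paths in terms of the geometric model -/

lemma expNeg_ofReal_mul {a d : ℝ} (ha : 0 ≤ a) (hd : 0 ≤ d) :
    expNeg (ENNReal.ofReal a * ENNReal.ofReal d) = Real.exp (-(a * d)) := by
  rw [← ENNReal.ofReal_mul ha, expNeg, if_neg ENNReal.ofReal_ne_top,
    ENNReal.toReal_ofReal (mul_nonneg ha hd)]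

lemma expNeg_ofReal_mul_top {a : ℝ} (ha : 0 < a) : expNeg (ENNReal.ofReal a * ⊤) = 0 := by
  rw [ENNReal.mul_top (by simpa using ha), expNeg, if_pos rfl]

lemma rho_pos {g : ℝ → ℝ} {n : ℕ × ℕ} (hg : 0 < g 1) (h1 : 0 < n.1) (h2 : 0 < n.2) :
    0 < rho g n := by
  have : (0 : ℝ) < n.1 := by exact_mod_cast h1
  have : (0 : ℝ) < n.2 := by exact_mod_cast h2
  unfold rho; positivity

lemma alpha_pos {g : ℝ → ℝ} {n : ℕ × ℕ} (hg : 0 < g 1) (h1 : 0 < n.1) (h2 : 0 < n.2) :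
    0 < alpha g n :=
  Real.rpow_pos_of_pos (mul_pos (rho_pos hg h1 h2) (by exact_mod_cast h1)) _

lemma alpha_pow_three {g : ℝ → ℝ} {n : ℕ × ℕ} (hg : 0 < g 1) (h1 : 0 < n.1) (h2 : 0 < n.2) :
    alpha g n ^ 3 = (rho g n * n.1)⁻¹ := by
  have h : 0 ≤ rho g n * n.1 := mul_nonneg (rho_pos hg h1 h2).le (Nat.cast_nonneg _)
  rw [alpha, Real.rpow_neg h, inv_pow, rpow_third_pow_three h]

/-- The parameters with an additional factor `σ` in the second exponent. -/
def tiltedParam (g : ℝ → ℝ) (n : ℕ × ℕ) (σ : ℝ) (x : Direction) : ℝ × ℝ :=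
  (expNeg (ENNReal.ofReal (alpha g n) * delta₁ g (tiltedSlope g n x)),
   expNeg (ENNReal.ofReal (alpha g n * σ) * delta₂ g (tiltedSlope g n x)))

lemma tiltedParam_one (g : ℝ → ℝ) (n : ℕ × ℕ) : tiltedParam g n 1 = zParam g n := by
  ext x <;> simp [tiltedParam, zParam]

lemma tiltedParam_rho (g : ℝ → ℝ) (n : ℕ × ℕ) : tiltedParam g n (rho g n) = zParam' g n := rfl

lemma zPow_tiltedParam_of_top {g : ℝ → ℝ} {n : ℕ × ℕ} {σ : ℝ} {x : Direction} (hα : 0 < alpha g n)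
    (hσ : 0 < σ) (h : delta₁ g (tiltedSlope g n x) = ⊤) : zPow (tiltedParam g n σ) x = 0 := by
  have h2 : delta₂ g (tiltedSlope g n x) = ⊤ := by
    rw [delta₂, h, ENNReal.top_div_of_ne_top ENNReal.ofReal_ne_top]
  rw [zPow, tiltedParam, h, h2, expNeg_ofReal_mul_top hα, expNeg_ofReal_mul_top (mul_pos hα hσ)]
  rcases Nat.eq_zero_or_pos x.1.1 with h1 | h1
  · have : x.1.2 ≠ 0 := fun h2 => by have := size_pos x; simp [h1, h2] at this
    simp [this]
  · simp [h1.ne']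

namespace Admissible

variable {g : ℝ → ℝ} {M : SlopeModel}

/-- The cube root of the curvature denominator is `√(1+t²)`, which cancels against the numerator of
`δ₁`. -/
lemma delta₁_slopeFn (h : Admissible g)
    (hE : ∀ u ∈ Icc (0 : ℝ) 1, M.E (slopeFn g u) = kappa * slopeFn' g u ^ (1 / 3 : ℝ))
    {u : ℝ} (hu : u ∈ Icc (0 : ℝ) 1) :
    delta₁ g (ENNReal.ofReal (slopeFn g u)) =
      ENNReal.ofReal (M.E (slopeFn g u) * (g 1 / (g 1 + slopeFn g u))) := by
  have hmem : slopeFn g u ∈ Icc (slopeFn g 0) (slopeFn g 1) := by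
    rw [← h.image_slopeFn]; exact mem_image_of_mem _ hu
  have hs := h.slopeFn_nonneg u
  have hp := h.slopeFn'_pos hu
  have hq : 0 < 1 + slopeFn g u ^ 2 := by positivity
  rw [delta₁, if_pos ⟨by rw [h.minSlope_eq]; exact ENNReal.ofReal_le_ofReal hmem.1,
    by rw [h.maxSlope_eq]; exact ENNReal.ofReal_le_ofReal hmem.2⟩, curvatureAtSlope,
    h.uParam_slopeFn hu, ENNReal.toReal_ofReal hs, hE u hu,
    Real.div_rpow hp.le (by positivity), ← Real.rpow_mul hq.le, Real.sqrt_eq_rpow]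
  congr 1
  rw [show (3 / 2 * (1 / 3) : ℝ) = 1 / 2 by norm_num]
  have : 0 < (1 + slopeFn g u ^ 2) ^ (1 / 2 : ℝ) := by positivity
  field_simp

/-- With `τ = ρ x₂/x₁` and `δ₂ = δ₁/c` the exponent is `α E(τ) (c x₁ + σ x₂)/(c + τ)`, which is the
height at `α x`. Slopes outside `[t₀, t₁]`, vertical edges included, have infinite `δ` and parameter
`0`. -/
lemma zPow_tiltedParam (h : Admissible g) (h0 : M.t₀ = slopeFn g 0) (h1 : M.t₁ = slopeFn g 1)
    (hc : M.c = g 1)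
    (hE : ∀ u ∈ Icc (0 : ℝ) 1, M.E (slopeFn g u) = kappa * slopeFn' g u ^ (1 / 3 : ℝ))
    {n : ℕ × ℕ} (hn1 : 0 < n.1) (hn2 : 0 < n.2) {σ : ℝ} (hσ : 0 < σ) (x : Direction) :
    zPow (tiltedParam g n σ) x = M.param (alpha g n) (rho g n) σ x := by
  have hα := alpha_pos h.one_pos hn1 hn2
  have hρ := rho_pos h.one_pos hn1 hn2
  have hg := h.one_pos
  have hcone : ((alpha g n * x.1.1, alpha g n * x.1.2) : ℝ × ℝ) ∈ M.cone (rho g n) ↔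
      ((x.1.1, x.1.2) : ℝ × ℝ) ∈ M.cone (rho g n) := 
    M.mem_cone_smul hα (x.1.1, x.1.2)
  rcases Nat.eq_zero_or_pos x.1.1 with hx | hx
  · have hx2 : 0 < x.1.2 := Nat.pos_of_ne_zero fun h2 => by
      have := size_pos x; simp [hx, h2] at this
    have hx2' : (0 : ℝ) < x.1.2 := by exact_mod_cast hx2
    rw [zPow_tiltedParam_of_top hα hσ, SlopeModel.param, SlopeModel.density, if_neg]
    · rw [hcone]; exact fun hm => by simpa [hx] using hm.1
    · have : tiltedSlope g n x = ⊤ := by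
        rw [tiltedSlope, hx, Nat.cast_zero, ENNReal.div_zero]
        simpa using mul_pos hρ hx2'
      rw [delta₁, if_neg]
      rw [this]; simp
  have hx' : (0 : ℝ) < x.1.1 := by exact_mod_cast hx
  have hy' : (0 : ℝ) ≤ x.1.2 := Nat.cast_nonneg _
  have hts : tiltedSlope g n x = ENNReal.ofReal (rho g n * x.1.2 / x.1.1) := by
    rw [tiltedSlope, ENNReal.ofReal_div_of_pos hx', ENNReal.ofReal_natCast]
  have hmem : ((x.1.1, x.1.2) : ℝ × ℝ) ∈ M.cone (rho g n) ↔
      rho g n * x.1.2 / x.1.1 ∈ Icc (slopeFn g 0) (slopeFn g 1) := by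
    rw [mem_Icc, le_div_iff₀ hx', div_le_iff₀ hx', ← h0, ← h1]
    exact ⟨fun hm => ⟨hm.2.1, hm.2.2⟩, fun hm => ⟨hx', hm.1, hm.2⟩⟩
  by_cases hin : rho g n * x.1.2 / x.1.1 ∈ Icc (slopeFn g 0) (slopeFn g 1)
  · obtain ⟨u, hu, hut⟩ : rho g n * x.1.2 / x.1.1 ∈ slopeFn g '' Icc 0 1 := by
      rw [h.image_slopeFn]; exact hin
    have hs := h.slopeFn_nonneg u
    have hE0 := M.E_pos (slopeFn g u)
    have hd : 0 ≤ M.E (slopeFn g u) * (g 1 / (g 1 + slopeFn g u)) := by positivity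
    rw [SlopeModel.param, SlopeModel.density, if_pos (hcone.2 (hmem.2 hin)), zPow, tiltedParam,
      delta₂, hts, ← hut, h.delta₁_slopeFn hE hu, ← ENNReal.ofReal_div_of_pos hg,
      expNeg_ofReal_mul hα.le hd, expNeg_ofReal_mul (by positivity) (by positivity),
      ← Real.exp_nat_mul, ← Real.exp_nat_mul, ← Real.exp_add, SlopeModel.height, hc,
      show rho g n * (alpha g n * x.1.2) / (alpha g n * x.1.1) = slopeFn g u by
        rw [hut]; field_simp, hut]
    congr 1
    field_simp
    ring
  · rw [zPow_tiltedParam_of_top hα hσ, SlopeModel.param, SlopeModel.density,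
      if_neg fun hm => hin (hmem.1 (hcone.1 hm))]
    rw [delta₁, if_neg]
    rw [h.minSlope_eq, h.maxSlope_eq, hts, ENNReal.ofReal_le_ofReal_iff (by positivity),
      ENNReal.ofReal_le_ofReal_iff (h.slopeFn_nonneg 1)]
    exact hin

lemma Q_tiltedParam (h : Admissible g) (h0 : M.t₀ = slopeFn g 0) (h1 : M.t₁ = slopeFn g 1)
    (hc : M.c = g 1)
    (hE : ∀ u ∈ Icc (0 : ℝ) 1, M.E (slopeFn g u) = kappa * slopeFn' g u ^ (1 / 3 : ℝ))
    {n : ℕ × ℕ} (hn1 : 0 < n.1) (hn2 : 0 < n.2) {σ : ℝ} (hσ : σ ∈ Icc (1 / 2 : ℝ) 2)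
    (hρ : rho g n ∈ Icc (1 / 2 : ℝ) 2) :
    Q (tiltedParam g n σ) = geomMeasure (M.param (alpha g n) (rho g n) σ) := by
  have hα := alpha_pos h.one_pos hn1 hn2
  exact Q_eq_geomMeasure
    (h.zPow_tiltedParam h0 h1 hc hE hn1 hn2 (lt_of_lt_of_le (by norm_num) hσ.1))
    (M.param_lt_one hα hρ hσ)
    (summable_of_le_exp (mul_pos hα M.rate_pos) (M.param_nonneg _ _ _)
      fun x => M.param_le hα.le hρ hσ x)

end Admissible

/-! ### Lengths of polygonal lines -/

open Classical in
/-- The contribution of a direction to the length of the part with slopes at most `t`. -/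
def lengthWeight (t : ℝ≥0∞) (x : Direction) : ℝ :=
  if edgeSlope x ≤ t then √((x.1.1 : ℝ) ^ 2 + (x.1.2 : ℝ) ^ 2) else 0

lemma polyLength_eq {s : ℝ} (hs : 0 ≤ s) (Γ : PolyLine) (t : ℝ≥0∞) :
    polyLength s Γ t = s * linSum (lengthWeight t) Γ := by
  unfold polyLength linSum Finsupp.sum
  rw [Finset.mul_sum]
  refine Finset.sum_congr rfl fun x _ => ?_
  simp only [lengthWeight]
  split_ifs
  · rw [show (s * Γ x * x.1.1) ^ 2 + (s * Γ x * x.1.2) ^ 2 =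
      (s * Γ x) ^ 2 * ((x.1.1 : ℝ) ^ 2 + (x.1.2 : ℝ) ^ 2) by ring,
      Real.sqrt_mul (by positivity), Real.sqrt_sq (by positivity), mul_assoc]
  · simp

lemma polyLength_nonneg (s : ℝ) (Γ : PolyLine) (t : ℝ≥0∞) : 0 ≤ polyLength s Γ t :=
  Finset.sum_nonneg fun x _ => by
    simp only
    split_ifs
    exacts [Real.sqrt_nonneg _, le_rfl]

lemma polyLength_mono (s : ℝ) (Γ : PolyLine) : Monotone (polyLength s Γ) := by
  intro t u htu
  refine Finset.sum_le_sum fun x _ => ?_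
  simp only
  split_ifs with h1 h2
  · exact le_rfl
  · exact absurd (h1.trans htu) h2
  · exact Real.sqrt_nonneg _
  · exact le_rfl

lemma sqrt_sq_add_sq_le {a b : ℝ} (ha : 0 ≤ a) (hb : 0 ≤ b) : √(a ^ 2 + b ^ 2) ≤ a + b :=
  Real.sqrt_le_iff.2 ⟨by positivity, by nlinarith [mul_nonneg ha hb]⟩

lemma sqrt_sq_add_sq_smul {k a b : ℝ} (hk : 0 < k) :
    √((k * a) ^ 2 + (k * b) ^ 2) = k * √(a ^ 2 + b ^ 2) := by
  rw [show (k * a) ^ 2 + (k * b) ^ 2 = k ^ 2 * (a ^ 2 + b ^ 2) by ring,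
    Real.sqrt_mul (by positivity), Real.sqrt_sq hk.le]

lemma sqrt_sq_add_sq_eq {a b : ℝ} (ha : 0 < a) : √(a ^ 2 + b ^ 2) = a * √(1 + (b / a) ^ 2) := by
  rw [← one_pow 2, ← sqrt_sq_add_sq_smul ha, mul_one, mul_div_cancel₀ _ ha.ne']

lemma abs_lengthWeight_le (t : ℝ≥0∞) (x : Direction) : |lengthWeight t x| ≤ x.1.1 + x.1.2 := by
  unfold lengthWeight
  split_ifs
  · rw [abs_of_nonneg (Real.sqrt_nonneg _)]
    exact sqrt_sq_add_sq_le (Nat.cast_nonneg _) (Nat.cast_nonneg _)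
  · rw [abs_zero]; positivity

lemma edgeSlope_le_ofReal_iff {s : ℝ} (hs : 0 ≤ s) (x : Direction) :
    edgeSlope x ≤ ENNReal.ofReal s ↔ ((x.1.1, x.1.2) : ℝ × ℝ) ∈ sector 0 s := by
  rcases Nat.eq_zero_or_pos x.1.1 with hx | hx
  · have hx2 : x.1.2 ≠ 0 := fun h2 => by have := size_pos x; simp [hx, h2] at this
    have : edgeSlope x = ⊤ := by
      rw [edgeSlope, hx, Nat.cast_zero, ENNReal.div_zero (by exact_mod_cast hx2)]
    rw [this]
    simp [sector, hx]
  · have hx' : (0 : ℝ) < x.1.1 := by exact_mod_cast hx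
    have : edgeSlope x = ENNReal.ofReal (x.1.2 / x.1.1) := by
      rw [ENNReal.ofReal_div_of_pos hx', ENNReal.ofReal_natCast, ENNReal.ofReal_natCast, edgeSlope]
    rw [this, ENNReal.ofReal_le_ofReal_iff hs, div_le_iff₀ hx']
    simp [sector, hx]

lemma lengthWeight_ofReal {s : ℝ} (hs : 0 ≤ s) (x : Direction) :
    lengthWeight (ENNReal.ofReal s) x =
      (sector 0 s).indicator (fun y => √(y.1 ^ 2 + y.2 ^ 2)) (x.1.1, x.1.2) := by
  classical
  simp only [lengthWeight, indicator_apply, edgeSlope_le_ofReal_iff hs]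

lemma lengthWeight_top (x : Direction) :
    lengthWeight ⊤ x = √((x.1.1 : ℝ) ^ 2 + (x.1.2 : ℝ) ^ 2) := if_pos le_top

namespace SlopeModel

variable {M : SlopeModel} {α ρ σ : ℕ → ℝ} {n : ℕ → ℕ × ℕ}

lemma Regime.tendsto_meanSum_length_top (h : M.Regime α ρ σ n) :
    Tendsto (fun i => α i ^ 3 * meanSum (M.param (α i) (ρ i) (σ i)) (lengthWeight ⊤)) atTop
      (𝓝 (M.limitMean fun t => √(1 + t ^ 2))) := by
  refine (M.tendsto_meanSum h.pos h.lim h.ρ_mem h.σ_mem h.ρ_lim h.σ_lim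
    (G := fun y => √(y.1 ^ 2 + y.2 ^ 2)) (ψ := fun t => √(1 + t ^ 2))
    (fun y h1 h2 => ?_) (fun k y hk => sqrt_sq_add_sq_smul hk)
    (Eventually.of_forall fun x => by fun_prop) (by fun_prop) (fun t => Real.sqrt_nonneg _)
    (fun y h1 _ => sqrt_sq_add_sq_eq h1)).congr fun i => ?_
  · rw [abs_of_nonneg (Real.sqrt_nonneg _)]
    exact sqrt_sq_add_sq_le h1 h2
  · rw [funext lengthWeight_top]

lemma Regime.tendsto_meanSum_length (h : M.Regime α ρ σ n) {s : ℝ} (hs : 0 ≤ s) :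
    Tendsto (fun i => α i ^ 3 *
        meanSum (M.param (α i) (ρ i) (σ i)) (lengthWeight (ENNReal.ofReal s))) atTop
      (𝓝 (M.limitMean ((Icc 0 s).indicator fun t => √(1 + t ^ 2)))) := by
  classical
  refine (M.tendsto_meanSum h.pos h.lim h.ρ_mem h.σ_mem h.ρ_lim h.σ_lim
    (G := (sector 0 s).indicator fun y => √(y.1 ^ 2 + y.2 ^ 2))
    (ψ := (Icc 0 s).indicator fun t => √(1 + t ^ 2))
    (fun y h1 h2 => ?_) (fun k y hk => ?_)
    (ae_continuousAt_indicator_sector 0 s (by fun_prop))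
    ((by fun_prop : Measurable fun t : ℝ => √(1 + t ^ 2)).indicator measurableSet_Icc)
    (fun t => indicator_nonneg (fun t _ => Real.sqrt_nonneg _) t)
    (fun y h1 _ => ?_)).congr fun i => ?_
  · rw [indicator_apply]
    split_ifs
    · rw [abs_of_nonneg (Real.sqrt_nonneg _)]
      exact sqrt_sq_add_sq_le h1 h2
    · rw [abs_zero]; positivity
  · simp only [indicator_apply, smul_mem_sector hk]
    split_ifs
    · exact sqrt_sq_add_sq_smul hk
    · simp
  · simp only [indicator_apply, mem_sector_iff h1]
    split_ifs
    · exact sqrt_sq_add_sq_eq h1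
    · simp
  · rw [funext (lengthWeight_ofReal hs)]

end SlopeModel

/-! ### The limit shape -/

namespace Admissible

variable {g : ℝ → ℝ} {M : SlopeModel}

lemma tendsto_rho (h : Admissible g) {n : ℕ → ℕ × ℕ}
    (hlim : Tendsto (fun k => ((n k).2 : ℝ) / ((n k).1 : ℝ)) atTop (𝓝 (g 1))) :
    Tendsto (fun k => rho g (n k)) atTop (𝓝 1) := by
  have := (tendsto_const_nhds (x := g 1)).div hlim h.one_pos.ne'
  rwa [div_self h.one_pos.ne'] at this

/-- Here `α³ = 1/(ρ n₁)`, hence `α³ n₁ = 1/ρ → 1` and `α³ n₂ = (n₂/n₁)/ρ → g(1)`. -/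
lemma regime (h : Admissible g) (hc : M.c = g 1) {n : ℕ → ℕ × ℕ} {σ : ℕ → ℝ}
    (hn1 : ∀ i, 0 < (n i).1) (hn2 : ∀ i, 0 < (n i).2) (hρ : ∀ i, rho g (n i) ∈ Icc (1 / 2 : ℝ) 2)
    (hσ : ∀ i, σ i ∈ Icc (1 / 2 : ℝ) 2) (hσl : Tendsto σ atTop (𝓝 1))
    (hn : Tendsto (fun k => (n k).1) atTop atTop)
    (hlim : Tendsto (fun k => ((n k).2 : ℝ) / ((n k).1 : ℝ)) atTop (𝓝 (g 1))) :
    M.Regime (fun i => alpha g (n i)) (fun i => rho g (n i)) σ n := by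
  have hg := h.one_pos
  have hn1' : ∀ i, (0 : ℝ) < (n i).1 := fun i => by exact_mod_cast hn1 i
  have hρl := h.tendsto_rho hlim
  refine ⟨fun i => alpha_pos hg (hn1 i) (hn2 i), ?_, hρ, hσ, hρl, hσl, ?_, ?_⟩
  · exact (tendsto_rpow_neg_atTop (by norm_num : (0 : ℝ) < 1 / 3)).comp
      (hρl.pos_mul_atTop zero_lt_one (tendsto_natCast_atTop_atTop.comp hn))
  · have := hρl.inv₀ one_ne_zero
    rw [inv_one] at this
    refine this.congr fun i => ?_
    rw [alpha_pow_three hg (hn1 i) (hn2 i), mul_inv, mul_assoc, inv_mul_cancel₀ (hn1' i).ne',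
      mul_one]
  · have := (hρl.inv₀ one_ne_zero).mul hlim
    rw [inv_one, one_mul] at this
    rw [hc]
    refine this.congr fun i => ?_
    rw [alpha_pow_three hg (hn1 i) (hn2 i), mul_inv]
    ring

theorem tendsto_cond_distL (h : Admissible g) (h0 : M.t₀ = slopeFn g 0) (h1 : M.t₁ = slopeFn g 1)
    (hc : M.c = g 1)
    (hE : ∀ u ∈ Icc (0 : ℝ) 1, M.E (slopeFn g u) = kappa * slopeFn' g u ^ (1 / 3 : ℝ))
    {n : ℕ → ℕ × ℕ} {σ : ℕ → ℝ} (hn1 : ∀ i, 0 < (n i).1) (hn2 : ∀ i, 0 < (n i).2)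
    (hreg : M.Regime (fun i => alpha g (n i)) (fun i => rho g (n i)) σ n) {ε : ℝ} (hε : 0 < ε) :
    Tendsto (fun i => ProbabilityTheory.cond
        (geomMeasure (M.param (alpha g (n i)) (rho g (n i)) (σ i))) (linesTo (n i))
        {Γ | distL (((n i).1 : ℝ)⁻¹) Γ g ≤ ENNReal.ofReal ε}) atTop (𝓝 1) := by
  have H1 := h.limitMean_one h0 h1 hE
  have H2 := (h.limitMean_abs h0 h1 hE).trans hc.symm
  obtain ⟨S, hS, hgrid⟩ := h.exists_slope_grid hε
  set μ : ℕ → Measure PolyLine := fun i => ProbabilityTheory.cond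
    (geomMeasure (M.param (alpha g (n i)) (rho g (n i)) (σ i))) (linesTo (n i)) with hμ
  -- The grid needs accuracy `ε/2` after scaling by `1/n₁ = ρ α³`: a deviation below `ε/8` grows by
  -- `ρ ≤ 2`, and replacing `ρ` by `1` costs another `ε/4`.
  let bad : ℕ → ℝ≥0∞ → Set PolyLine := fun i t =>
    {Γ | ε / 8 ≤ |alpha g (n i) ^ 3 * linSum (lengthWeight t) Γ - curveLength g t|}
  have hbad : ∀ t ∈ S, Tendsto (fun i => μ i (bad i t)) atTop (𝓝 0) := by
    intro t ht
    refine hreg.tendsto_cond_deviation H1 H2 (abs_lengthWeight_le t) ?_ (by positivity)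
    rcases hS t ht with rfl | ⟨v, hv, rfl⟩
    · rw [← h.limitMean_length_top h0 h1 hE]
      exact hreg.tendsto_meanSum_length_top
    · rw [← h.limitMean_length h0 h1 hE hv]
      exact hreg.tendsto_meanSum_length (h.slopeFn_nonneg v)
  have hsum : Tendsto (fun i => 1 - ∑ t ∈ S, μ i (bad i t)) atTop (𝓝 1) := by
    have h2 : Tendsto (fun i => ∑ t ∈ S, μ i (bad i t)) atTop (𝓝 0) := by
      simpa using tendsto_finsetSum S hbad
    simpa using ENNReal.Tendsto.sub tendsto_const_nhds h2 (Or.inl ENNReal.one_ne_top)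
  -- The lower bound for the end point also excludes the degenerate case in which `cond` is the zero
  -- measure.
  have hprob : ∀ᶠ i in atTop, IsProbabilityMeasure (μ i) := by
    filter_upwards [hreg.eventually_le_linesTo H1 H2 zero_lt_one] with i hi
    have hα := hreg.pos i
    have := isProbabilityMeasure_geomMeasure (M.param_nonneg _ _ _)
      (M.param_lt_one hα (hreg.ρ_mem i) (hreg.σ_mem i))
      (summable_of_le_exp (mul_pos hα M.rate_pos) (M.param_nonneg _ _ _)
        fun x => M.param_le hα.le (hreg.ρ_mem i) (hreg.σ_mem i) x)
    refine ProbabilityTheory.cond_isProbabilityMeasure (ne_of_gt (lt_of_lt_of_le ?_ hi))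
    exact ENNReal.ofReal_pos.2 (Real.exp_pos _)
  have hρS : ∀ᶠ i in atTop, ∀ t ∈ S, |(rho g (n i) - 1) * curveLength g t| < ε / 4 := by
    rw [Filter.eventually_all_finset]
    intro t _
    have : Tendsto (fun i => |(rho g (n i) - 1) * curveLength g t|) atTop (𝓝 0) := by
      simpa using ((hreg.ρ_lim.sub_const 1).mul_const (curveLength g t)).abs
    exact this.eventually (gt_mem_nhds (by positivity))
  refine tendsto_of_tendsto_of_tendsto_of_le_of_le' hsum tendsto_const_nhds ?_ ?_
  · filter_upwards [hprob, hρS] with i hi hρi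
    have hsub : {Γ : PolyLine | distL (((n i).1 : ℝ)⁻¹) Γ g ≤ ENNReal.ofReal ε}ᶜ ⊆
        ⋃ t ∈ S, bad i t := by
      intro Γ hΓ
      by_contra hcon
      simp only [mem_iUnion, not_exists, bad, mem_ofPred_eq, not_le] at hcon
      refine hΓ (iSup_le fun t => ENNReal.ofReal_le_ofReal ?_)
      refine hgrid (polyLength (((n i).1 : ℝ)⁻¹) Γ) (polyLength_mono _ _) (polyLength_nonneg _ _)
        (fun t ht => ?_) t
      have hρ := hreg.ρ_mem i
      have hscale : ((n i).1 : ℝ)⁻¹ = rho g (n i) * alpha g (n i) ^ 3 := by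
        rw [alpha_pow_three h.one_pos (hn1 i) (hn2 i), mul_inv, mul_inv_cancel_left₀]
        exact (rho_pos h.one_pos (hn1 i) (hn2 i)).ne'
      rw [polyLength_eq (by positivity), hscale, show rho g (n i) * alpha g (n i) ^ 3 *
        linSum (lengthWeight t) Γ - curveLength g t = rho g (n i) *
          (alpha g (n i) ^ 3 * linSum (lengthWeight t) Γ - curveLength g t) +
          (rho g (n i) - 1) * curveLength g t by ring]
      refine (abs_add_le _ _).trans ?_
      rw [abs_mul, abs_of_pos (rho_pos h.one_pos (hn1 i) (hn2 i))]
      have b1 := hcon t ht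
      have b2 := hρi t ht
      have b3 : rho g (n i) * |alpha g (n i) ^ 3 * linSum (lengthWeight t) Γ - curveLength g t| ≤
          2 * (ε / 8) := by
        gcongr
        exact hρ.2
      linarith
    have hle := (measure_mono hsub).trans (measure_biUnion_finset_le S (bad i) (μ := μ i))
    rw [prob_compl_eq_one_sub MeasurableSpace.measurableSet_top] at hle
    exact tsub_le_iff_tsub_le.1 hle
  · filter_upwards [hprob] with i hi
    exact prob_le_one

/-- Positivity of `n` and the bounds on `ρ` and `σ` hold only eventually, whereas `Regime` asks for
them at every index; the limit is therefore taken along the sequence shifted by `N`. -/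
theorem tendsto_P_distL (h : Admissible g) {n : ℕ → ℕ × ℕ} {σ : ℕ → ℝ}
    (hσl : Tendsto σ atTop (𝓝 1)) (hn : Tendsto (fun k => (n k).1) atTop atTop)
    (hlim : Tendsto (fun k => ((n k).2 : ℝ) / ((n k).1 : ℝ)) atTop (𝓝 (g 1))) {ε : ℝ}
    (hε : 0 < ε) :
    Tendsto (fun k => P (tiltedParam g (n k) (σ k)) (n k)
        {Γ | distL (((n k).1 : ℝ)⁻¹) Γ g ≤ ENNReal.ofReal ε}) atTop (𝓝 1) := by
  obtain ⟨M, h0, h1, hc, hE⟩ := h.exists_slopeModel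
  have hg := h.one_pos
  have hρl := h.tendsto_rho hlim
  have hnhds : Icc (1 / 2 : ℝ) 2 ∈ 𝓝 (1 : ℝ) := Icc_mem_nhds (by norm_num) (by norm_num)
  have hev : ∀ᶠ k in atTop, 0 < (n k).1 ∧ 0 < (n k).2 ∧ rho g (n k) ∈ Icc (1 / 2 : ℝ) 2 ∧
      σ k ∈ Icc (1 / 2 : ℝ) 2 := by
    filter_upwards [hn.eventually (eventually_gt_atTop 0), hlim.eventually (lt_mem_nhds hg),
      hρl.eventually hnhds, hσl.eventually hnhds] with k e1 e2 e3 e4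
    refine ⟨e1, Nat.pos_of_ne_zero fun hz => ?_, e3, e4⟩
    simp [hz] at e2
  obtain ⟨N, hN⟩ := eventually_atTop.1 hev
  have hN' := fun k => hN (k + N) (Nat.le_add_left _ _)
  have hshift := tendsto_add_atTop_nat N
  rw [← tendsto_add_atTop_iff_nat N]
  refine (h.tendsto_cond_distL h0 h1 hc hE (n := fun k => n (k + N)) (σ := fun k => σ (k + N))
    (fun k => (hN' k).1) (fun k => (hN' k).2.1)
    (h.regime hc (fun k => (hN' k).1) (fun k => (hN' k).2.1) (fun k => (hN' k).2.2.1)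
      (fun k => (hN' k).2.2.2) (hσl.comp hshift) (hn.comp hshift) (hlim.comp hshift)) hε).congr
    fun k => ?_
  rw [P, h.Q_tiltedParam h0 h1 hc hE (hN' k).1 (hN' k).2.1 (hN' k).2.2.2 (hN' k).2.2.1]

end Admissible

end

end LatticePaths

theorem theorem8p2 (g : ℝ → ℝ)
    (hg0 : g 0 = 0)
    (hg_mono : StrictMonoOn g (Icc 0 1))
    (hg_conv : StrictConvexOn ℝ (Icc 0 1) g)
    (hg_smooth : ContDiffOn ℝ 3 g (Icc 0 1))
    (hg_curv : ∃ K₀ : ℝ, 0 < K₀ ∧ ∀ u ∈ Icc (0 : ℝ) 1, K₀ ≤ LatticePaths.curvature g u)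
    (n : ℕ → ℕ × ℕ)
    (hn : Tendsto (fun k => (n k).1) atTop atTop)
    (hc : Tendsto (fun k => ((n k).2 : ℝ) / ((n k).1 : ℝ)) atTop (𝓝 (g 1)))
    (ε : ℝ) (hε : 0 < ε) :
    Tendsto (fun k => LatticePaths.P (LatticePaths.zParam g (n k)) (n k)
        {Γ | LatticePaths.distL (((n k).1 : ℝ)⁻¹) Γ g ≤ ENNReal.ofReal ε}) atTop (𝓝 1) ∧
    Tendsto (fun k => LatticePaths.P (LatticePaths.zParam' g (n k)) (n k)
        {Γ | LatticePaths.distL (((n k).1 : ℝ)⁻¹) Γ g ≤ ENNReal.ofReal ε}) atTop (𝓝 1) := by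
  have h : LatticePaths.Admissible g := ⟨hg0, hg_mono, hg_conv, hg_smooth, hg_curv⟩
  constructor
  · simp_rw [← LatticePaths.tiltedParam_one]
    exact h.tendsto_P_distL tendsto_const_nhds hn hc hε
  · simp_rw [← LatticePaths.tiltedParam_rho]
    exact h.tendsto_P_distL (h.tendsto_rho hc) hn hc hε
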